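/- Let $P$ be a closed simplicial surface embedded in $\mathbb R^3$: a finite geometric simplicial complex of planar triangles with their edges and vertices (simplices meet only in common faces), in which every edge lies in exactly two triangles, the triangles around each vertex form a single cycle, and no two triangles sharing an edge are coplanar. Let $\chi(P)$ be the number of vertices minus the number of edges plus the number of triangles. Let $\xi\in S^2$ be general for $P$, i.e. $\langle\xi,v\rangle\ne\langle\xi,w\rangle$ for every edge $vw$. The index of a vertex $v$ is $$i(v,\xi)=1-\#\{\text{edges } e\ni v:\ \langle\xi,\cdot\rangle|_e \text{ is maximal at } v\}+\#\{\text{triangles } f\ni v:\ \langle\xi,\cdot\rangle|_f \text{ is maximal at } v\},$$ and $v$ is a critical point of $\langle\xi,\cdot\rangle$ if $i(v,\xi)\neq 0$. Fix an orientation of $P$. The Gauss image of the star of $v$ is the closed spherical polygon that joins, by shortest great circle arcs, the unit normals $n_1,\dots,n_k$ of the triangles around $v$ in their positive cyclic order. The normal degree $d(v,\xi)$ is the number of crossings of the Gauss image with a great circle arc $\gamma$ from $\xi$ to $-\xi$ that contains none of the $n_j$, where a crossing on the edge $n_jn_{j+1}$ is counted with the sign of $\langle n_j\times n_{j+1},\xi\rangle$;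 it does not depend on the choice of $\gamma$. Suppose that $\langle\xi,\cdot\rangle$ has exactly three critical points on $P$. Let $v_+$ and $v_-$ be the vertices where its maximum and its minimum on $P$ are attained, and let $v_0$ be the other critical point. Then $$d(v_0,\xi)=0\qquad\text{and}\qquad i(v_0,\xi)=\chi(P)-2 .$$ In particular, $P$ is not homeomorphic to the sphere $S^2$: no polyhedral embedding of a sphere admits a height function (in a general direction) with exactly three critical points. Furthermore, $P$ is not transversally embedded: no transversally embedded closed polyhedral surface admits such a height function. Here $P$ is transversally embedded if through every vertex $v$ there is a plane to which the star of $v$ (the union of the triangles with corner $v$) projects orthogonally in a one-to-one way. -/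

import Mathlib

noncomputable section

/-- Euclidean three-space. -/
abbrev E3 : Type := EuclideanSpace ℝ (Fin 3)

/-- The cross product on Euclidean three-space. -/
def cross (x y : E3) : E3 := WithLp.toLp 2 (crossProduct x.ofLp y.ofLp)

open Classical in
/-- A closed simplicial surface embedded in Euclidean three-space: a finite geometric simplicial
complex (so simplices are nondegenerate and meet only in common faces) that is a closed
combinatorial surface, and in which no two triangles that share an edge are coplanar. -/
structure SimplicialSurface extends Geometry.SimplicialComplex ℝ E3 where
  /-- there are finitely many simplices -/
  finite : faces.Finite
  /-- every simplex is a face of a triangle -/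
  pure : ∀ s ∈ faces, ∃ t ∈ faces, t.card = 3 ∧ s ⊆ t
  /-- every edge lies in exactly two triangles -/
  two_triangles : ∀ e ∈ faces, e.card = 2 → {t ∈ faces | t.card = 3 ∧ e ⊆ t}.ncard = 2
  /-- the triangles around a vertex form a single cycle: any two of them are joined by a chain of
  triangles around that vertex in which consecutive ones share an edge -/
  star_connected : ∀ v : E3, ∀ s ∈ faces, ∀ t ∈ faces,
    s.card = 3 → t.card = 3 → v ∈ s → v ∈ t →
      Relation.ReflTransGen
        (fun a b : Finset E3 => (a ∈ faces ∧ a.card = 3 ∧ v ∈ a) ∧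
          (b ∈ faces ∧ b.card = 3 ∧ v ∈ b) ∧ (a ∩ b).card = 2) s t
  /-- two triangles that share an edge are not coplanar -/
  not_coplanar : ∀ s ∈ faces, ∀ t ∈ faces,
    s.card = 3 → t.card = 3 → s ≠ t → (s ∩ t).card = 2 →
      ¬ Coplanar ℝ ((s : Set E3) ∪ (t : Set E3))

namespace SimplicialSurface

/-- The simplices with exactly `k` corners: vertices (`k = 1`), edges (`k = 2`) and
triangles (`k = 3`). -/
def simplices (P : SimplicialSurface) (k : ℕ) : Finset (Finset E3) :=
  P.finite.toFinset.filter (fun s => s.card = k)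

open Classical in
/-- The finite set of vertices, as points of space. -/
def verts (P : SimplicialSurface) : Finset E3 := P.finite.toFinset.biUnion id

theorem mem_verts (P : SimplicialSurface) (v : E3) : v ∈ P.verts ↔ v ∈ P.vertices := by
  simp only [verts, Finset.mem_biUnion, Set.Finite.mem_toFinset, id,
    Geometry.SimplicialComplex.mem_vertices]
  constructor
  · rintro ⟨s, hs, hv⟩
    exact P.down_closed hs (Finset.singleton_subset_iff.2 hv) (Finset.singleton_nonempty v)
  · intro h
    exact ⟨{v}, h, Finset.mem_singleton_self v⟩

/-- The Euler characteristic: vertices minus edges plus triangles. -/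
def eulerChar (P : SimplicialSurface) : ℤ :=
  (P.simplices 1).card - (P.simplices 2).card + (P.simplices 3).card

/-- `ξ` is general for `P` if the height `⟨ξ, ·⟩` differs at the two ends of every edge. -/
def IsGeneral (P : SimplicialSurface) (ξ : E3) : Prop :=
  ∀ e ∈ P.simplices 2, ∀ v ∈ e, ∀ w ∈ e, v ≠ w → inner ℝ ξ v ≠ inner ℝ ξ w

open Classical in
/-- The simplices with `k` corners, one of which is `v`, on which `⟨ξ, ·⟩` is maximal at `v`. -/
def simplicesBelow (P : SimplicialSurface) (k : ℕ) (v ξ : E3) : Finset (Finset E3) :=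
  (P.simplices k).filter (fun s => v ∈ s ∧ ∀ w ∈ s, inner ℝ ξ w ≤ inner ℝ ξ v)

/-- The critical point index `i(v, ξ)`. -/
def index (P : SimplicialSurface) (v ξ : E3) : ℤ :=
  1 - (P.simplicesBelow 2 v ξ).card + (P.simplicesBelow 3 v ξ).card

/-- The critical points of the height function `⟨ξ, ·⟩`: the vertices of nonzero index. -/
def criticalPoints (P : SimplicialSurface) (ξ : E3) : Set E3 :=
  {v ∈ P.vertices | P.index v ξ ≠ 0}

/-- The star of `v`, as a point set: the union of the triangles with corner `v`. -/
def star (P : SimplicialSurface) (v : E3) : Set E3 :=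
  ⋃ t ∈ {t ∈ P.simplices 3 | v ∈ t}, convexHull ℝ (t : Set E3)

/-- There is a plane through `v` to which the star of `v` projects orthogonally in a one-to-one
way. The plane has unit normal `n`; the orthogonal projection to it is
`x ↦ x - ⟨n, x - v⟩ n`. -/
def HasTransversePlane (P : SimplicialSurface) (v : E3) : Prop :=
  ∃ n : E3, ‖n‖ = 1 ∧ Set.InjOn (fun x : E3 => x - (inner ℝ n (x - v)) • n) (P.star v)

/-- The embedding is transversal: every vertex possesses a transverse plane. -/
def IsTransversal (P : SimplicialSurface) : Prop :=
  ∀ v ∈ P.vertices, P.HasTransversePlane v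

open Classical in
/-- An orientation of `P`: `pos a b c` says that `a, b, c` are the corners of a triangle listed in
its positive cyclic order. Each triangle has exactly one positive cyclic order, and two triangles
with a common edge induce opposite directions on it. -/
structure Orientation (P : SimplicialSurface) where
  pos : E3 → E3 → E3 → Prop
  mem : ∀ a b c, pos a b c → ({a, b, c} : Finset E3) ∈ P.simplices 3
  rotate : ∀ a b c, pos a b c → pos b c a
  total : ∀ a b c, ({a, b, c} : Finset E3) ∈ P.simplices 3 → pos a b c ∨ pos b a c
  asymm : ∀ a b c, pos a b c → ¬ pos b a c
  coherent : ∀ a b c d, pos a b c → pos a b d → c = d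

end SimplicialSurface

/-- The unit normal of the oriented triangle `a b c`. -/
def unitNormal (a b c : E3) : E3 :=
  ‖cross (b - a) (c - a)‖⁻¹ • cross (b - a) (c - a)

/-- The shorter great circle arc between two points `p ≠ ±q` of the unit sphere. -/
def shortArc (p q : E3) : Set E3 :=
  {x | ‖x‖ = 1 ∧ ∃ a b : ℝ, 0 ≤ a ∧ 0 ≤ b ∧ x = a • p + b • q}

/-- The great circle arc from `ξ` to `-ξ` through `u`, for orthogonal unit vectors `ξ` and `u`. -/
def meridian (ξ u : E3) : Set E3 :=
  {x | ‖x‖ = 1 ∧ ∃ a b : ℝ, 0 ≤ b ∧ x = a • ξ + b • u}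

open Classical in
/-- The signed crossing of the arc `pq` with the meridian from `ξ` to `-ξ` through `u`. -/
def crossingSign (p q ξ u : E3) : ℤ :=
  if (shortArc p q ∩ meridian ξ u).Nonempty then
    (SignType.sign (inner ℝ (cross p q) ξ) : ℤ)
  else 0

namespace SimplicialSurface.Orientation

variable {P : SimplicialSurface}

/-- The meridian from `ξ` to `-ξ` through `u` meets no vertex of the Gauss image of the star of
`v`, the vertices of the Gauss image being the unit normals of the triangles around `v`. -/
def IsAdmissible (o : P.Orientation) (v ξ u : E3) : Prop :=
  ‖u‖ = 1 ∧ inner ℝ ξ u = 0 ∧ ∀ a b : E3, o.pos v a b → unitNormal v a b ∉ meridian ξ u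

open Classical in
/-- The signed number of crossings of the Gauss image of the star of `v` with the meridian from
`ξ` to `-ξ` through `u`. If `a, w, b` are consecutive neighbours of `v` in the positive cyclic
order, then the Gauss image has an edge from the normal of `v a w` to the normal of `v w b`. -/
def degreeAlong (o : P.Orientation) (v ξ u : E3) : ℤ :=
  ∑ a ∈ P.verts, ∑ w ∈ P.verts, ∑ b ∈ P.verts,
    if o.pos v a w ∧ o.pos v w b then
      crossingSign (unitNormal v a w) (unitNormal v w b) ξ u
    else 0

/-- The normal degree of the star of `v` at `ξ` is `d`: admissible meridians exist, and `d` is the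
signed number of crossings of the Gauss image with each of them. -/
def HasNormalDegree (o : P.Orientation) (v ξ : E3) (d : ℤ) : Prop :=
  (∃ u, o.IsAdmissible v ξ u) ∧ ∀ u, o.IsAdmissible v ξ u → o.degreeAlong v ξ u = d

end SimplicialSurface.Orientation

end

noncomputable section

open Classical

/-! ### Edges, third corners, orientations and links -/

namespace SimplicialSurface

variable {P : SimplicialSurface}

/-! The index of a vertex measures how its link crosses the horizontal plane through it: it is one
minus the number of passages from below to above (`index_eq`). Every simplex has one highest corner,
so the indices add up to the Euler characteristic (`sum_index`). The highest and the lowest vertex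
have index 1, which leaves χ(P) − 2 for the third critical point v₀.

Degree. A small perturbation of ξ separates the heights of all vertices and changes no index
(`frequently_threeCritical`). Passing a vertex of index 0 keeps a level set connected, because one
arc of edges coming up to the vertex is exchanged for one arc of edges going on. Working up from the
lowest vertex and, with −ξ, down from the highest, one finds that the slices of P just below and
just above v₀ are each a single simple closed polygon (`cutConnected_lt`, `cutConnected_le`,
`CutConnected.sameCycle`). The turning of a slice at the point of an edge depends only on that edge;
counted as a signed crossing of a fixed ray, it is the crossing of the corresponding edge of the
Gauss image with a meridian, so the turnings of the edges at v₀ add up to the normal degree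
(`degreeAlong_eq_sum_edgeTurning`). On the other hand, as in Hopf's proof of the Umlaufsatz, the
total turning of a simple polygon is expressed by the angles that it sweeps as seen from the two
ends of one side (`sum_rayCrossing_polyline`, `sum_rayCrossing_cycle`). If that side stays away from
v₀, these angles do not jump at the level of v₀ (`eventually_sweep_eq`), where the slices from below
and from above have the same limit (`sum_slices_eq`). Hence the total turnings below and above
agree. Edges that cross both levels cancel, and the edges at v₀ have total turning zero
(`sum_edgeTurning_link`). The value of the total turning itself is never needed.

Transversality. If the star of v₀ projects injectively along n, the projected neighbours turn around
v₀ exactly once. Their scalar products with the projected normals tell which neighbours are below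
v₀, and comparing the two rotations shows that they differ by the number of passages
(`sum_arg_div_eq_sub`). Degree zero then forces exactly one passage, that is index zero, which is
excluded (`false_of_inner_cross_pos`).

Spheres. The vertex v₀ has neighbours above and below (`exists_above`, `exists_below`), so its
nonzero index is at most −1 and χ(P) ≤ 1. On a sphere every circle valued map lifts to the reals, so
every integral cocycle is a coboundary (`exists_primitive`), and counting ranks gives χ(P) ≥ 2
(`two_le_eulerChar`).

All this is done with an orientation of P. It exists because P is embedded: the parity of the number
of triangles met by a generic ray distinguishes the two sides of each triangle
(`nonempty_orientation`). -/

theorem mem_simplices {k : ℕ} {s : Finset E3} : s ∈ P.simplices k ↔ s ∈ P.faces ∧ s.card = k := by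
  simp [simplices]

/-- Two vertices are adjacent if they are the ends of an edge. -/
def Adj (P : SimplicialSurface) (a b : E3) : Prop := a ≠ b ∧ ({a, b} : Finset E3) ∈ P.faces

theorem Adj.symm {a b : E3} (h : P.Adj a b) : P.Adj b a :=
  ⟨h.1.symm, by rw [Finset.pair_comm]; exact h.2⟩

theorem Adj.mem_left {a b : E3} (h : P.Adj a b) : a ∈ P.verts := by
  rw [mem_verts]
  exact P.down_closed h.2 (by simp) (by simp)

theorem Adj.mem_right {a b : E3} (h : P.Adj a b) : b ∈ P.verts := h.symm.mem_left

theorem Adj.edge_mem {a b : E3} (h : P.Adj a b) : ({a, b} : Finset E3) ∈ P.simplices 2 :=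
  mem_simplices.2 ⟨h.2, Finset.card_pair h.1⟩

theorem IsGeneral.ne {ξ a b : E3} (hg : P.IsGeneral ξ) (h : P.Adj a b) :
    inner ℝ ξ a ≠ inner ℝ ξ b :=
  hg _ h.edge_mem a (by simp) b (by simp) h.1

theorem adj_of_mem {s : Finset E3} (hs : s ∈ P.faces) {a b : E3} (ha : a ∈ s) (hb : b ∈ s)
    (hab : a ≠ b) : P.Adj a b :=
  ⟨hab, P.down_closed hs (by intro x; simp; rintro (rfl | rfl) <;> assumption) (by simp)⟩

theorem mem_verts_of_mem {s : Finset E3} (hs : s ∈ P.faces) {a : E3} (ha : a ∈ s) : a ∈ P.verts := by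
  rw [mem_verts]
  exact P.down_closed hs (by simpa using ha) (by simp)

theorem exists_eq_insert_of_card_eq_three {s : Finset E3} (hs : s.card = 3) {a b : E3} (ha : a ∈ s)
    (hb : b ∈ s) (hab : a ≠ b) : ∃ c, c ≠ a ∧ c ≠ b ∧ s = {a, b, c} := by
  have h1 : ((s.erase a).erase b).card = 1 := by
    rw [Finset.card_erase_of_mem (by simp [hb, hab.symm]), Finset.card_erase_of_mem ha, hs]
  obtain ⟨c, hc⟩ := Finset.card_eq_one.1 h1
  refine ⟨c, ?_, ?_, ?_⟩
  · rintro rfl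
    have : c ∈ (s.erase c).erase b := by rw [hc]; simp
    simp at this
  · rintro rfl
    have : c ∈ (s.erase a).erase c := by rw [hc]; simp
    simp at this
  · rw [← hc, Finset.insert_erase (by simp [hb, hab.symm]), Finset.insert_erase ha]

theorem Adj.exists_third {a b : E3} (h : P.Adj a b) : ∃ c d, c ≠ d ∧ c ≠ a ∧ c ≠ b ∧ d ≠ a ∧ d ≠ b ∧
    ({a, b, c} : Finset E3) ∈ P.simplices 3 ∧ ({a, b, d} : Finset E3) ∈ P.simplices 3 ∧
    ∀ t ∈ P.simplices 3, a ∈ t → b ∈ t → t = {a, b, c} ∨ t = {a, b, d} := by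
  have h2 := P.two_triangles {a, b} h.2 (Finset.card_pair h.1)
  obtain ⟨s, t, hst, hs⟩ := Set.ncard_eq_two.1 h2
  have hs' : s ∈ ({s, t} : Set (Finset E3)) := by simp
  have ht' : t ∈ ({s, t} : Set (Finset E3)) := by simp
  rw [← hs] at hs' ht'
  obtain ⟨hsf, hs3, hsab⟩ := hs'
  obtain ⟨htf, ht3, htab⟩ := ht'
  obtain ⟨c, hca, hcb, rfl⟩ := exists_eq_insert_of_card_eq_three hs3 (hsab (by simp : a ∈ _))
    (hsab (by simp : b ∈ _)) h.1
  obtain ⟨d, hda, hdb, rfl⟩ := exists_eq_insert_of_card_eq_three ht3 (htab (by simp : a ∈ _))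
    (htab (by simp : b ∈ _)) h.1
  refine ⟨c, d, ?_, hca, hcb, hda, hdb, mem_simplices.2 ⟨hsf, hs3⟩, mem_simplices.2 ⟨htf, ht3⟩, ?_⟩
  · rintro rfl; exact hst rfl
  · intro r hr ha hb
    rw [mem_simplices] at hr
    have : r ∈ {t ∈ P.faces | t.card = 3 ∧ {a, b} ⊆ t} := ⟨hr.1, hr.2, by
      intro x; simp; rintro (rfl | rfl) <;> assumption⟩
    rw [hs] at this
    simpa using this

namespace Orientation

variable (o : P.Orientation)

theorem rotate' {a b c : E3} (h : o.pos a b c) : o.pos c a b := o.rotate _ _ _ (o.rotate _ _ _ h)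

theorem face {a b c : E3} (h : o.pos a b c) : ({a, b, c} : Finset E3) ∈ P.faces :=
  (mem_simplices.1 (o.mem _ _ _ h)).1

theorem ne {a b c : E3} (h : o.pos a b c) : a ≠ b := by
  rintro rfl
  exact o.asymm _ _ _ h h

theorem adj {a b c : E3} (h : o.pos a b c) : P.Adj a b :=
  adj_of_mem (o.face h) (by simp) (by simp) (o.ne h)

theorem adj₂ {a b c : E3} (h : o.pos a b c) : P.Adj b c := o.adj (o.rotate _ _ _ h)

theorem adj₃ {a b c : E3} (h : o.pos a b c) : P.Adj c a := o.adj (o.rotate' h)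

/-- If neither of the two triangles at the edge induced the direction from `a` to `b`, both would
induce the opposite one, and coherence would identify their third corners. -/
theorem exists_pos {a b : E3} (h : P.Adj a b) : ∃ c, o.pos a b c := by
  obtain ⟨c, d, hcd, -, -, -, -, hc, hd, -⟩ := h.exists_third
  rcases o.total _ _ _ hc with h1 | h1
  · exact ⟨c, h1⟩
  rcases o.total _ _ _ hd with h2 | h2
  · exact ⟨d, h2⟩
  exact absurd (o.coherent _ _ _ _ h1 h2) hcd

/-- The third corner of the triangle on the positive side of a directed edge. -/
def opp (a b : E3) : E3 := if h : ∃ c, o.pos a b c then h.choose else 0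

theorem pos_opp {a b : E3} (h : P.Adj a b) : o.pos a b (o.opp a b) := by
  have h' := o.exists_pos h
  rw [opp, dif_pos h']
  exact h'.choose_spec

theorem opp_eq {a b c : E3} (h : o.pos a b c) : o.opp a b = c :=
  o.coherent _ _ _ _ (o.pos_opp (o.adj h)) h

theorem opp_eq₂ {a b c : E3} (h : o.pos a b c) : o.opp b c = a := o.opp_eq (o.rotate _ _ _ h)

theorem opp_eq₃ {a b c : E3} (h : o.pos a b c) : o.opp c a = b := o.opp_eq (o.rotate' h)

end Orientation

/-- The neighbours of a vertex. -/
def link (P : SimplicialSurface) (v : E3) : Finset E3 := P.verts.filter (P.Adj v)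

theorem mem_link {v a : E3} : a ∈ P.link v ↔ P.Adj v a := by
  simp only [link, Finset.mem_filter, and_iff_right_iff_imp]
  exact fun h => h.mem_right

namespace Orientation

variable (o : P.Orientation)

/-- The next neighbour of `v` in the positive cyclic order. -/
def rot (v : E3) : Equiv.Perm (P.link v) where
  toFun a := ⟨o.opp v a, mem_link.2 (o.adj₃ (o.pos_opp (mem_link.1 a.2))).symm⟩
  invFun b := ⟨o.opp b v, mem_link.2 (o.adj₂ (o.pos_opp (mem_link.1 b.2).symm))⟩
  left_inv a := by
    ext1
    exact o.opp_eq₃ (o.pos_opp (mem_link.1 a.2))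
  right_inv b := by
    ext1
    exact o.opp_eq₂ (o.pos_opp (mem_link.1 b.2).symm)

theorem pos_rot (v : E3) (a : P.link v) : o.pos v a (o.rot v a) := o.pos_opp (mem_link.1 a.2)

theorem rot_eq {v a b : E3} (h : o.pos v a b) :
    o.rot v ⟨a, mem_link.2 (o.adj h)⟩ = ⟨b, mem_link.2 (o.adj₃ h).symm⟩ := by
  ext1
  exact o.opp_eq h

/-- A property of the neighbours of `v` that is invariant under rotation holds for all or none. -/
theorem link_connected {v : E3} {g : E3 → Prop} (hg : ∀ a b, o.pos v a b → (g a ↔ g b)) {a b : E3}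
    (ha : P.Adj v a) (hb : P.Adj v b) : g a ↔ g b := by
  -- Within one triangle, the two corners other than `v` are consecutive in one of the two
  -- directions.
  have key : ∀ s ∈ P.faces, s.card = 3 → v ∈ s → ∀ x ∈ s, ∀ y ∈ s, x ≠ v → y ≠ v → (g x ↔ g y) := by
    intro s hs h3 hv x hx y hy hxv hyv
    by_cases hxy : x = y
    · rw [hxy]
    obtain ⟨z, hzv, hzx, hsz⟩ := exists_eq_insert_of_card_eq_three h3 hv hx hxv.symm
    have hyz : y = z := by
      rw [hsz] at hy
      simp only [Finset.mem_insert, Finset.mem_singleton] at hy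
      tauto
    subst hyz
    have hs' : ({v, x, y} : Finset E3) ∈ P.simplices 3 := mem_simplices.2 ⟨hsz ▸ hs, hsz ▸ h3⟩
    rcases o.total _ _ _ hs' with h | h
    · exact hg _ _ h
    · exact (hg _ _ (o.rotate _ _ _ h)).symm
  have key2 : ∀ s t, s ∈ P.faces → s.card = 3 → v ∈ s → Relation.ReflTransGen
        (fun a b : Finset E3 => (a ∈ P.faces ∧ a.card = 3 ∧ v ∈ a) ∧
          (b ∈ P.faces ∧ b.card = 3 ∧ v ∈ b) ∧ (a ∩ b).card = 2) s t →
      (t ∈ P.faces ∧ t.card = 3 ∧ v ∈ t) ∧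
        ∀ x ∈ s, ∀ y ∈ t, x ≠ v → y ≠ v → (g x ↔ g y) := by
    intro s t hs h3 hv hst
    induction hst with
    | refl => exact ⟨⟨hs, h3, hv⟩, key s hs h3 hv⟩
    | tail h1 h2 ih =>
      rename_i b c
      obtain ⟨⟨hb, hb3, hbv⟩, ⟨hc, hc3, hcv⟩, hbc⟩ := h2
      refine ⟨⟨hc, hc3, hcv⟩, ?_⟩
      intro x hx y hy hxv hyv
      -- Consecutive triangles share an edge, hence a corner besides `v` that carries the property
      -- over.
      have : ∃ z ∈ b ∩ c, z ≠ v := by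
        by_contra hcon
        push Not at hcon
        have : b ∩ c ⊆ {v} := fun z hz => by simpa using hcon z hz
        have := Finset.card_le_card this
        simp at this
        omega
      obtain ⟨z, hz, hzv⟩ := this
      rw [Finset.mem_inter] at hz
      exact (ih.2 x hx z hz.1 hxv hzv).trans (key c hc hc3 hcv z hz.2 y hy hzv hyv)
  have h1 := o.pos_opp ha
  have h2 := o.pos_opp hb
  have t1 := mem_simplices.1 (o.mem _ _ _ h1)
  have t2 := mem_simplices.1 (o.mem _ _ _ h2)
  exact (key2 _ _ t1.1 t1.2 (by simp) (P.star_connected v _ t1.1 _ t2.1 t1.2 t2.2 (by simp)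
    (by simp))).2 a (by simp) b (by simp) ha.1.symm hb.1.symm

end Orientation

theorem link_nonempty {v : E3} (hv : v ∈ P.verts) : ∃ a, P.Adj v a := by
  rw [mem_verts] at hv
  obtain ⟨t, ht, h3, hvt⟩ := P.pure _ hv
  have hvt : v ∈ t := hvt (by simp)
  obtain ⟨a, ha, hav⟩ : ∃ a ∈ t, a ≠ v := by
    by_contra hcon
    push Not at hcon
    have : t ⊆ {v} := fun z hz => by simpa using hcon z hz
    have := Finset.card_le_card this
    simp at this
    omega
  exact ⟨a, adj_of_mem ht hvt ha hav.symm⟩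

/-! ### The index as a count of passages through the link -/

namespace Orientation

variable (o : P.Orientation)

theorem simplicesBelow_two_card {ξ : E3} (hg : P.IsGeneral ξ) (v : E3) :
    (P.simplicesBelow 2 v ξ).card =
      (Finset.univ.filter (fun a : P.link v => inner ℝ ξ (a : E3) < inner ℝ ξ v)).card := by
  symm
  refine Finset.card_bij (fun a _ => {v, (a : E3)}) ?_ ?_ ?_
  · intro a ha
    have hva := mem_link.1 a.2
    simp only [Finset.mem_filter, Finset.mem_univ, true_and] at ha
    simp only [simplicesBelow, Finset.mem_filter]
    exact ⟨hva.edge_mem, by simp, by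
      intro w hw; simp at hw; rcases hw with rfl | rfl
      · exact le_rfl
      · exact ha.le⟩
  · intro a ha b hb hab
    have hva := mem_link.1 a.2
    have : (a : E3) ∈ ({v, (b : E3)} : Finset E3) := by rw [← hab]; simp
    simp only [Finset.mem_insert, Finset.mem_singleton] at this
    rcases this with h | h
    · exact absurd h.symm hva.1
    · exact Subtype.ext h
  · intro s hs
    simp only [simplicesBelow, Finset.mem_filter] at hs
    obtain ⟨hs, hv, hmax⟩ := hs
    have hs2 := mem_simplices.1 hs
    obtain ⟨x, y, hxy, rfl⟩ := Finset.card_eq_two.1 hs2.2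
    have : ∃ a, P.Adj v a ∧ ({x, y} : Finset E3) = {v, a} := by
      simp only [Finset.mem_insert, Finset.mem_singleton] at hv
      rcases hv with rfl | rfl
      · exact ⟨y, ⟨hxy, hs2.1⟩, rfl⟩
      · exact ⟨x, Adj.symm ⟨hxy, hs2.1⟩, Finset.pair_comm _ _⟩
    obtain ⟨a, ha, he⟩ := this
    refine ⟨⟨a, mem_link.2 ha⟩, ?_, he.symm⟩
    simp only [Finset.mem_filter, Finset.mem_univ, true_and]
    exact lt_of_le_of_ne (hmax a (by rw [he]; simp)) (hg.ne ha).symm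

/-- A triangle is recorded by the first of its two neighbours of `v` in the positive cyclic order;
asymmetry of the orientation prevents the second one from recording it as well. -/
theorem simplicesBelow_three_card {ξ : E3} (hg : P.IsGeneral ξ) (v : E3) :
    (P.simplicesBelow 3 v ξ).card =
      (Finset.univ.filter (fun a : P.link v => inner ℝ ξ (a : E3) < inner ℝ ξ v ∧
        inner ℝ ξ (o.rot v a : E3) < inner ℝ ξ v)).card := by
  symm
  refine Finset.card_bij (fun a _ => {v, (a : E3), (o.rot v a : E3)}) ?_ ?_ ?_
  · intro a ha
    have hp := o.pos_rot v a
    simp only [Finset.mem_filter, Finset.mem_univ, true_and] at ha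
    simp only [simplicesBelow, Finset.mem_filter]
    refine ⟨o.mem _ _ _ hp, by simp, ?_⟩
    intro w hw
    simp only [Finset.mem_insert, Finset.mem_singleton] at hw
    rcases hw with rfl | rfl | rfl
    · exact le_rfl
    · exact ha.1.le
    · exact ha.2.le
  · intro a ha b hb hab
    have hpa := o.pos_rot v a
    have hpb := o.pos_rot v b
    have h1 : (a : E3) ∈ ({v, (b : E3), (o.rot v b : E3)} : Finset E3) := by rw [← hab]; simp
    have h2 : (b : E3) ∈ ({v, (a : E3), (o.rot v a : E3)} : Finset E3) := by rw [hab]; simp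
    simp only [Finset.mem_insert, Finset.mem_singleton] at h1 h2
    have hav := o.ne hpa
    have hbv := o.ne hpb
    rcases h1 with h | h | h
    · exact absurd h.symm hav
    · exact Subtype.ext h
    rcases h2 with h' | h' | h'
    · exact absurd h'.symm hbv
    · exact (Subtype.ext h').symm
    · rw [← h] at hpb
      rw [← h'] at hpa
      exact absurd (o.rotate _ _ _ hpb) (o.asymm _ _ _ (o.rotate _ _ _ hpa))
  · intro s hs
    simp only [simplicesBelow, Finset.mem_filter] at hs
    obtain ⟨hs, hv, hmax⟩ := hs
    have hs3 := mem_simplices.1 hs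
    obtain ⟨x, hx, hxv⟩ : ∃ a ∈ s, a ≠ v := by
      by_contra hcon
      push Not at hcon
      have : s ⊆ {v} := fun z hz => by simpa using hcon z hz
      have := Finset.card_le_card this
      simp at this
      omega
    obtain ⟨y, hyv, hyx, rfl⟩ := exists_eq_insert_of_card_eq_three hs3.2 hv hx hxv.symm
    have hvx := adj_of_mem hs3.1 hv hx hxv.symm
    have hvy : P.Adj v y := adj_of_mem hs3.1 hv (by simp) hyv.symm
    have lx : inner ℝ ξ x < inner ℝ ξ v := lt_of_le_of_ne (hmax x (by simp)) (hg.ne hvx).symm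
    have ly : inner ℝ ξ y < inner ℝ ξ v := lt_of_le_of_ne (hmax y (by simp)) (hg.ne hvy).symm
    rcases o.total _ _ _ hs with h | h
    · refine ⟨⟨x, mem_link.2 hvx⟩, ?_, ?_⟩
      · simp only [Finset.mem_filter, Finset.mem_univ, true_and, o.rot_eq h]; exact ⟨lx, ly⟩
      · rw [o.rot_eq h]
    · have h' := o.rotate _ _ _ h
      refine ⟨⟨y, mem_link.2 hvy⟩, ?_, ?_⟩
      · simp only [Finset.mem_filter, Finset.mem_univ, true_and, o.rot_eq h']; exact ⟨ly, lx⟩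
      · rw [o.rot_eq h']
        ext z; simp; tauto

/-- The index of `v` is one minus the number of passages from below to above in the link. -/
theorem index_eq {ξ : E3} (hg : P.IsGeneral ξ) (v : E3) :
    P.index v ξ = 1 - (Finset.univ.filter (fun a : P.link v => inner ℝ ξ (a : E3) < inner ℝ ξ v ∧
        inner ℝ ξ v < inner ℝ ξ (o.rot v a : E3))).card := by
  rw [index, simplicesBelow_two_card hg v, o.simplicesBelow_three_card hg v]
  -- The lower neighbours are split by whether their successor is also below, so edges minus
  -- triangles counts those whose successor is above.
  have := Finset.card_filter_add_card_filter_not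
    (s := Finset.univ.filter (fun a : P.link v => inner ℝ ξ (a : E3) < inner ℝ ξ v))
    (fun a : P.link v => inner ℝ ξ (o.rot v a : E3) < inner ℝ ξ v)
  rw [Finset.filter_filter, Finset.filter_filter] at this
  have h2 : (Finset.univ.filter (fun a : P.link v => inner ℝ ξ (a : E3) < inner ℝ ξ v ∧
        ¬ inner ℝ ξ (o.rot v a : E3) < inner ℝ ξ v)) =
      (Finset.univ.filter (fun a : P.link v => inner ℝ ξ (a : E3) < inner ℝ ξ v ∧
        inner ℝ ξ v < inner ℝ ξ (o.rot v a : E3))) := by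
    ext a
    have := hg.ne (mem_link.1 (o.rot v a).2)
    simp only [Finset.mem_filter, Finset.mem_univ, true_and, not_lt, and_congr_right_iff]
    exact fun _ => ⟨fun h => lt_of_le_of_ne h this, fun h => h.le⟩
  rw [h2] at this
  omega

end Orientation

/-- Along a permutation of a finite set, a subset is left as often as it is entered. -/
theorem card_leave_eq_card_enter {ι : Type*} [Fintype ι] (σ : Equiv.Perm ι) (p : ι → Prop)
    [DecidablePred fun a => p a ∧ ¬ p (σ a)] [DecidablePred fun a => ¬ p a ∧ p (σ a)] :
    (Finset.univ.filter (fun a => p a ∧ ¬ p (σ a))).card =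
      (Finset.univ.filter (fun a => ¬ p a ∧ p (σ a))).card := by
  -- The increments of the indicator of `p` along `σ` add up to zero; each of them is an entry minus
  -- a departure.
  have h : ∑ a, ((if p (σ a) then 1 else 0 : ℤ) - if p a then 1 else 0) = 0 := by
    rw [Finset.sum_sub_distrib, Equiv.sum_comp σ (fun a => if p a then (1 : ℤ) else 0), sub_self]
  have h' : ∑ a, ((if ¬ p a ∧ p (σ a) then 1 else 0 : ℤ) - if p a ∧ ¬ p (σ a) then 1 else 0) = 0 := by
    refine Eq.trans (Finset.sum_congr rfl fun a _ => ?_) h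
    by_cases h1 : p a <;> by_cases h2 : p (σ a) <;> simp [h1, h2]
  rw [Finset.sum_sub_distrib, Finset.sum_boole, Finset.sum_boole, sub_eq_zero] at h'
  exact_mod_cast h'.symm

end SimplicialSurface

/-! ### Indices and the Euler characteristic -/

namespace SimplicialSurface

variable {P : SimplicialSurface}

theorem IsGeneral.ne_of_mem {ξ : E3} (hg : P.IsGeneral ξ) {s : Finset E3} (hs : s ∈ P.faces)
    {a b : E3} (ha : a ∈ s) (hb : b ∈ s) (hab : a ≠ b) : inner ℝ ξ a ≠ inner ℝ ξ b :=
  hg.ne (adj_of_mem hs ha hb hab)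

/-- Double counting: by generality each simplex has exactly one highest corner. -/
theorem sum_card_simplicesBelow {ξ : E3} (hg : P.IsGeneral ξ) (k : ℕ) :
    ∑ v ∈ P.verts, (P.simplicesBelow k v ξ).card = (P.simplices k).card := by
  have h := Finset.sum_card_bipartiteAbove_eq_sum_card_bipartiteBelow (s := P.verts)
    (t := P.simplices k) (fun v s => v ∈ s ∧ ∀ w ∈ s, inner ℝ ξ w ≤ inner ℝ ξ v)
  have h1 : ∀ v, P.simplicesBelow k v ξ = Finset.bipartiteAbove
      (fun v s => v ∈ s ∧ ∀ w ∈ s, inner ℝ ξ w ≤ inner ℝ ξ v) (P.simplices k) v := by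
    intro v
    ext s
    simp [simplicesBelow, Finset.mem_bipartiteAbove]
  simp only [h1]
  rw [h, Finset.card_eq_sum_ones]
  refine Finset.sum_congr rfl fun s hs => ?_
  have hs' := mem_simplices.1 hs
  obtain ⟨x, hx, hmax⟩ := s.exists_max_image (fun w => inner ℝ ξ w) (P.nonempty_of_mem_faces hs'.1)
  rw [Finset.card_eq_one]
  refine ⟨x, ?_⟩
  ext y
  simp only [Finset.mem_bipartiteBelow, Finset.mem_singleton]
  constructor
  · rintro ⟨-, hy, hymax⟩
    by_contra hne
    exact hg.ne_of_mem hs'.1 hy hx hne (le_antisymm (hmax y hy) (hymax x hx))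
  · rintro rfl
    exact ⟨mem_verts_of_mem hs'.1 hx, hx, hmax⟩

theorem card_simplices_one : (P.simplices 1).card = P.verts.card := by
  symm
  refine Finset.card_bij (fun v _ => {v}) ?_ ?_ ?_
  · intro v hv
    exact mem_simplices.2 ⟨(P.mem_verts v).1 hv, Finset.card_singleton v⟩
  · intro v _ w _ h
    simpa using h
  · intro s hs
    obtain ⟨hs, h1⟩ := mem_simplices.1 hs
    obtain ⟨v, rfl⟩ := Finset.card_eq_one.1 h1
    exact ⟨v, (P.mem_verts v).2 hs, rfl⟩

/-- The indices of a general height function add up to the Euler characteristic. -/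
theorem sum_index {ξ : E3} (hg : P.IsGeneral ξ) : ∑ v ∈ P.verts, P.index v ξ = P.eulerChar := by
  simp only [index, Finset.sum_add_distrib, Finset.sum_sub_distrib]
  rw [eulerChar, card_simplices_one, ← sum_card_simplicesBelow hg 2, ← sum_card_simplicesBelow hg 3]
  simp

/-- If all vertices but three have index zero, then the indices of these add up to the Euler
characteristic. -/
theorem index_add_index_add_index {ξ : E3} (hg : P.IsGeneral ξ) {a b c : E3} (ha : a ∈ P.verts)
    (hb : b ∈ P.verts) (hc : c ∈ P.verts) (hab : a ≠ b) (hac : a ≠ c) (hbc : b ≠ c)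
    (h0 : ∀ x ∈ P.verts, x ≠ a → x ≠ b → x ≠ c → P.index x ξ = 0) :
    P.index a ξ + P.index b ξ + P.index c ξ = P.eulerChar := by
  rw [← sum_index hg, ← Finset.sum_subset (s₁ := {a, b, c})]
  · rw [Finset.sum_insert (by simp [hab, hac]), Finset.sum_pair hbc, add_assoc]
  · intro x
    simp only [Finset.mem_insert, Finset.mem_singleton]
    rintro (rfl | rfl | rfl) <;> assumption
  · intro x hx hn
    simp only [Finset.mem_insert, Finset.mem_singleton, not_or] at hn
    exact h0 x hx hn.1 hn.2.1 hn.2.2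

namespace Orientation

theorem index_eq_one_of_above (o : P.Orientation) {ξ v : E3} (hg : P.IsGeneral ξ)
    (h : ∀ a, P.Adj v a → inner ℝ ξ v < inner ℝ ξ a) : P.index v ξ = 1 := by
  rw [o.index_eq hg, Finset.filter_false_of_mem]
  · simp
  · intro a _ ha
    exact lt_asymm ha.1 (h a (mem_link.1 a.2))

theorem index_eq_one_of_below (o : P.Orientation) {ξ v : E3} (hg : P.IsGeneral ξ)
    (h : ∀ a, P.Adj v a → inner ℝ ξ a < inner ℝ ξ v) : P.index v ξ = 1 := by
  rw [o.index_eq hg, Finset.filter_false_of_mem]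
  · simp
  · intro a _ ha
    exact lt_asymm ha.2 (h _ (mem_link.1 (o.rot v a).2))

theorem isGeneral_neg {ξ : E3} (hg : P.IsGeneral ξ) : P.IsGeneral (-ξ) := by
  intro e he v hv w hw hvw
  simpa using hg e he v hv w hw hvw

/-- Reversing `ξ` exchanges the passages upwards and downwards, and along the closed link there are
equally many of both. -/
theorem index_neg (o : P.Orientation) {ξ : E3} (hg : P.IsGeneral ξ) (v : E3) : P.index v (-ξ) = P.index v ξ := by
  rw [o.index_eq hg, o.index_eq (isGeneral_neg hg)]
  have h := card_leave_eq_card_enter (o.rot v) (fun a => inner ℝ ξ (a : E3) < inner ℝ ξ v)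
  have h1 : ∀ a : P.link v, ¬ inner ℝ ξ (a : E3) < inner ℝ ξ v ↔ inner ℝ ξ v < inner ℝ ξ (a : E3) := by
    intro a
    have := hg.ne (mem_link.1 a.2)
    rw [not_lt]
    exact ⟨fun h => lt_of_le_of_ne h this, fun h => h.le⟩
  simp only [h1] at h
  simp only [inner_neg_left, neg_lt_neg_iff]
  rw [h]

/-- If a property of the neighbours of `v` is entered only once in the cyclic order, then the
neighbours with this property are connected. -/
theorem arc_connected (o : P.Orientation) {v : E3} {p g : E3 → Prop}
    [DecidablePred fun a : P.link v => ¬ p a ∧ p (o.rot v a)]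
    (h1 : (Finset.univ.filter (fun a : P.link v => ¬ p a ∧ p (o.rot v a))).card = 1)
    (hg : ∀ a b, o.pos v a b → p a → p b → (g a ↔ g b)) {a b : E3} (ha : P.Adj v a)
    (hb : P.Adj v b) (hpa : p a) (hpb : p b) : g a ↔ g b := by
  -- Entered once means left once; `w` is the only exit.
  replace h1 := (card_leave_eq_card_enter (o.rot v) (fun a : P.link v => p (a : E3))).trans
    (by convert h1)
  rw [Finset.card_eq_one] at h1
  obtain ⟨w, hw⟩ := h1
  have hw' : p w ∧ ¬ p (o.rot v w) := by
    have : w ∈ ({w} : Finset _) := by simp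
    rw [← hw] at this
    simpa using this
  have key : ∀ x, P.Adj v x → p x → (g x ↔ g w) := by
    by_contra hcon
    push Not at hcon
    obtain ⟨x, hx, hpx, hgx⟩ := hcon
    have hgx' : ¬ (g x ↔ g w) := by tauto
    -- The neighbours in `p` that disagree with `w` are never left: that would require leaving `p`,
    -- which happens only at `w`. So they are never entered either, and form all of the link or none
    -- of it; `w` is not among them.
    have hleave : (Finset.univ.filter (fun a : P.link v => (p a ∧ ¬ (g a ↔ g w)) ∧
        ¬ (p (o.rot v a) ∧ ¬ (g (o.rot v a) ↔ g w)))).card = 0 := by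
      rw [Finset.card_eq_zero, Finset.filter_eq_empty_iff]
      rintro a - ⟨⟨hpa, hga⟩, hn⟩
      have hpr : p (o.rot v a) := by
        by_contra hpr
        have : a ∈ ({w} : Finset _) := by
          rw [← hw]; simp [hpa, hpr]
        rw [Finset.mem_singleton] at this
        exact hga (by rw [this])
      have := hg _ _ (o.pos_rot v a) hpa hpr
      tauto
    have henter := hleave
    rw [card_leave_eq_card_enter (o.rot v) (fun a : P.link v => p a ∧ ¬ (g a ↔ g w)),
      Finset.card_eq_zero, Finset.filter_eq_empty_iff] at henter
    rw [Finset.card_eq_zero, Finset.filter_eq_empty_iff] at hleave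
    have := o.link_connected (v := v) (g := fun a => p a ∧ ¬ (g a ↔ g w)) (a := x) (b := w) (by
      intro a b hab
      have e1 := o.rot_eq hab
      have l := hleave (Finset.mem_univ (⟨a, mem_link.2 (o.adj hab)⟩ : P.link v))
      have e := henter (Finset.mem_univ (⟨a, mem_link.2 (o.adj hab)⟩ : P.link v))
      rw [e1] at l e
      simp only at l e
      tauto) hx (mem_link.1 w.2)
    tauto
  exact (key a ha hpa).trans (key b hb hpb).symm

/-! ### Connected cuts -/

/-- The edges that lead out of `L` are connected through the triangles that they lie in. -/
def CutConnected (o : P.Orientation) (L : Set E3) : Prop :=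
  ∀ g : E3 → E3 → Prop, (∀ a b c, o.pos a b c → a ∈ L → b ∉ L →
      (c ∈ L → (g a b ↔ g c b)) ∧ (c ∉ L → (g a b ↔ g a c))) →
    ∀ a b a' b', P.Adj a b → a ∈ L → b ∉ L → P.Adj a' b' → a' ∈ L → b' ∉ L → (g a b ↔ g a' b')

variable {o : P.Orientation}

theorem CutConnected.congr {L L' : Set E3} (h : o.CutConnected L)
    (hL : ∀ x ∈ P.verts, x ∈ L ↔ x ∈ L') : o.CutConnected L' := by
  intro g hg a b a' b' hab ha hb hab' ha' hb'
  refine h g ?_ a b a' b' hab ((hL a hab.mem_left).2 ha) (fun h => hb ((hL b hab.mem_right).1 h)) hab'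
    ((hL _ hab'.mem_left).2 ha') (fun h => hb' ((hL _ hab'.mem_right).1 h))
  intro a b c hp ha hb
  rw [hL a (o.adj hp).mem_left] at ha
  rw [hL b (o.adj hp).mem_right] at hb
  rw [hL c (o.adj₂ hp).mem_right]
  exact hg a b c hp ha hb

/-- A set and its complement have the same outgoing edges up to direction. -/
theorem CutConnected.compl {L : Set E3} (h : o.CutConnected Lᶜ) : o.CutConnected L := by
  intro g hg a b a' b' hab ha hb hab' ha' hb'
  refine h (fun x y => g y x) ?_ b a b' a' hab.symm hb (fun h => h ha) hab'.symm hb' (fun h => h ha')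
  intro x y z hp hx hy
  have hy' : y ∈ L := not_not.1 hy
  refine ⟨fun hz => ?_, fun hz => ?_⟩
  · exact ((hg y z x (o.rotate _ _ _ hp) hy' hz).2 hx).symm
  · have hz' : z ∈ L := not_not.1 hz
    exact ((hg z x y (o.rotate' hp) hz' hx).1 hy').symm

/-- The edges out of a single vertex correspond to its link, which is one cycle. -/
theorem CutConnected.singleton (o : P.Orientation) (v : E3) : o.CutConnected {v} := by
  intro g hg a b a' b' hab ha hb hab' ha' hb'
  rw [Set.mem_singleton_iff] at ha ha'
  subst ha ha'
  refine o.link_connected (g := fun x => g a' x) ?_ hab hab'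
  intro x y hp
  exact (hg a' x y hp rfl (o.ne hp).symm).2 (o.adj₃ hp).1

/-- By `h1` the link of `v` leaves `L` once, so the neighbours outside `L` form one arc. Adding `v`
replaces the edges from `L` to `v` by the edges from `v` to this arc, and the cut stays connected.
-/
theorem CutConnected.insert {L : Set E3} (h : o.CutConnected L) {v : E3} (hv : v ∉ L)
    (h1 : (Finset.univ.filter (fun a : P.link v => ¬ (a : E3) ∉ L ∧ (o.rot v a : E3) ∉ L)).card = 1) :
    o.CutConnected (insert v L) := by
  intro g hg
  obtain ⟨d, hd⟩ : ∃ d : P.link v, ¬ (d : E3) ∉ L ∧ (o.rot v d : E3) ∉ L := by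
    obtain ⟨d, hd⟩ := Finset.card_eq_one.1 h1
    have : d ∈ ({d} : Finset _) := by simp
    rw [← hd] at this
    exact ⟨d, by simpa using this⟩
  set u : E3 := (o.rot v d : E3) with hu
  have hvu : P.Adj v u := mem_link.1 (o.rot v d).2
  have hvd : P.Adj v d := mem_link.1 d.2
  have hup : ∀ x, P.Adj v x → x ∉ L → (g v x ↔ g v u) := by
    intro x hx hxL
    refine o.arc_connected (p := fun x => x ∉ L) (g := fun x => g v x) h1 ?_ hx hvu hxL hd.2
    intro a b hab ha hb
    refine (hg v a b hab (Set.mem_insert _ _) ?_).2 ?_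
    · rintro (h | h)
      · exact (o.ne hab) h.symm
      · exact ha h
    · rintro (h | h)
      · exact (o.adj₃ hab).1 h
      · exact hb h
  have hni : ∀ x, x ≠ v → x ∉ L → x ∉ Insert.insert v L := by
    rintro x h1 h2 (h | h)
    · exact h1 h
    · exact h2 h
  -- A property on the new cut is pulled back to the old one by giving every edge into `v` the
  -- common value of the edges out of `v`.
  have hpull := h (fun a b => if b = v then g v u else g a b) (by
    intro a b c hp ha hb
    have hav : a ≠ v := by rintro rfl; exact hv ha
    by_cases hbv : b = v
    · subst hbv
      have hcb : c ≠ b := (o.adj₂ hp).1.symm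
      refine ⟨fun hc => by simp, fun hc => ?_⟩
      simp only [if_true, if_neg hcb]
      have e1 := (hg b c a (o.rotate _ _ _ hp) (Set.mem_insert _ _) (hni c hcb hc)).1
        (Set.mem_insert_of_mem _ ha)
      exact (hup c (o.adj₂ hp) hc).symm.trans e1
    · by_cases hcv : c = v
      · subst hcv
        refine ⟨fun hc => absurd hc hv, fun _ => ?_⟩
        simp only [if_true, if_neg hbv]
        have e1 := (hg a b c hp (Set.mem_insert_of_mem _ ha) (hni b hbv hb)).1 (Set.mem_insert _ _)
        exact e1.trans (hup b (o.adj₂ hp).symm hb)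
      · simp only [if_neg hbv, if_neg hcv]
        have e1 := hg a b c hp (Set.mem_insert_of_mem _ ha) (hni b hbv hb)
        exact ⟨fun hc => e1.1 (Set.mem_insert_of_mem _ hc), fun hc => e1.2 (hni c hcv hc)⟩)
  have key : ∀ a b, P.Adj a b → a ∈ Insert.insert v L → b ∉ Insert.insert v L → (g a b ↔ g v u) := by
    intro a b hab ha hb
    have hbv : b ≠ v := by rintro rfl; exact hb (Set.mem_insert _ _)
    have hbL : b ∉ L := fun h => hb (Set.mem_insert_of_mem _ h)
    rcases ha with rfl | ha
    · exact hup b hab hbL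
    · have := hpull a b d v hab ha hbL hvd.symm (not_not.1 hd.1) hv
      simpa only [if_neg hbv, if_true] using this
  intro a b a' b' hab ha hb hab' ha' hb'
  exact (key a b hab ha hb).trans (key a' b' hab' ha' hb').symm

/-- The cut below a level is connected if all vertices below, except for the lowest one, have
index zero. -/
theorem cutConnected_lt {ξ : E3} (o : P.Orientation) (hg : P.IsGeneral ξ)
    (hinj : Set.InjOn (fun x : E3 => inner ℝ ξ x) P.verts) {m : E3}
    (hm : ∀ x ∈ P.verts, inner ℝ ξ m ≤ inner ℝ ξ x) (hmv : m ∈ P.verts) (t : ℝ)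
    (h0 : ∀ x ∈ P.verts, inner ℝ ξ x < t → x ≠ m → P.index x ξ = 0) :
    o.CutConnected {x | inner ℝ ξ x < t} := by
  -- Induction on the number of vertices below the level. The highest of them is either the minimum,
  -- whose cut is its link, or a vertex of index zero that is added to the set below it.
  induction hn : (P.verts.filter (fun x => inner ℝ ξ x < t)).card using Nat.strong_induction_on
    generalizing t with
  | _ n ih =>
  by_cases hne : (P.verts.filter (fun x => inner ℝ ξ x < t)).Nonempty
  · obtain ⟨v, hv, hmax⟩ := (P.verts.filter (fun x => inner ℝ ξ x < t)).exists_max_image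
      (fun x => inner ℝ ξ x) hne
    simp only [Finset.mem_filter] at hv hmax
    by_cases hvm : v = m
    · subst hvm
      refine (CutConnected.singleton o v).congr ?_
      intro x hx
      simp only [Set.mem_singleton_iff, Set.mem_ofPred_eq]
      constructor
      · rintro rfl; exact hv.2
      · intro hxt
        exact hinj hx hv.1 (le_antisymm (hmax x ⟨hx, hxt⟩) (hm x hx))
    · have hlt : (P.verts.filter (fun x => inner ℝ ξ x < inner ℝ ξ v)).card < n := by
        rw [← hn]
        refine Finset.card_lt_card ⟨?_, fun hsub => ?_⟩
        · intro x hx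
          simp only [Finset.mem_filter] at hx ⊢
          exact ⟨hx.1, hx.2.trans hv.2⟩
        · have := hsub (Finset.mem_filter.2 hv)
          simp at this
      have h1 := ih _ hlt (inner ℝ ξ v) (fun x hx hxv hxm => h0 x hx (hxv.trans hv.2) hxm) rfl
      have hi := h0 v hv.1 hv.2 hvm
      rw [o.index_eq hg] at hi
      refine (h1.insert (v := v) (by simp) ?_).congr ?_
      · rw [← Nat.cast_inj (R := ℤ), Nat.cast_one]
        refine Eq.trans ?_ (sub_eq_zero.1 hi).symm
        congr 2
        ext a
        have := hg.ne (mem_link.1 (o.rot v a).2)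
        simp only [Set.mem_ofPred_eq, not_lt, not_le, Finset.mem_filter, Finset.mem_univ, true_and,
          and_congr_right_iff]
        exact fun _ => ⟨fun h => lt_of_le_of_ne h this, fun h => h.le⟩
      · intro x hx
        simp only [Set.mem_insert_iff, Set.mem_ofPred_eq]
        constructor
        · rintro (rfl | h)
          · exact hv.2
          · exact h.trans hv.2
        · intro hxt
          rcases (hmax x ⟨hx, hxt⟩).lt_or_eq with h | h
          · exact Or.inr h
          · exact Or.inl (hinj hx hv.1 h)
  · intro g _ a b a' b' hab ha
    exact absurd ⟨a, Finset.mem_filter.2 ⟨hab.mem_left, ha⟩⟩ hne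

end Orientation

/-! ### Height functions with three critical points -/

/-- The height `⟨ξ, ·⟩` separates the vertices, and its critical points are its highest vertex
`top`, its lowest vertex `bot`, and one further vertex `mid`. -/
structure ThreeCritical (P : SimplicialSurface) (ξ top bot mid : E3) : Prop where
  general : P.IsGeneral ξ
  inj : Set.InjOn (fun x : E3 => inner ℝ ξ x) P.verts
  top_mem : top ∈ P.verts
  bot_mem : bot ∈ P.verts
  mid_mem : mid ∈ P.verts
  le_top : ∀ x ∈ P.verts, inner ℝ ξ x ≤ inner ℝ ξ top
  bot_le : ∀ x ∈ P.verts, inner ℝ ξ bot ≤ inner ℝ ξ x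
  mid_ne_top : mid ≠ top
  mid_ne_bot : mid ≠ bot
  index_eq_zero : ∀ x ∈ P.verts, x ≠ top → x ≠ bot → x ≠ mid → P.index x ξ = 0
  index_ne_zero : P.index mid ξ ≠ 0

namespace ThreeCritical

variable {ξ top bot mid : E3}

theorem neg (h : P.ThreeCritical ξ top bot mid) (o : P.Orientation) :
    P.ThreeCritical (-ξ) bot top mid where
  general := Orientation.isGeneral_neg h.general
  inj := by
    intro x hx y hy hxy
    exact h.inj hx hy (by simpa using hxy)
  top_mem := h.bot_mem
  bot_mem := h.top_mem
  mid_mem := h.mid_mem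
  le_top := by simpa using h.bot_le
  bot_le := by simpa using h.le_top
  mid_ne_top := h.mid_ne_bot
  mid_ne_bot := h.mid_ne_top
  index_eq_zero := fun x hx h1 h2 h3 => by
    rw [o.index_neg h.general]; exact h.index_eq_zero x hx h2 h1 h3
  index_ne_zero := by rw [o.index_neg h.general]; exact h.index_ne_zero

theorem bot_lt_mid (h : P.ThreeCritical ξ top bot mid) : inner ℝ ξ bot < inner ℝ ξ mid :=
  lt_of_le_of_ne (h.bot_le _ h.mid_mem) fun e => h.mid_ne_bot (h.inj h.bot_mem h.mid_mem e).symm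

theorem mid_lt_top (h : P.ThreeCritical ξ top bot mid) : inner ℝ ξ mid < inner ℝ ξ top :=
  lt_of_le_of_ne (h.le_top _ h.mid_mem) fun e => h.mid_ne_top (h.inj h.mid_mem h.top_mem e)

theorem cutConnected_lt (h : P.ThreeCritical ξ top bot mid) (o : P.Orientation) :
    o.CutConnected {x | inner ℝ ξ x < inner ℝ ξ mid} := by
  refine o.cutConnected_lt h.general h.inj h.bot_le h.bot_mem _ ?_
  intro x hx hlt hxb
  refine h.index_eq_zero x hx ?_ hxb ?_
  · rintro rfl; exact lt_asymm hlt h.mid_lt_top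
  · rintro rfl; exact lt_irrefl _ hlt

/-- For `-ξ`, the vertices below `mid` are those above it for `ξ`; their complement is the set in
question. -/
theorem cutConnected_le (h : P.ThreeCritical ξ top bot mid) (o : P.Orientation) :
    o.CutConnected {x | inner ℝ ξ x ≤ inner ℝ ξ mid} := by
  have h1 := (h.neg o).cutConnected_lt o
  refine Orientation.CutConnected.compl (h1.congr ?_)
  intro x _
  simp

/-- If all neighbours of `mid` were below it, ending at `mid` would be an invariant property of the
edges in the cut below `mid`, so all of these edges would end at `mid`. The lowest vertex above
`mid` would then be a local minimum, of index one, though it is neither critical nor the top. -/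
theorem exists_above (h : P.ThreeCritical ξ top bot mid) (o : P.Orientation) :
    ∃ u, P.Adj mid u ∧ inner ℝ ξ mid < inner ℝ ξ u := by
  by_contra hcon
  push Not at hcon
  have hdown : ∀ u, P.Adj mid u → inner ℝ ξ u < inner ℝ ξ mid := fun u hu =>
    lt_of_le_of_ne (hcon u hu) (h.general.ne hu).symm
  have hconn := h.cutConnected_lt o (fun _ b => b = mid) (by
    intro a b c hp ha hb
    refine ⟨fun _ => Iff.rfl, fun hc => ⟨?_, ?_⟩⟩
    · rintro rfl
      exact absurd (hdown c (o.adj₂ hp)) hc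
    · rintro rfl
      exact absurd (hdown b (o.adj₂ hp).symm) hb)
  obtain ⟨a₀, ha₀⟩ := link_nonempty h.mid_mem
  have hend : ∀ a b, P.Adj a b → inner ℝ ξ a < inner ℝ ξ mid → inner ℝ ξ mid ≤ inner ℝ ξ b →
      b = mid := by
    intro a b hab ha hb
    exact (hconn a b a₀ mid hab ha (not_lt.2 hb) ha₀.symm (hdown _ ha₀) (by simp)).2 rfl
  obtain ⟨x, hx, hmin⟩ := (P.verts.filter (fun x => inner ℝ ξ mid < inner ℝ ξ x)).exists_min_image
      (fun x => inner ℝ ξ x) ⟨top, Finset.mem_filter.2 ⟨h.top_mem, h.mid_lt_top⟩⟩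
  simp only [Finset.mem_filter] at hx hmin
  have hxup : ∀ y, P.Adj x y → inner ℝ ξ x < inner ℝ ξ y := by
    intro y hxy
    refine lt_of_le_of_ne ?_ (h.general.ne hxy)
    rcases lt_trichotomy (inner ℝ ξ y) (inner ℝ ξ mid) with hlt | heq | hgt
    · exact absurd (hend y x hxy.symm hlt hx.2.le) (by rintro rfl; exact lt_irrefl _ hx.2)
    · have := h.inj hxy.mem_right h.mid_mem heq
      subst this
      exact absurd (hdown x hxy.symm) (lt_asymm hx.2)
    · exact hmin y ⟨hxy.mem_right, hgt⟩
  have hi := o.index_eq_one_of_above h.general hxup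
  have hxtop : x ≠ top := by
    rintro rfl
    obtain ⟨y, hy⟩ := link_nonempty hx.1
    exact absurd (hxup y hy) (not_lt.2 (h.le_top y hy.mem_right))
  have := h.index_eq_zero x hx.1 hxtop
    (by rintro rfl; exact lt_asymm hx.2 h.bot_lt_mid) (by rintro rfl; exact lt_irrefl _ hx.2)
  omega

theorem exists_below (h : P.ThreeCritical ξ top bot mid) (o : P.Orientation) :
    ∃ u, P.Adj mid u ∧ inner ℝ ξ u < inner ℝ ξ mid := by
  obtain ⟨u, hu, h'⟩ := (h.neg o).exists_above o
  exact ⟨u, hu, by simpa using h'⟩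

/-- There is an edge of a triangle at `mid` that crosses the level of `mid`. -/
theorem exists_mixed (h : P.ThreeCritical ξ top bot mid) (o : P.Orientation) :
    ∃ a b, o.pos mid a b ∧ inner ℝ ξ a < inner ℝ ξ mid ∧ inner ℝ ξ mid < inner ℝ ξ b := by
  by_contra hcon
  push Not at hcon
  obtain ⟨u, hu, hu'⟩ := h.exists_above o
  obtain ⟨d, hd, hd'⟩ := h.exists_below o
  have h0 : (Finset.univ.filter (fun a : P.link mid => inner ℝ ξ (a : E3) < inner ℝ ξ mid ∧
      ¬ inner ℝ ξ (o.rot mid a : E3) < inner ℝ ξ mid)).card = 0 := by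
    rw [Finset.card_eq_zero, Finset.filter_eq_empty_iff]
    rintro a - ⟨h1, h2⟩
    have h3 := hcon a _ (o.pos_rot mid a) h1
    exact h.general.ne (mem_link.1 (o.rot mid a).2) (le_antisymm (not_lt.1 h2) h3)
  have h1 := h0
  rw [card_leave_eq_card_enter (o.rot mid) (fun a => inner ℝ ξ (a : E3) < inner ℝ ξ mid),
      Finset.card_eq_zero, Finset.filter_eq_empty_iff] at h1
  rw [Finset.card_eq_zero, Finset.filter_eq_empty_iff] at h0
  have := o.link_connected (v := mid) (g := fun a => inner ℝ ξ a < inner ℝ ξ mid) (by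
    intro a b hab
    have e1 := o.rot_eq hab
    have l := h0 (Finset.mem_univ (⟨a, mem_link.2 (o.adj hab)⟩ : P.link mid))
    have e := h1 (Finset.mem_univ (⟨a, mem_link.2 (o.adj hab)⟩ : P.link mid))
    rw [e1] at l e
    simp only at l e
    tauto) hu hd
  exact lt_asymm hu' (this.2 hd')

/-- There is at least one passage, so the index is at most zero, and it is not zero. -/
theorem index_le (h : P.ThreeCritical ξ top bot mid) (o : P.Orientation) : P.index mid ξ ≤ -1 := by
  have h0 := h.index_ne_zero
  obtain ⟨a, b, hp, ha, hb⟩ := h.exists_mixed o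
  rw [o.index_eq h.general] at h0 ⊢
  have : 0 < (Finset.univ.filter (fun a : P.link mid => inner ℝ ξ (a : E3) < inner ℝ ξ mid ∧
        inner ℝ ξ mid < inner ℝ ξ (o.rot mid a : E3))).card := by
    rw [Finset.card_pos]
    refine ⟨⟨a, mem_link.2 (o.adj hp)⟩, ?_⟩
    simp only [Finset.mem_filter, Finset.mem_univ, true_and, o.rot_eq hp]
    exact ⟨ha, hb⟩
  omega

end ThreeCritical

end SimplicialSurface

/-! ### Crossings with a ray and a discrete Umlaufsatz -/

/-- The signed number of crossings of the segment from `z` to `z'` with the ray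
`{(0, p) | 0 < p}`. Points of the ray count as lying on its left side. -/
def rayCrossing (z z' : ℝ × ℝ) : ℤ :=
  (if z.1 ≤ 0 ∧ 0 < z'.1 ∧ 0 < z.2 * z'.1 - z'.2 * z.1 then 1 else 0) -
    (if z'.1 ≤ 0 ∧ 0 < z.1 ∧ 0 < z'.2 * z.1 - z.2 * z'.1 then 1 else 0)

theorem rayCrossing_comm (z z' : ℝ × ℝ) : rayCrossing z' z = -rayCrossing z z' := by
  simp only [rayCrossing, neg_sub]

theorem rayCrossing_self (z : ℝ × ℝ) : rayCrossing z z = 0 := by simp [rayCrossing]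

theorem rayCrossing_zero_left (z : ℝ × ℝ) : rayCrossing 0 z = 0 := by simp [rayCrossing]

theorem rayCrossing_zero_right (z : ℝ × ℝ) : rayCrossing z 0 = 0 := by simp [rayCrossing]

theorem rayCrossing_smul {r s : ℝ} (hr : 0 < r) (hs : 0 < s) (z z' : ℝ × ℝ) :
    rayCrossing (r • z) (s • z') = rayCrossing z z' := by
  have e1 : r * z.2 * (s * z'.1) - s * z'.2 * (r * z.1) = (r * s) * (z.2 * z'.1 - z'.2 * z.1) := by
    ring
  have e2 : s * z'.2 * (r * z.1) - r * z.2 * (s * z'.1) = (r * s) * (z'.2 * z.1 - z.2 * z'.1) := by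
    ring
  have h1 : ∀ x : ℝ, r * x ≤ 0 ↔ x ≤ 0 := fun x => by
    rw [← not_lt, ← not_lt, mul_pos_iff_of_pos_left hr]
  have h2 : ∀ x : ℝ, s * x ≤ 0 ↔ x ≤ 0 := fun x => by
    rw [← not_lt, ← not_lt, mul_pos_iff_of_pos_left hs]
  simp only [rayCrossing, Prod.smul_fst, Prod.smul_snd, smul_eq_mul, e1, e2,
    mul_pos_iff_of_pos_left (mul_pos hr hs), mul_pos_iff_of_pos_left hr, mul_pos_iff_of_pos_left hs,
    h1, h2]

/-- On a convex set that misses the origin, the crossing number is a coboundary. -/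
theorem exists_rayCrossing_eq_sub {K : Set (ℝ × ℝ)} (hK : Convex ℝ K) (h0 : (0 : ℝ × ℝ) ∉ K) :
    ∃ F : ℝ × ℝ → ℤ, ∀ z ∈ K, ∀ z' ∈ K, rayCrossing z z' = F z' - F z := by
  -- The point where the segment meets the second axis; its position has the sign of the determinant
  -- in `rayCrossing`.
  have cross : ∀ z ∈ K, ∀ z' ∈ K, z.1 ≤ 0 → 0 < z'.1 →
      ((0 : ℝ), (z.2 * z'.1 - z'.2 * z.1) / (z'.1 - z.1)) ∈ K := by
    intro z hz z' hz' h1 h2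
    have hd : 0 < z'.1 - z.1 := by linarith
    have := hK hz hz' (a := z'.1 / (z'.1 - z.1)) (b := -z.1 / (z'.1 - z.1))
      (by positivity) (div_nonneg (by linarith) hd.le) (by field_simp; ring)
    convert this using 1
    ext
    · simp; field_simp; ring
    · simp; field_simp; ring
  by_cases hA : ∃ p : ℝ, 0 < p ∧ ((0 : ℝ), p) ∈ K
  · obtain ⟨p, hp, hpK⟩ := hA
    -- Otherwise the origin would lie between two points of `K`.
    have hpos : ∀ p' : ℝ, ((0 : ℝ), p') ∈ K → 0 < p' := by
      intro p' hp'
      by_contra hcon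
      push Not at hcon
      apply h0
      have hd : 0 < p - p' := by linarith
      have := hK hpK hp' (a := -p' / (p - p')) (b := p / (p - p'))
        (div_nonneg (by linarith) hd.le) (by positivity) (by field_simp; ring)
      convert this using 1
      ext
      · simp
      · simp; field_simp; ring
    -- Inside `K` every crossing of the axis is a crossing of the ray, so only the sides of the axis
    -- matter.
    refine ⟨fun z => if 0 < z.1 then 1 else 0, fun z hz z' hz' => ?_⟩
    have c1 : z.1 ≤ 0 → 0 < z'.1 → 0 < z.2 * z'.1 - z'.2 * z.1 := fun h1 h2 => by
      have := hpos _ (cross z hz z' hz' h1 h2)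
      exact (div_pos_iff_of_pos_right (by linarith)).1 this
    have c2 : z'.1 ≤ 0 → 0 < z.1 → 0 < z'.2 * z.1 - z.2 * z'.1 := fun h1 h2 => by
      have := hpos _ (cross z' hz' z hz h1 h2)
      exact (div_pos_iff_of_pos_right (by linarith)).1 this
    simp only [rayCrossing]
    by_cases h1 : 0 < z.1 <;> by_cases h2 : 0 < z'.1
    · simp [h1, h2, h1.not_ge, h2.not_ge]
    · simp [h1, h2, h1.not_ge, not_lt.1 h2, c2 (not_lt.1 h2) h1]
    · simp [h1, h2, not_lt.1 h1, h2.not_ge, c1 (not_lt.1 h1) h2]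
    · simp [h1, h2]
  · push Not at hA
    refine ⟨fun _ => 0, fun z hz z' hz' => ?_⟩
    have c1 : ¬ (z.1 ≤ 0 ∧ 0 < z'.1 ∧ 0 < z.2 * z'.1 - z'.2 * z.1) := fun ⟨h1, h2, h3⟩ =>
      hA _ (div_pos h3 (by linarith)) (cross z hz z' hz' h1 h2)
    have c2 : ¬ (z'.1 ≤ 0 ∧ 0 < z.1 ∧ 0 < z'.2 * z.1 - z.2 * z'.1) := fun ⟨h1, h2, h3⟩ =>
      hA _ (div_pos h3 (by linarith)) (cross z' hz' z hz h1 h2)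
    rw [rayCrossing, if_neg c1, if_neg c2, sub_zero]

open scoped Pointwise in
/-- The crossing numbers around the four differences of two disjoint segments. -/
theorem rayCrossing_square {a b c d : ℝ × ℝ}
    (h : ∀ x ∈ segment ℝ a b, ∀ y ∈ segment ℝ c d, x ≠ y) :
    rayCrossing (d - a) (d - b) - rayCrossing (c - a) (c - b) =
      rayCrossing (c - b) (d - b) - rayCrossing (c - a) (d - a) := by
  -- The difference set of disjoint segments is convex and misses the origin.
  obtain ⟨F, hF⟩ := exists_rayCrossing_eq_sub
    (K := (segment ℝ c d - segment ℝ a b : Set (ℝ × ℝ)))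
    ((convex_segment c d).sub (convex_segment a b)) (by
      rintro ⟨y, hy, x, hx, hxy⟩
      exact h x hx y hy (sub_eq_zero.1 hxy).symm)
  have ha := left_mem_segment ℝ a b
  have hb := right_mem_segment ℝ a b
  have hc := left_mem_segment ℝ c d
  have hd := right_mem_segment ℝ c d
  rw [hF _ (Set.sub_mem_sub hd ha) _ (Set.sub_mem_sub hd hb),
    hF _ (Set.sub_mem_sub hc ha) _ (Set.sub_mem_sub hc hb),
    hF _ (Set.sub_mem_sub hc hb) _ (Set.sub_mem_sub hd hb),
    hF _ (Set.sub_mem_sub hc ha) _ (Set.sub_mem_sub hd ha)]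
  ring

/-- The exterior angle of a triangle is the sum of the opposite interior angles. -/
theorem rayCrossing_triangle {z w : ℝ × ℝ}
    (h : ∀ a b : ℝ, 0 ≤ a → 0 ≤ b → a • z + b • w = 0 → a = 0 ∧ b = 0) :
    rayCrossing z w = rayCrossing z (z + w) + rayCrossing (z + w) w := by
  -- The nonnegative combinations of total weight at least one form a convex set that contains `z`,
  -- `w` and `z + w`, but not the origin.
  obtain ⟨F, hF⟩ := exists_rayCrossing_eq_sub
    (K := {x | ∃ a b : ℝ, 0 ≤ a ∧ 0 ≤ b ∧ 1 ≤ a + b ∧ x = a • z + b • w}) (by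
      rintro x ⟨a, b, ha, hb, hab, rfl⟩ y ⟨a', b', ha', hb', hab', rfl⟩ r s hr hs hrs
      refine ⟨r * a + s * a', r * b + s * b', by positivity, by positivity, ?_, by module⟩
      nlinarith) (by
      rintro ⟨a, b, ha, hb, hab, h0⟩
      obtain ⟨rfl, rfl⟩ := h a b ha hb h0.symm
      norm_num at hab)
  have hz : z ∈ {x | ∃ a b : ℝ, 0 ≤ a ∧ 0 ≤ b ∧ 1 ≤ a + b ∧ x = a • z + b • w} :=
    ⟨1, 0, by norm_num, by norm_num, by norm_num, by simp⟩
  have hw : w ∈ {x | ∃ a b : ℝ, 0 ≤ a ∧ 0 ≤ b ∧ 1 ≤ a + b ∧ x = a • z + b • w} :=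
    ⟨0, 1, by norm_num, by norm_num, by norm_num, by simp⟩
  have hzw : z + w ∈ {x | ∃ a b : ℝ, 0 ≤ a ∧ 0 ≤ b ∧ 1 ≤ a + b ∧ x = a • z + b • w} :=
    ⟨1, 1, by norm_num, by norm_num, by norm_num, by simp⟩
  rw [hF z hz w hw, hF z hz _ hzw, hF _ hzw w hw]
  ring

/-- The total turning of a simple polyline is the sum of the angles that it sweeps as seen from its
two ends: a discrete form of Hopf's Umlaufsatz. -/
theorem sum_rayCrossing_polyline (q : ℕ → ℝ × ℝ) (k : ℕ)
    (hdisj : ∀ i j, i + 1 < j → j ≤ k → ∀ x ∈ segment ℝ (q i) (q (i + 1)),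
      ∀ y ∈ segment ℝ (q j) (q (j + 1)), x ≠ y)
    (hturn : ∀ i, i < k → ∀ a b : ℝ, 0 ≤ a → 0 ≤ b →
      a • (q (i + 1) - q i) + b • (q (i + 2) - q (i + 1)) = 0 → a = 0 ∧ b = 0) :
    ∑ i ∈ Finset.range k, rayCrossing (q (i + 1) - q i) (q (i + 2) - q (i + 1)) =
      ∑ i ∈ Finset.range k, rayCrossing (q (i + 1) - q 0) (q (i + 2) - q 0) +
        ∑ i ∈ Finset.range k, rayCrossing (q (k + 1) - q i) (q (k + 1) - q (i + 1)) := by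
  induction k with
  | zero => simp
  | succ k ih =>
    have ih' := ih (fun i j h1 h2 => hdisj i j h1 (by omega)) (fun i hi => hturn i (by omega))
    rw [Finset.sum_range_succ, ih', Finset.sum_range_succ, Finset.sum_range_succ]
    -- The far end moves along the new side, which is disjoint from all earlier sides but the last;
    -- the identities for pairs of disjoint sides telescope.
    have hsq : ∑ i ∈ Finset.range k, rayCrossing (q (k + 2) - q i) (q (k + 2) - q (i + 1)) -
        ∑ i ∈ Finset.range k, rayCrossing (q (k + 1) - q i) (q (k + 1) - q (i + 1)) =
        rayCrossing (q (k + 1) - q k) (q (k + 2) - q k) -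
          rayCrossing (q (k + 1) - q 0) (q (k + 2) - q 0) := by
      rw [← Finset.sum_sub_distrib,
        ← Finset.sum_range_sub (fun i => rayCrossing (q (k + 1) - q i) (q (k + 2) - q i)) k]
      refine Finset.sum_congr rfl fun i hi => ?_
      rw [Finset.mem_range] at hi
      exact rayCrossing_square (hdisj i (k + 1) (by omega) le_rfl)
    -- The turning at the former end is split along the diagonal from `q k` to `q (k + 2)`.
    have htri := rayCrossing_triangle (hturn k (by omega))
    have e : q (k + 1) - q k + (q (k + 2) - q (k + 1)) = q (k + 2) - q k := by abel
    rw [e] at htri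
    rw [htri]
    linarith

open Filter Topology in
/-- The crossing number does not change under small perturbations. -/
theorem eventually_rayCrossing_eq {α : Type*} {l : Filter α} {z z' : α → ℝ × ℝ} {a a' : ℝ × ℝ}
    (hz : Tendsto z l (𝓝 a)) (hz' : Tendsto z' l (𝓝 a')) (h : a.1 = 0 → a.2 < 0)
    (h' : a'.1 = 0 → a'.2 < 0) (hd : a.1 * a'.1 < 0 → a.2 * a'.1 - a'.2 * a.1 ≠ 0) :
    ∀ᶠ x in l, rayCrossing (z x) (z' x) = rayCrossing a a' := by
  have ht : Tendsto (fun x => (z x).1) l (𝓝 a.1) := (continuous_fst.tendsto a).comp hz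
  have hp : Tendsto (fun x => (z x).2) l (𝓝 a.2) := (continuous_snd.tendsto a).comp hz
  have ht' : Tendsto (fun x => (z' x).1) l (𝓝 a'.1) := (continuous_fst.tendsto a').comp hz'
  have hp' : Tendsto (fun x => (z' x).2) l (𝓝 a'.2) := (continuous_snd.tendsto a').comp hz'
  have hD : Tendsto (fun x => (z x).2 * (z' x).1 - (z' x).2 * (z x).1) l
      (𝓝 (a.2 * a'.1 - a'.2 * a.1)) := (hp.mul ht').sub (hp'.mul ht)
  -- Once the determinant has a definite sign, only one of the two terms can be nonzero, and it
  -- depends on the first coordinates alone.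
  have main : ∀ y y' : ℝ × ℝ, 0 < y.2 * y'.1 - y'.2 * y.1 →
      rayCrossing y y' = if y.1 ≤ 0 ∧ 0 < y'.1 then 1 else 0 := by
    intro y y' hy
    have : ¬ (0 < y'.2 * y.1 - y.2 * y'.1) := by linarith
    simp only [rayCrossing, hy, this, and_false, if_false, and_true, sub_zero]
  have main' : ∀ y y' : ℝ × ℝ, y.2 * y'.1 - y'.2 * y.1 < 0 →
      rayCrossing y y' = if y'.1 ≤ 0 ∧ 0 < y.1 then -1 else 0 := by
    intro y y' hy
    have h1 : ¬ (0 < y.2 * y'.1 - y'.2 * y.1) := by linarith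
    have h2 : 0 < y'.2 * y.1 - y.2 * y'.1 := by linarith
    simp only [rayCrossing, h1, h2, and_false, if_false, and_true, zero_sub]
    split_ifs <;> simp
  rcases lt_trichotomy a.1 0 with ha | ha | ha <;> rcases lt_trichotomy a'.1 0 with ha' | ha' | ha'
  · filter_upwards [ht.eventually_lt_const ha, ht'.eventually_lt_const ha'] with x h1 h2
    simp [rayCrossing, h1.not_gt, h2.not_gt, ha.not_gt, ha'.not_gt]
  · have := h' ha'
    have hD0 : a.2 * a'.1 - a'.2 * a.1 < 0 := by rw [ha']; nlinarith
    filter_upwards [ht.eventually_lt_const ha, hD.eventually_lt_const hD0] with x h1 h2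
    rw [main' _ _ h2, main' _ _ hD0, if_neg (fun h => lt_asymm h.2 h1), if_neg (fun h => lt_asymm h.2 ha)]
  · rcases lt_or_gt_of_ne (hd (mul_neg_of_neg_of_pos ha ha')) with hD0 | hD0
    · filter_upwards [ht.eventually_lt_const ha, hD.eventually_lt_const hD0] with x h1 h2
      rw [main' _ _ h2, main' _ _ hD0, if_neg (fun h => lt_asymm h.2 h1),
        if_neg (fun h => lt_asymm h.2 ha)]
    · filter_upwards [ht.eventually_lt_const ha, ht'.eventually_const_lt ha',
        hD.eventually_const_lt hD0] with x h1 h1' h2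
      rw [main _ _ h2, main _ _ hD0, if_pos ⟨h1.le, h1'⟩, if_pos ⟨ha.le, ha'⟩]
  · have := h ha
    have hD0 : 0 < a.2 * a'.1 - a'.2 * a.1 := by rw [ha]; nlinarith
    filter_upwards [ht'.eventually_lt_const ha', hD.eventually_const_lt hD0] with x h1 h2
    rw [main _ _ h2, main _ _ hD0, if_neg (fun h => lt_asymm h.2 h1),
      if_neg (fun h => lt_asymm h.2 ha')]
  · have e0 : rayCrossing a a' = 0 := by simp [rayCrossing, ha, ha']
    rw [e0]
    filter_upwards [hp.eventually_lt_const (h ha), hp'.eventually_lt_const (h' ha')] with x h1 h2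
    have c1 : ¬ ((z x).1 ≤ 0 ∧ 0 < (z' x).1 ∧ 0 < (z x).2 * (z' x).1 - (z' x).2 * (z x).1) := by
      rintro ⟨e1, e2, e3⟩; nlinarith
    have c2 : ¬ ((z' x).1 ≤ 0 ∧ 0 < (z x).1 ∧ 0 < (z' x).2 * (z x).1 - (z x).2 * (z' x).1) := by
      rintro ⟨e1, e2, e3⟩; nlinarith
    rw [rayCrossing, if_neg c1, if_neg c2, sub_zero]
  · have := h ha
    have hD0 : a.2 * a'.1 - a'.2 * a.1 < 0 := by rw [ha]; nlinarith
    filter_upwards [ht'.eventually_const_lt ha', hD.eventually_lt_const hD0] with x h1 h2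
    rw [main' _ _ h2, main' _ _ hD0, if_neg (fun h => not_lt.2 h.1 h1),
      if_neg (fun h => not_lt.2 h.1 ha')]
  · rcases lt_or_gt_of_ne (hd (mul_neg_of_pos_of_neg ha ha')) with hD0 | hD0
    · filter_upwards [ht.eventually_const_lt ha, ht'.eventually_lt_const ha',
        hD.eventually_lt_const hD0] with x h1 h1' h2
      rw [main' _ _ h2, main' _ _ hD0, if_pos ⟨h1'.le, h1⟩, if_pos ⟨ha'.le, ha⟩]
    · filter_upwards [ht.eventually_const_lt ha, hD.eventually_const_lt hD0] with x h1 h2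
      rw [main _ _ h2, main _ _ hD0, if_neg (fun h => not_lt.2 h.1 h1),
        if_neg (fun h => not_lt.2 h.1 ha)]
  · have := h' ha'
    have hD0 : 0 < a.2 * a'.1 - a'.2 * a.1 := by rw [ha']; nlinarith
    filter_upwards [ht.eventually_const_lt ha, hD.eventually_const_lt hD0] with x h1 h2
    rw [main _ _ h2, main _ _ hD0, if_neg (fun h => not_lt.2 h.1 h1),
      if_neg (fun h => not_lt.2 h.1 ha)]
  · filter_upwards [ht.eventually_const_lt ha, ht'.eventually_const_lt ha'] with x h1 h2
    simp [rayCrossing, h1.not_ge, h2.not_ge, ha.not_ge, ha'.not_ge]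

/-! ### Vector algebra in space -/

theorem inner_eq (x y : E3) : inner ℝ x y = x 0 * y 0 + x 1 * y 1 + x 2 * y 2 := by
  rw [PiLp.inner_apply, Fin.sum_univ_three]
  simp [mul_comm]

@[simp] theorem cross_zero (x y : E3) : cross x y 0 = x 1 * y 2 - x 2 * y 1 := by
  simp [cross, crossProduct]

@[simp] theorem cross_one (x y : E3) : cross x y 1 = x 2 * y 0 - x 0 * y 2 := by
  simp [cross, crossProduct]

@[simp] theorem cross_two (x y : E3) : cross x y 2 = x 0 * y 1 - x 1 * y 0 := by
  simp [cross, crossProduct]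

theorem ext_three {x y : E3} (h0 : x 0 = y 0) (h1 : x 1 = y 1) (h2 : x 2 = y 2) : x = y := by
  ext i
  fin_cases i <;> assumption

theorem cross_anti (x y : E3) : cross y x = -cross x y := by
  apply ext_three <;> simp <;> ring

theorem cross_cross_left (x y z : E3) :
    cross (cross x y) z = (inner ℝ x z) • y - (inner ℝ y z) • x := by
  simp only [inner_eq]
  apply ext_three <;> simp <;> ring

theorem cross_cross_cross (x y z : E3) :
    cross (cross x y) (cross y z) = (inner ℝ (cross x y) z) • y := by
  simp only [inner_eq]
  apply ext_three <;> simp <;> ring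

theorem inner_cross_rotate (x y z : E3) : inner ℝ (cross x y) z = inner ℝ (cross y z) x := by
  simp only [inner_eq]; simp; ring

theorem inner_cross_left_self (x y : E3) : inner ℝ (cross x y) x = 0 := by
  simp only [inner_eq]; simp; ring

theorem inner_cross_right_self (x y : E3) : inner ℝ (cross x y) y = 0 := by
  simp only [inner_eq]; simp; ring

theorem lagrange_identity (x y : E3) : inner ℝ (cross x y) (cross x y) + inner ℝ x y * inner ℝ x y =
    inner ℝ x x * inner ℝ y y := by
  simp only [inner_eq]; simp; ring

theorem eq_zero_of_cross_eq_zero_of_inner_eq_zero {x y : E3} (hx : x ≠ 0) (h : cross x y = 0)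
    (h' : inner ℝ x y = 0) : y = 0 := by
  have := lagrange_identity x y
  rw [h, h', inner_zero_left] at this
  have hx' : inner ℝ x x ≠ (0 : ℝ) := inner_self_ne_zero.2 hx
  have : inner ℝ y y = (0 : ℝ) := by
    rcases mul_eq_zero.1 (by linarith : inner ℝ x x * inner ℝ y y = (0 : ℝ)) with h | h
    · exact absurd h hx'
    · exact h
  exact inner_self_eq_zero.1 this

theorem cross_sub_rotate (a b c : E3) :
    cross (c - b) (a - b) = cross (b - a) (c - a) := by
  apply ext_three <;> simp <;> ring

/-- Coordinates in the plane orthogonal to `ξ`: the components along `μ` and along `μ × ξ`. -/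
def planeCoord (ξ μ : E3) : E3 →ₗ[ℝ] ℝ × ℝ :=
  ((innerSL ℝ μ : E3 →L[ℝ] ℝ) : E3 →ₗ[ℝ] ℝ).prod ((innerSL ℝ (cross μ ξ) : E3 →L[ℝ] ℝ) : E3 →ₗ[ℝ] ℝ)

@[simp] theorem planeCoord_apply (ξ μ z : E3) :
    planeCoord ξ μ z = (inner ℝ μ z, inner ℝ (cross μ ξ) z) := rfl

theorem eq_zero_of_planeCoord_eq_zero {ξ μ z : E3} (h : cross μ ξ ≠ 0) (hz : inner ℝ ξ z = 0)
    (h0 : planeCoord ξ μ z = 0) : z = 0 := by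
  rw [planeCoord_apply, Prod.mk_eq_zero] at h0
  refine eq_zero_of_cross_eq_zero_of_inner_eq_zero h ?_ h0.2
  rw [cross_cross_left, h0.1, hz]
  simp

/-! ### Nondegenerate triangles and edges -/

namespace SimplicialSurface

variable {P : SimplicialSurface} (o : P.Orientation)

theorem ne_of_card_eq_three {a b c : E3} (h : ({a, b, c} : Finset E3).card = 3) :
    a ≠ b ∧ a ≠ c ∧ b ≠ c := by
  refine ⟨?_, ?_, ?_⟩
  · rintro rfl
    have := Finset.card_le_two (a := a) (b := c)
    rw [Finset.insert_idem] at h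
    omega
  · rintro rfl
    have := Finset.card_le_two (a := a) (b := b)
    have e : ({a, b, a} : Finset E3) = {a, b} := by ext; simp; tauto
    rw [e] at h
    omega
  · rintro rfl
    have := Finset.card_le_two (a := a) (b := b)
    have e : ({a, b, b} : Finset E3) = {a, b} := by ext; simp
    rw [e] at h
    omega

theorem cross_ne_zero_of_face {a b c : E3} (h : ({a, b, c} : Finset E3) ∈ P.faces)
    (h3 : ({a, b, c} : Finset E3).card = 3) : cross (b - a) (c - a) ≠ 0 := by
  obtain ⟨hab, hac, hbc⟩ := ne_of_card_eq_three h3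
  have hi := P.indep h
  let f : Fin 3 ↪ ({a, b, c} : Finset E3) :=
    ⟨![⟨a, by simp⟩, ⟨b, by simp⟩, ⟨c, by simp⟩], by
      intro i j hij
      fin_cases i <;> fin_cases j <;> simp_all⟩
  have hf := hi.comp_embedding f
  have he : ((↑) ∘ f : Fin 3 → E3) = ![a, b, c] := by
    ext i; fin_cases i <;> rfl
  rw [he, affineIndependent_iff_linearIndependent_vsub ℝ _ (0 : Fin 3)] at hf
  let g : Fin 2 ↪ {x : Fin 3 // x ≠ 0} := ⟨![⟨1, by simp⟩, ⟨2, by simp⟩], by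
    intro i j hij
    fin_cases i <;> fin_cases j <;> simp_all⟩
  have hg := hf.comp g g.injective
  have hlin : LinearIndependent ℝ ![b - a, c - a] := by
    have he2 : (fun i : {x : Fin 3 // x ≠ 0} => (![a, b, c] i -ᵥ ![a, b, c] 0 : E3)) ∘ g =
        ![b - a, c - a] := by
      ext i; fin_cases i <;> rfl
    rwa [he2] at hg
  intro h0
  rw [LinearIndependent.pair_iff] at hlin
  -- `(b - a) × (c - a) = 0` makes the two vectors proportional
  have hx : b - a ≠ 0 := sub_ne_zero.2 hab.symm
  have e : (inner ℝ (b - a) (b - a)) • (c - a) - (inner ℝ (b - a) (c - a)) • (b - a) = 0 := by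
    have := cross_cross_left (b - a) (c - a) (b - a)
    rw [h0] at this
    have h1 : cross 0 (b - a) = 0 := by apply ext_three <;> simp
    rw [h1, real_inner_comm (b - a) (c - a)] at this
    exact this.symm
  have := (hlin (-(inner ℝ (b - a) (c - a))) (inner ℝ (b - a) (b - a)) (by
    rw [← e]; module)).2
  exact hx (inner_self_eq_zero.1 this)

theorem Orientation.cross_ne_zero {a b c : E3} (h : o.pos a b c) : cross (b - a) (c - a) ≠ 0 :=
  cross_ne_zero_of_face (o.face h) (mem_simplices.1 (o.mem _ _ _ h)).2

/-- If the triple product vanished, all four corners would lie in the plane of the first triangle,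
while triangles that share an edge are not coplanar. -/
theorem inner_cross_ne_zero_of_faces {a b c d : E3} (h : ({a, b, c} : Finset E3) ∈ P.simplices 3)
    (h' : ({a, b, d} : Finset E3) ∈ P.simplices 3) (hcd : c ≠ d) :
    inner ℝ (cross (b - a) (c - a)) (d - a) ≠ 0 := by
  intro h0
  rw [mem_simplices] at h h'
  have hn := cross_ne_zero_of_face h.1 h.2
  set n := cross (b - a) (c - a) with hndef
  obtain ⟨hab, hac, hbc⟩ := ne_of_card_eq_three h.2
  have hne : ({a, b, c} : Finset E3) ≠ {a, b, d} := by
    intro he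
    have : c ∈ ({a, b, d} : Finset E3) := by rw [← he]; simp
    simp only [Finset.mem_insert, Finset.mem_singleton] at this
    rcases this with h | h | h
    · exact hac h.symm
    · exact hbc h.symm
    · exact hcd h
  have hcard : (({a, b, c} : Finset E3) ∩ {a, b, d}).card = 2 := by
    have h1 : ({a, b} : Finset E3) ⊆ ({a, b, c} : Finset E3) ∩ {a, b, d} := by
      intro x; simp; tauto
    have h2 := Finset.card_le_card h1
    rw [Finset.card_pair hab] at h2
    have h3 : (({a, b, c} : Finset E3) ∩ {a, b, d}).card < 3 := by
      refine lt_of_lt_of_eq (b := ({a, b, c} : Finset E3).card) ?_ h.2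
      refine Finset.card_lt_card ⟨Finset.inter_subset_left, fun hsub => ?_⟩
      have hs : ({a, b, c} : Finset E3) ⊆ {a, b, d} := hsub.trans Finset.inter_subset_right
      exact hne (Finset.eq_of_subset_of_card_le hs (by rw [h.2, h'.2]))
    omega
  refine P.not_coplanar _ h.1 _ h'.1 h.2 h'.2 hne hcard ?_
  have hmem : ∀ x ∈ (({a, b, c} : Finset E3) : Set E3) ∪ (({a, b, d} : Finset E3) : Set E3),
      inner ℝ n (x - a) = 0 := by
    intro x hx
    simp only [Finset.coe_insert, Finset.coe_singleton, Set.mem_union, Set.mem_insert_iff,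
      Set.mem_singleton_iff] at hx
    rcases hx with (rfl | rfl | rfl) | (rfl | rfl | rfl)
    · simp
    · exact inner_cross_left_self _ _
    · exact inner_cross_right_self _ _
    · simp
    · exact inner_cross_left_self _ _
    · exact h0
  have hle : vectorSpan ℝ ((({a, b, c} : Finset E3) : Set E3) ∪ (({a, b, d} : Finset E3) : Set E3)) ≤
      (Submodule.span ℝ {n})ᗮ := by
    rw [vectorSpan, Submodule.span_le]
    rintro _ ⟨x, hx, y, hy, rfl⟩
    rw [SetLike.mem_coe, Submodule.mem_orthogonal_singleton_iff_inner_right]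
    have : x -ᵥ y = (x - a) - (y - a) := by simp
    change inner ℝ n (x -ᵥ y) = 0
    rw [this, inner_sub_right, hmem x hx, hmem y hy, sub_zero]
  have hfr : Module.finrank ℝ (Submodule.span ℝ {n})ᗮ = 2 := by
    have h1 := Submodule.finrank_add_finrank_orthogonal (Submodule.span ℝ {n})
    rw [finrank_span_singleton hn] at h1
    simp at h1
    omega
  rw [coplanar_iff_finrank_le_two]
  exact (Submodule.finrank_mono hle).trans hfr.le

theorem Orientation.inner_cross_ne_zero {a b c d : E3} (h : o.pos a b c) (h' : o.pos b a d) :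
    inner ℝ (cross (b - a) (c - a)) (d - a) ≠ 0 := by
  refine inner_cross_ne_zero_of_faces (o.mem _ _ _ h) (o.mem _ _ _ h' |> fun h => by
    rwa [Finset.insert_comm] at h) ?_
  rintro rfl
  exact o.asymm _ _ _ h h'

end SimplicialSurface

/-! ### Cycles of a permutation -/

section Cycle

variable {ι : Type*} [Fintype ι]

/-- The exponents start at one: the enumeration begins at `σ y` and ends at `y`, which opens the
cycle between `y` and `σ y`. -/
theorem exists_pow_lt_card {σ : Equiv.Perm ι} {y : ι} (hσ : ∀ x, σ.SameCycle y x) (x : ι) :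
    ∃ i < Fintype.card ι, (σ ^ (i + 1)) y = x := by
  have hc : σ.IsCycleOn ((Finset.univ : Finset ι) : Set ι) := by
    refine ⟨by simp [Set.bijOn_univ], fun a _ b _ => (hσ a).symm.trans (hσ b)⟩
  obtain ⟨n, hn, hn'⟩ := hc.exists_pow_eq (Finset.mem_univ (σ y)) (Finset.mem_univ x)
  refine ⟨n, by simpa using hn, ?_⟩
  rw [pow_succ, Equiv.Perm.mul_apply, hn']

theorem pow_injOn_range {σ : Equiv.Perm ι} {y : ι} (hσ : ∀ x, σ.SameCycle y x) :
    Set.InjOn (fun i => (σ ^ (i + 1)) y) (Finset.range (Fintype.card ι)) := by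
  have : (Finset.range (Fintype.card ι)).image (fun i => (σ ^ (i + 1)) y) = Finset.univ := by
    ext x
    simpa using exists_pow_lt_card hσ x
  exact Finset.injOn_of_card_image_eq (by rw [this]; simp)

theorem sum_eq_sum_range_pow {σ : Equiv.Perm ι} {y : ι} (hσ : ∀ x, σ.SameCycle y x)
    {M : Type*} [AddCommMonoid M] (f : ι → M) :
    ∑ x, f x = ∑ i ∈ Finset.range (Fintype.card ι), f ((σ ^ (i + 1)) y) := by
  symm
  refine Finset.sum_bij (fun i _ => (σ ^ (i + 1)) y) (by simp) ?_ ?_ (by simp)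
  · intro i hi j hj h
    exact pow_injOn_range hσ (by simpa using hi) (by simpa using hj) h
  · intro x _
    obtain ⟨i, hi, h⟩ := exists_pow_lt_card hσ x
    exact ⟨i, by simpa using hi, h⟩

theorem pow_card_eq_self {σ : Equiv.Perm ι} {y : ι} (hσ : ∀ x, σ.SameCycle y x) :
    (σ ^ (Fintype.card ι)) y = y := by
  have hc : σ.IsCycleOn ((Finset.univ : Finset ι) : Set ι) := by
    refine ⟨by simp [Set.bijOn_univ], fun a _ b _ => (hσ a).symm.trans (hσ b)⟩
  simpa using hc.pow_card_apply (Finset.mem_univ y)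

/-- The total turning of a simple closed polygon, computed from the angles that it sweeps as seen
from the two ends of one of its sides. -/
theorem sum_rayCrossing_cycle {σ : Equiv.Perm ι} {y : ι} (hσ : ∀ x, σ.SameCycle y x)
    (hy : σ y ≠ y) (A : ι → ℝ × ℝ)
    (hdisj : ∀ u v, u ≠ v → σ u ≠ v → σ v ≠ u → ∀ p ∈ segment ℝ (A u) (A (σ u)),
      ∀ r ∈ segment ℝ (A v) (A (σ v)), p ≠ r)
    (hturn : ∀ u, ∀ a b : ℝ, 0 ≤ a → 0 ≤ b →
      a • (A (σ u) - A u) + b • (A (σ (σ u)) - A (σ u)) = 0 → a = 0 ∧ b = 0) :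
    ∑ x, rayCrossing (A (σ x) - A x) (A (σ (σ x)) - A (σ x)) =
      ∑ x, rayCrossing (A x - A (σ y)) (A (σ x) - A (σ y)) +
        ∑ x, rayCrossing (A y - A x) (A y - A (σ x)) +
        rayCrossing (A y - A (σ.symm y)) (A (σ y) - A y) +
        rayCrossing (A (σ y) - A y) (A (σ (σ y)) - A (σ y)) := by
  -- The open polyline `q 0, …, q (k + 1)` leads from `σ y` to `y` and has `k` inner corners. The
  -- corners at its two ends account for the last two terms.
  obtain ⟨k, hk⟩ : ∃ k, Fintype.card ι = k + 2 := by
    have : 1 < Fintype.card ι := Fintype.one_lt_card_iff.2 ⟨σ y, y, hy⟩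
    exact ⟨Fintype.card ι - 2, by omega⟩
  have hinj := pow_injOn_range hσ
  have hN := pow_card_eq_self hσ
  rw [sum_eq_sum_range_pow hσ, sum_eq_sum_range_pow hσ, sum_eq_sum_range_pow hσ]
  rw [hk] at hinj hN ⊢
  set q : ℕ → ℝ × ℝ := fun i => A ((σ ^ (i + 1)) y) with hq
  have hs : ∀ i, σ ((σ ^ i) y) = (σ ^ (i + 1)) y := fun i => by
    rw [pow_succ', Equiv.Perm.mul_apply]
  have q0 : A (σ y) = q 0 := by simp [hq]
  have q1 : A (σ (σ y)) = q 1 := by simp [hq, pow_succ]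
  have qk1 : A y = q (k + 1) := by simp only [hq]; rw [hN]
  have qk : A (σ.symm y) = q k := by
    simp only [hq]
    congr 1
    rw [Equiv.symm_apply_eq, hs, hN]
  have qk2 : q (k + 2) = q 0 := by
    simp only [hq]; rw [← hs, hN]; simp
  have qk3 : q (k + 3) = q 1 := by
    simp only [hq]; rw [← hs, ← hs, hN]; simp [pow_succ]
  simp only [hs]
  have e : ∀ i, A ((σ ^ (i + 1)) y) = q i := fun i => rfl
  rw [q0, q1, qk1, qk]
  simp only [e]
  have main := sum_rayCrossing_polyline q k (by
    intro i j hij hjk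
    have hne : ∀ s t, s < k + 2 → t < k + 2 → s ≠ t → (σ ^ (s + 1)) y ≠ (σ ^ (t + 1)) y :=
      fun s t hs ht hst h => hst (hinj (by simpa using hs) (by simpa using ht) h)
    have := hdisj ((σ ^ (i + 1)) y) ((σ ^ (j + 1)) y) (hne i j (by omega) (by omega) (by omega))
      (by rw [hs]; exact hne (i + 1) j (by omega) (by omega) (by omega))
      (by rw [hs]; exact hne (j + 1) i (by omega) (by omega) (by omega))
    simpa only [hs] using this) (by
    intro i _
    have := hturn ((σ ^ (i + 1)) y)
    simpa only [hs] using this)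
  rw [Finset.sum_range_succ, Finset.sum_range_succ, main]
  -- Compared with the polyline, the sums over the whole cycle only add sides that have the
  -- viewpoint as an end; for these one argument of `rayCrossing` is zero.
  rw [Finset.sum_range_succ (fun i => rayCrossing (q i - q 0) (q (i + 1) - q 0)) (k + 1),
    Finset.sum_range_succ' (fun i => rayCrossing (q i - q 0) (q (i + 1) - q 0)) k,
    Finset.sum_range_succ _ (k + 1), Finset.sum_range_succ _ k]
  simp only [show k + 1 + 1 = k + 2 from rfl, show k + 1 + 2 = k + 3 from rfl, qk2, qk3, sub_self,
    rayCrossing_zero_left, rayCrossing_zero_right, add_zero]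

end Cycle

/-! ### Slices as polygons: the permutation of the outgoing edges -/

namespace SimplicialSurface

variable {P : SimplicialSurface}

/-- The directed edges that lead out of `L`. -/
def cut (P : SimplicialSurface) (L : Set E3) : Finset (E3 × E3) :=
  (P.verts ×ˢ P.verts).filter (fun x => P.Adj x.1 x.2 ∧ x.1 ∈ L ∧ x.2 ∉ L)

theorem mem_cut {L : Set E3} {x : E3 × E3} :
    x ∈ P.cut L ↔ P.Adj x.1 x.2 ∧ x.1 ∈ L ∧ x.2 ∉ L := by
  simp only [cut, Finset.mem_filter, Finset.mem_product, and_iff_right_iff_imp]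
  exact fun h => ⟨h.1.mem_left, h.1.mem_right⟩

namespace Orientation

variable (o : P.Orientation)

/-- The other outgoing edge of the triangle on the positive side of an outgoing edge. -/
def nextEdge (L : Set E3) (x : E3 × E3) : E3 × E3 :=
  if o.opp x.1 x.2 ∈ L then (o.opp x.1 x.2, x.2) else (x.1, o.opp x.1 x.2)

/-- The other outgoing edge of the triangle on the negative side of an outgoing edge. -/
def prevEdge (L : Set E3) (x : E3 × E3) : E3 × E3 :=
  if o.opp x.2 x.1 ∈ L then (o.opp x.2 x.1, x.2) else (x.1, o.opp x.2 x.1)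

theorem nextEdge_mem {L : Set E3} {x : E3 × E3} (hx : x ∈ P.cut L) : o.nextEdge L x ∈ P.cut L := by
  rw [mem_cut] at hx ⊢
  have hp := o.pos_opp hx.1
  rw [nextEdge]
  split_ifs with h
  · exact ⟨(o.adj₂ hp).symm, h, hx.2.2⟩
  · exact ⟨(o.adj₃ hp).symm, hx.2.1, h⟩

theorem prevEdge_mem {L : Set E3} {x : E3 × E3} (hx : x ∈ P.cut L) : o.prevEdge L x ∈ P.cut L := by
  rw [mem_cut] at hx ⊢
  have hp := o.pos_opp hx.1.symm
  rw [prevEdge]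
  split_ifs with h
  · exact ⟨o.adj₃ hp, h, hx.2.2⟩
  · exact ⟨o.adj₂ hp, hx.2.1, h⟩

theorem prevEdge_nextEdge {L : Set E3} {x : E3 × E3} (hx : x ∈ P.cut L) :
    o.prevEdge L (o.nextEdge L x) = x := by
  rw [mem_cut] at hx
  have hp := o.pos_opp hx.1
  rw [nextEdge]
  split_ifs with h
  · simp only [prevEdge, o.opp_eq₂ hp, if_pos hx.2.1]
  · simp only [prevEdge, o.opp_eq₃ hp, if_neg hx.2.2]

theorem nextEdge_prevEdge {L : Set E3} {x : E3 × E3} (hx : x ∈ P.cut L) :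
    o.nextEdge L (o.prevEdge L x) = x := by
  rw [mem_cut] at hx
  have hp := o.pos_opp hx.1.symm
  rw [prevEdge]
  split_ifs with h
  · simp only [nextEdge, o.opp_eq₃ hp, if_pos hx.2.1]
  · simp only [nextEdge, o.opp_eq₂ hp, if_neg hx.2.2]

/-- The outgoing edges are permuted by passing through the triangle on the positive side. -/
def next (L : Set E3) : Equiv.Perm (P.cut L) where
  toFun x := ⟨o.nextEdge L x, o.nextEdge_mem x.2⟩
  invFun x := ⟨o.prevEdge L x, o.prevEdge_mem x.2⟩
  left_inv x := Subtype.ext (o.prevEdge_nextEdge x.2)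
  right_inv x := Subtype.ext (o.nextEdge_prevEdge x.2)

@[simp] theorem coe_next (L : Set E3) (x : P.cut L) : (o.next L x : E3 × E3) = o.nextEdge L x := rfl

theorem next_ne (L : Set E3) (x : P.cut L) : o.next L x ≠ x := by
  intro h
  have h' := congrArg Subtype.val h
  have hx := mem_cut.1 x.2
  have hp := o.pos_opp hx.1
  rw [coe_next, nextEdge] at h'
  split_ifs at h' with hc
  · exact (o.adj₃ hp).1 (congrArg Prod.fst h')
  · exact (o.adj₂ hp).1 (congrArg Prod.snd h').symm

variable {o}

/-- Cut connectedness is applied to the property of lying in the cycle of `x`; the passages through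
triangles that it allows are exactly the moves of `next`. -/
theorem CutConnected.sameCycle {L : Set E3} (h : o.CutConnected L) (x y : P.cut L) :
    (o.next L).SameCycle x y := by
  have hx := mem_cut.1 x.2
  have hy := mem_cut.1 y.2
  have := h (fun a b => ∃ hab : (a, b) ∈ P.cut L, (o.next L).SameCycle x ⟨(a, b), hab⟩) (by
    intro a b c hp ha hb
    have hab : (a, b) ∈ P.cut L := mem_cut.2 ⟨o.adj hp, ha, hb⟩
    have key : ∀ (z : E3 × E3) (hz : z ∈ P.cut L), o.nextEdge L (a, b) = z →
        ((∃ hab : (a, b) ∈ P.cut L, (o.next L).SameCycle x ⟨(a, b), hab⟩) ↔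
          ∃ hz : z ∈ P.cut L, (o.next L).SameCycle x ⟨z, hz⟩) := by
      intro z hz hzn
      have e : o.next L ⟨(a, b), hab⟩ = ⟨z, hz⟩ := Subtype.ext hzn
      constructor
      · rintro ⟨h1, h2⟩
        exact ⟨hz, e ▸ Equiv.Perm.sameCycle_apply_right.2 h2⟩
      · rintro ⟨h1, h2⟩
        rw [← e] at h2
        exact ⟨hab, Equiv.Perm.sameCycle_apply_right.1 h2⟩
    have hn : o.nextEdge L (a, b) = if c ∈ L then (c, b) else (a, c) := by
      simp only [nextEdge, o.opp_eq hp]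
    have hm := o.nextEdge_mem hab
    refine ⟨fun hc => ?_, fun hc => ?_⟩
    · rw [if_pos hc] at hn
      exact key (c, b) (hn ▸ hm) hn
    · rw [if_neg hc] at hn
      exact key (a, c) (hn ▸ hm) hn) x.1.1 x.1.2 y.1.1 y.1.2 hx.1 hx.2.1 hx.2.2 hy.1 hy.2.1 hy.2.2
  obtain ⟨_, h2⟩ := this.1 ⟨x.2, Equiv.Perm.SameCycle.refl _ _⟩
  exact h2

variable (o)

/-- The corners of the triangle on the positive side of a directed edge. -/
def tri (x : E3 × E3) : Finset E3 := {x.1, x.2, o.opp x.1 x.2}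

theorem tri_mem {x : E3 × E3} (h : P.Adj x.1 x.2) : o.tri x ∈ P.faces := o.face (o.pos_opp h)

/-- The outgoing edges of a triangle. -/
theorem eq_or_eq_nextEdge {L : Set E3} {x : E3 × E3} (hx : x ∈ P.cut L) {a b : E3} (ha : a ∈ o.tri x)
    (hb : b ∈ o.tri x) (haL : a ∈ L) (hbL : b ∉ L) : (a, b) = x ∨ (a, b) = o.nextEdge L x := by
  rw [mem_cut] at hx
  simp only [tri, Finset.mem_insert, Finset.mem_singleton] at ha hb
  rw [nextEdge]
  split_ifs with h
  · have hb' : b = x.2 := by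
      rcases hb with rfl | hb | rfl
      · exact absurd hx.2.1 hbL
      · exact hb
      · exact absurd h hbL
    rcases ha with rfl | rfl | rfl
    · exact Or.inl (Prod.ext rfl hb')
    · exact absurd haL hx.2.2
    · exact Or.inr (Prod.ext rfl hb')
  · have ha' : a = x.1 := by
      rcases ha with ha | rfl | rfl
      · exact ha
      · exact absurd haL hx.2.2
      · exact absurd haL h
    rcases hb with rfl | rfl | rfl
    · exact absurd hx.2.1 hbL
    · exact Or.inl (Prod.ext ha' rfl)
    · exact Or.inr (Prod.ext ha' rfl)

/-- The direction in which a horizontal plane intersects a triangle `a b c`. -/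
def sliceDir (ξ : E3) (x : E3 × E3) : E3 :=
  cross (cross (x.2 - x.1) (o.opp x.1 x.2 - x.1)) ξ

theorem sliceDir_of_pos (ξ : E3) {a b c : E3} (h : o.pos a b c) :
    o.sliceDir ξ (a, b) = cross (cross (b - a) (c - a)) ξ := by
  simp only [sliceDir, o.opp_eq h]

theorem sliceDir_rotate (ξ : E3) {a b c : E3} (h : o.pos a b c) :
    o.sliceDir ξ (b, c) = o.sliceDir ξ (a, b) := by
  rw [o.sliceDir_of_pos ξ h, o.sliceDir_of_pos ξ (o.rotate _ _ _ h), cross_sub_rotate]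

/-- The triangle on the positive side of `x` is on the positive side of the reverse of the next
edge. -/
theorem sliceDir_nextEdge (ξ : E3) {L : Set E3} {x : E3 × E3} (hx : x ∈ P.cut L) :
    o.sliceDir ξ ((o.nextEdge L x).2, (o.nextEdge L x).1) = o.sliceDir ξ x := by
  have hp := o.pos_opp (mem_cut.1 hx).1
  rw [nextEdge]
  split_ifs with h
  · exact o.sliceDir_rotate ξ hp
  · exact (o.sliceDir_rotate ξ (o.rotate _ _ _ hp)).trans (o.sliceDir_rotate ξ hp)

/-- The turning of the horizontal slices at an edge, counted as a signed crossing. -/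
def edgeTurning (ξ μ : E3) (x : E3 × E3) : ℤ :=
  rayCrossing (planeCoord ξ μ (o.sliceDir ξ (x.2, x.1))) (planeCoord ξ μ (o.sliceDir ξ x))

theorem edgeTurning_swap (ξ μ a b : E3) :
    o.edgeTurning ξ μ (b, a) = -o.edgeTurning ξ μ (a, b) := rayCrossing_comm _ _

end Orientation

/-- The point at height `c` on the line through `x.1` and `x.2`. -/
def slicePoint (ξ : E3) (c : ℝ) (x : E3 × E3) : E3 :=
  x.1 + ((c - inner ℝ ξ x.1) / (inner ℝ ξ x.2 - inner ℝ ξ x.1)) • (x.2 - x.1)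

theorem inner_slicePoint {ξ : E3} (c : ℝ) {x : E3 × E3} (h : inner ℝ ξ x.1 ≠ inner ℝ ξ x.2) :
    inner ℝ ξ (slicePoint ξ c x) = c := by
  have : inner ℝ ξ x.2 - inner ℝ ξ x.1 ≠ 0 := sub_ne_zero.2 h.symm
  rw [slicePoint, inner_add_right, inner_smul_right, inner_sub_right]
  field_simp
  ring

theorem slicePoint_fst {ξ a b : E3} : slicePoint ξ (inner ℝ ξ a) (a, b) = a := by
  simp [slicePoint]

theorem slicePoint_snd {ξ a b : E3} (h : inner ℝ ξ a ≠ inner ℝ ξ b) :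
    slicePoint ξ (inner ℝ ξ b) (a, b) = b := by
  have : inner ℝ ξ b - inner ℝ ξ a ≠ 0 := sub_ne_zero.2 h.symm
  simp [slicePoint, div_self this]

theorem slicePoint_mem_segment {ξ : E3} {c : ℝ} {x : E3 × E3} (h1 : inner ℝ ξ x.1 ≤ c)
    (h2 : c ≤ inner ℝ ξ x.2) (h : inner ℝ ξ x.1 < inner ℝ ξ x.2) :
    slicePoint ξ c x ∈ segment ℝ x.1 x.2 := by
  rw [segment_eq_image']
  refine ⟨_, ⟨div_nonneg (by linarith) (by linarith), ?_⟩, rfl⟩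
  rw [div_le_one (by linarith)]
  linarith

theorem continuous_slicePoint (ξ : E3) (x : E3 × E3) : Continuous fun c => slicePoint ξ c x := by
  unfold slicePoint
  fun_prop

/-- `L` consists of the vertices below the level `c`, and no vertex has level `c`. -/
def IsBelow (P : SimplicialSurface) (ξ : E3) (c : ℝ) (L : Set E3) : Prop :=
  ∀ x ∈ P.verts, (x ∈ L → inner ℝ ξ x < c) ∧ (x ∉ L → c < inner ℝ ξ x)

/-- A point of a simplex whose height is `c` forces corners below and above. -/
theorem exists_mem_below {s : Finset E3} {ξ p : E3} {c : ℝ} (hp : p ∈ convexHull ℝ (s : Set E3))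
    (hc : inner ℝ ξ p = c) : ∃ a ∈ s, inner ℝ ξ a ≤ c := by
  by_contra hcon
  push Not at hcon
  have hconv : Convex ℝ {x : E3 | c < inner ℝ ξ x} :=
    convex_halfSpace_gt (innerSL ℝ ξ : E3 →L[ℝ] ℝ).isLinear c
  have := convexHull_min (s := (s : Set E3)) (fun x hx => hcon x hx) hconv hp
  exact (lt_irrefl c) (hc ▸ this : c < c)

theorem exists_mem_above {s : Finset E3} {ξ p : E3} {c : ℝ} (hp : p ∈ convexHull ℝ (s : Set E3))
    (hc : inner ℝ ξ p = c) : ∃ a ∈ s, c ≤ inner ℝ ξ a := by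
  obtain ⟨a, ha, h⟩ := exists_mem_below (ξ := -ξ) (c := -c) hp (by simp [hc])
  exact ⟨a, ha, by simpa using h⟩

theorem inner_sliceDir (o : P.Orientation) (ξ : E3) (x : E3 × E3) : inner ℝ ξ (o.sliceDir ξ x) = 0 := by
  rw [Orientation.sliceDir, real_inner_comm]
  exact inner_cross_right_self _ _

/-- The slice of a triangle is parallel to `sliceDir`, and its length follows by similarity from the
corner that is alone on its side of the level. Positivity of `r` is what lets turnings be computed
from `sliceDir`. -/
theorem slicePoint_nextEdge_sub (o : P.Orientation) {ξ : E3} {c : ℝ} {L : Set E3}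
    (hL : P.IsBelow ξ c L) {x : E3 × E3} (hx : x ∈ P.cut L) :
    ∃ r : ℝ, 0 < r ∧ slicePoint ξ c (o.nextEdge L x) - slicePoint ξ c x = r • o.sliceDir ξ x := by
  have hx' := mem_cut.1 hx
  have hp := o.pos_opp hx'.1
  have h1 := (hL x.1 hx'.1.mem_left).1 hx'.2.1
  have h2 := (hL x.2 hx'.1.mem_right).2 hx'.2.2
  have e : o.sliceDir ξ x = inner ℝ ξ (x.2 - x.1) • (o.opp x.1 x.2 - x.1) -
      inner ℝ ξ (o.opp x.1 x.2 - x.1) • (x.2 - x.1) := by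
    rw [Orientation.sliceDir, cross_cross_left, real_inner_comm, real_inner_comm ξ]
  rw [e, Orientation.nextEdge]
  set d := o.opp x.1 x.2
  simp only [inner_sub_right]
  split_ifs with h
  · have h3 := (hL d (o.adj₃ hp).mem_left).1 h
    refine ⟨(inner ℝ ξ x.2 - c) / ((inner ℝ ξ x.2 - inner ℝ ξ x.1) * (inner ℝ ξ x.2 - inner ℝ ξ d)),
      div_pos (by linarith) (mul_pos (by linarith) (by linarith)), ?_⟩
    have n1 : inner ℝ ξ x.2 - inner ℝ ξ x.1 ≠ 0 := by linarith
    have n2 : inner ℝ ξ x.2 - inner ℝ ξ d ≠ 0 := by linarith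
    simp only [slicePoint]
    apply ext_three <;> simp <;> field_simp <;> ring
  · have h3 := (hL d (o.adj₃ hp).mem_left).2 h
    refine ⟨(c - inner ℝ ξ x.1) / ((inner ℝ ξ x.2 - inner ℝ ξ x.1) * (inner ℝ ξ d - inner ℝ ξ x.1)),
      div_pos (by linarith) (mul_pos (by linarith) (by linarith)), ?_⟩
    have n1 : inner ℝ ξ x.2 - inner ℝ ξ x.1 ≠ 0 := by linarith
    have n2 : inner ℝ ξ d - inner ℝ ξ x.1 ≠ 0 := by linarith
    simp only [slicePoint]
    apply ext_three <;> simp <;> field_simp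

/-- The slice of a triangle lies in the triangle. -/
theorem segment_slice_subset (o : P.Orientation) {ξ : E3} {c : ℝ} {L : Set E3}
    (hL : ∀ x ∈ P.verts, (x ∈ L → inner ℝ ξ x ≤ c) ∧ (x ∉ L → c ≤ inner ℝ ξ x))
    (hg : P.IsGeneral ξ) {x : E3 × E3} (hx : x ∈ P.cut L) :
    segment ℝ (slicePoint ξ c x) (slicePoint ξ c (o.nextEdge L x)) ⊆
      convexHull ℝ (o.tri x : Set E3) := by
  have key : ∀ y ∈ P.cut L, y.1 ∈ o.tri x → y.2 ∈ o.tri x →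
      slicePoint ξ c y ∈ convexHull ℝ (o.tri x : Set E3) := by
    intro y hy h1 h2
    rw [mem_cut] at hy
    have l1 := (hL _ hy.1.mem_left).1 hy.2.1
    have l2 := (hL _ hy.1.mem_right).2 hy.2.2
    exact segment_subset_convexHull h1 h2
      (slicePoint_mem_segment l1 l2 (lt_of_le_of_ne (l1.trans l2) (hg.ne hy.1)))
  refine (convex_convexHull ℝ _).segment_subset (key x hx (by simp [Orientation.tri])
    (by simp [Orientation.tri])) (key _ (o.nextEdge_mem hx) ?_ ?_)
  · rw [Orientation.nextEdge]; split_ifs <;> simp [Orientation.tri]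
  · rw [Orientation.nextEdge]; split_ifs <;> simp [Orientation.tri]

/-- The slices of two triangles without a common outgoing edge are disjoint. -/
theorem slices_disjoint (o : P.Orientation) {ξ : E3} {c : ℝ} {L : Set E3} (hg : P.IsGeneral ξ)
    (hL : P.IsBelow ξ c L) {x y : E3 × E3} (hx : x ∈ P.cut L) (hy : y ∈ P.cut L) (h1 : x ≠ y)
    (h2 : o.nextEdge L x ≠ y) (h3 : o.nextEdge L y ≠ x) {p : E3}
    (hp : p ∈ segment ℝ (slicePoint ξ c x) (slicePoint ξ c (o.nextEdge L x)))
    (hp' : p ∈ segment ℝ (slicePoint ξ c y) (slicePoint ξ c (o.nextEdge L y))) : False := by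
  have hL' : ∀ x ∈ P.verts, (x ∈ L → inner ℝ ξ x ≤ c) ∧ (x ∉ L → c ≤ inner ℝ ξ x) :=
    fun x hx => ⟨fun h => ((hL x hx).1 h).le, fun h => ((hL x hx).2 h).le⟩
  have fx := o.tri_mem (mem_cut.1 hx).1
  have fy := o.tri_mem (mem_cut.1 hy).1
  -- A common point lies in the hull of the common corners. As no vertex has height `c`, there are
  -- common corners on both sides of the level, so the two triangles share an outgoing edge.
  have hpc := P.inter_subset_convexHull fx fy
    ⟨segment_slice_subset o hL' hg hx hp, segment_slice_subset o hL' hg hy hp'⟩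
  rw [← Finset.coe_inter] at hpc
  have hh : inner ℝ ξ p = c := by
    have hconv : Convex ℝ {z : E3 | inner ℝ ξ z = c} :=
      convex_hyperplane (innerSL ℝ ξ : E3 →L[ℝ] ℝ).isLinear c
    exact hconv.segment_subset (inner_slicePoint c (hg.ne (mem_cut.1 hx).1))
      (inner_slicePoint c (hg.ne (mem_cut.1 (o.nextEdge_mem hx)).1)) hp
  obtain ⟨a, ha, hac⟩ := exists_mem_below hpc hh
  obtain ⟨b, hb, hbc⟩ := exists_mem_above hpc hh
  rw [Finset.mem_inter] at ha hb
  have haL : a ∈ L := by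
    by_contra h
    exact absurd ((hL a (mem_verts_of_mem fx ha.1)).2 h) (not_lt.2 hac)
  have hbL : b ∉ L := fun h => absurd ((hL b (mem_verts_of_mem fx hb.1)).1 h) (not_lt.2 hbc)
  rcases o.eq_or_eq_nextEdge hx ha.1 hb.1 haL hbL with e | e <;>
    rcases o.eq_or_eq_nextEdge hy ha.2 hb.2 haL hbL with e' | e'
  · exact h1 (e.symm.trans e')
  · exact h3 (e'.symm.trans e)
  · exact h2 (e.symm.trans e')
  · have := congrArg (o.prevEdge L) (e.symm.trans e')
    rw [o.prevEdge_nextEdge hx, o.prevEdge_nextEdge hy] at this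
    exact h1 this

/-- The directions of the slices of adjacent triangles are independent. -/
theorem cross_sliceDir_ne_zero (o : P.Orientation) {ξ : E3} (hξ : ξ ≠ 0) (hg : P.IsGeneral ξ) {a b : E3}
    (h : P.Adj a b) : cross (o.sliceDir ξ (b, a)) (o.sliceDir ξ (a, b)) ≠ 0 := by
  obtain ⟨c, hc⟩ := o.exists_pos h
  obtain ⟨d, hd⟩ := o.exists_pos h.symm
  have hne := o.inner_cross_ne_zero hc hd
  rw [o.sliceDir_of_pos ξ hc, o.sliceDir_of_pos ξ hd]
  -- The product of the two directions is a multiple of `ξ`. Its factor is the triple product at the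
  -- edge times the difference of heights along the edge.
  have e : ∀ x y z : E3, cross (cross x z) (cross y z) = (inner ℝ (cross x y) z) • z := by
    intro x y z
    simp only [inner_eq]
    apply ext_three <;> simp <;> ring
  rw [e]
  have e2 : inner ℝ (cross (cross (a - b) (d - b)) (cross (b - a) (c - a))) ξ =
      inner ℝ (cross (b - a) (c - a)) (d - a) * (inner ℝ ξ b - inner ℝ ξ a) := by
    simp only [inner_eq]; simp; ring
  rw [e2]
  exact smul_ne_zero (mul_ne_zero hne (sub_ne_zero.2 (hg.ne h).symm)) hξ

end SimplicialSurface

theorem cross_smul_add_smul_left (a b : ℝ) (x y : E3) : cross (a • x + b • y) y = a • cross x y := by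
  apply ext_three <;> simp <;> ring

theorem cross_smul_add_smul_right (a b : ℝ) (x y : E3) :
    cross x (a • x + b • y) = b • cross x y := by
  apply ext_three <;> simp <;> ring

/-! ### The total turning of a slice and its limit at a vertex -/

namespace SimplicialSurface

variable {P : SimplicialSurface}

/-- The signed number of crossings of the slice of `P` at height `c` with a ray from a point of the
edge `y`, the direction of which is reversed if `s` is negative. -/
def sweep (o : P.Orientation) (ξ μ : E3) (L : Set E3) (s c : ℝ) (y : E3 × E3) : ℤ :=
  ∑ x ∈ P.cut L, rayCrossing (planeCoord ξ μ (s • (slicePoint ξ c x - slicePoint ξ c y)))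
    (planeCoord ξ μ (s • (slicePoint ξ c (o.nextEdge L x) - slicePoint ξ c y)))

/-- The sides are positive multiples of the `sliceDir`s, so the turning of the slice at a point
depends only on the edge through it and not on the level. -/
theorem rayCrossing_slices (o : P.Orientation) {ξ : E3} (μ : E3) {c : ℝ} {L : Set E3}
    (hL : P.IsBelow ξ c L) (x : P.cut L) :
    rayCrossing (planeCoord ξ μ (slicePoint ξ c (o.next L x)) - planeCoord ξ μ (slicePoint ξ c x))
      (planeCoord ξ μ (slicePoint ξ c (o.next L (o.next L x))) -
        planeCoord ξ μ (slicePoint ξ c (o.next L x))) = o.edgeTurning ξ μ (o.next L x) := by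
  obtain ⟨r, hr, e⟩ := slicePoint_nextEdge_sub o hL x.2
  obtain ⟨r', hr', e'⟩ := slicePoint_nextEdge_sub o hL (o.next L x).2
  rw [← map_sub, ← map_sub, o.coe_next L (o.next L x), e', o.coe_next L x, e, map_smul, map_smul,
    rayCrossing_smul hr hr', Orientation.edgeTurning, o.sliceDir_nextEdge ξ x.2]

/-- The total turning of a connected slice. -/
theorem sum_edgeTurning (o : P.Orientation) {ξ μ : E3} (hξ : ξ ≠ 0) (hμ : cross μ ξ ≠ 0)
    (hg : P.IsGeneral ξ) {c : ℝ} {L : Set E3} (hL : P.IsBelow ξ c L) (hconn : o.CutConnected L)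
    {y : E3 × E3} (hy : y ∈ P.cut L) :
    ∑ x ∈ P.cut L, o.edgeTurning ξ μ x =
      sweep o ξ μ L 1 c (o.nextEdge L y) + sweep o ξ μ L (-1) c y + o.edgeTurning ξ μ y +
        o.edgeTurning ξ μ (o.nextEdge L y) := by
  have hh : ∀ x : P.cut L, inner ℝ ξ (slicePoint ξ c x) = c := fun x =>
    inner_slicePoint c (hg.ne (mem_cut.1 x.2).1)
  -- The simple closed polygon is cut open along the side that starts at the edge `y`.
  have main := sum_rayCrossing_cycle (σ := o.next L) (y := ⟨y, hy⟩)
    (fun x => hconn.sameCycle _ x) (o.next_ne L _)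
    (fun x => planeCoord ξ μ (slicePoint ξ c x)) (by
      intro u v h1 h2 h3 p hp r hr hpr
      have hseg : ∀ z z' : E3, segment ℝ (planeCoord ξ μ z) (planeCoord ξ μ z') =
          planeCoord ξ μ '' segment ℝ z z' := fun z z' =>
        (image_segment ℝ (planeCoord ξ μ).toAffineMap z z').symm
      rw [hseg] at hp hr
      obtain ⟨p', hp', rfl⟩ := hp
      obtain ⟨r', hr', rfl⟩ := hr
      have hconv : Convex ℝ {z : E3 | inner ℝ ξ z = c} :=
        convex_hyperplane (innerSL ℝ ξ : E3 →L[ℝ] ℝ).isLinear c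
      have e1 : inner ℝ ξ p' = c := hconv.segment_subset (hh u) (hh (o.next L u)) hp'
      have e2 : inner ℝ ξ r' = c := hconv.segment_subset (hh v) (hh (o.next L v)) hr'
      have e3 : p' - r' = 0 := eq_zero_of_planeCoord_eq_zero hμ
        (by rw [inner_sub_right, e1, e2, sub_self]) (by rw [map_sub]; exact sub_eq_zero.2 hpr)
      rw [sub_eq_zero] at e3
      subst e3
      exact slices_disjoint o hg hL u.2 v.2 (fun h => h1 (Subtype.ext h))
        (fun h => h2 (Subtype.ext h)) (fun h => h3 (Subtype.ext h)) hp' hr') (by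
      intro u a b ha hb h0
      obtain ⟨r, hr, e⟩ := slicePoint_nextEdge_sub o hL u.2
      obtain ⟨r', hr', e'⟩ := slicePoint_nextEdge_sub o hL (o.next L u).2
      rw [o.coe_next L (o.next L u), ← map_sub, ← map_sub, e', o.coe_next L u, e,
        ← map_smul, ← map_smul, ← map_add, smul_smul, smul_smul] at h0
      have h1 := eq_zero_of_planeCoord_eq_zero hμ (by
        rw [inner_add_right, inner_smul_right, inner_smul_right, inner_sliceDir, inner_sliceDir]
        simp) h0
      -- Consecutive sides are independent, so the polygon never doubles back.
      have hne := cross_sliceDir_ne_zero o hξ hg (mem_cut.1 (o.next L u).2).1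
      rw [o.coe_next L u, o.sliceDir_nextEdge ξ u.2] at hne
      have h2 := cross_smul_add_smul_left (a * r) (b * r') (o.sliceDir ξ u)
        (o.sliceDir ξ (o.nextEdge L u))
      have h3 := cross_smul_add_smul_right (a * r) (b * r') (o.sliceDir ξ u)
        (o.sliceDir ξ (o.nextEdge L u))
      rw [h1] at h2 h3
      have z1 : ∀ x : E3, cross 0 x = 0 := fun x => by apply ext_three <;> simp
      have z2 : ∀ x : E3, cross x 0 = 0 := fun x => by apply ext_three <;> simp
      rw [z1] at h2
      rw [z2] at h3
      have h4 := (smul_eq_zero.1 h2.symm).resolve_right hne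
      have h5 := (smul_eq_zero.1 h3.symm).resolve_right hne
      exact ⟨(mul_eq_zero.1 h4).resolve_right hr.ne', (mul_eq_zero.1 h5).resolve_right hr'.ne'⟩)
  simp only [rayCrossing_slices o μ hL] at main
  rw [Equiv.sum_comp (o.next L) (fun x => o.edgeTurning ξ μ x)] at main
  have hlast := rayCrossing_slices o μ hL ((o.next L).symm ⟨y, hy⟩)
  rw [Equiv.apply_symm_apply] at hlast
  rw [hlast] at main
  rw [← Finset.sum_coe_sort, main, sweep, sweep, ← Finset.sum_coe_sort (P.cut L),
    ← Finset.sum_coe_sort (P.cut L)]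
  congr 1; congr 1; congr 1
  · refine Finset.sum_congr rfl fun x _ => ?_
    simp only [one_smul, map_sub, o.coe_next]
  · refine Finset.sum_congr rfl fun x _ => ?_
    simp only [neg_smul, one_smul, neg_sub, map_sub, o.coe_next]

section Limit

variable {ξ : E3} {c : ℝ} {L : Set E3}

/-- The vertices in `L` have height at most `c`, the others have height at least `c`. -/
def IsWeaklyBelow (P : SimplicialSurface) (ξ : E3) (c : ℝ) (L : Set E3) : Prop :=
  ∀ x ∈ P.verts, (x ∈ L → inner ℝ ξ x ≤ c) ∧ (x ∉ L → c ≤ inner ℝ ξ x)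

/-- A point of an edge that crosses the level `c` properly lies in no simplex that does not contain
this edge. -/
theorem mem_of_slicePoint_mem {y : E3 × E3} (hy : P.Adj y.1 y.2) (h1 : inner ℝ ξ y.1 < c)
    (h2 : c < inner ℝ ξ y.2) {s : Finset E3} (hs : s ∈ P.faces)
    (h : slicePoint ξ c y ∈ convexHull ℝ (s : Set E3)) : y.1 ∈ s ∧ y.2 ∈ s := by
  have hseg : slicePoint ξ c y ∈ convexHull ℝ (({y.1, y.2} : Finset E3) : Set E3) := by
    rw [Finset.coe_pair, convexHull_pair]
    exact slicePoint_mem_segment h1.le h2.le (h1.trans h2)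
  have hp := P.inter_subset_convexHull hy.2 hs ⟨hseg, h⟩
  rw [← Finset.coe_inter] at hp
  have hh := inner_slicePoint c (x := y) (h1.trans h2).ne
  obtain ⟨a, ha, hac⟩ := exists_mem_below hp hh
  obtain ⟨b, hb, hbc⟩ := exists_mem_above hp hh
  simp only [Finset.mem_inter, Finset.mem_insert, Finset.mem_singleton] at ha hb
  constructor
  · rcases ha.1 with rfl | rfl
    · exact ha.2
    · exact absurd h2 (not_lt.2 hac)
  · rcases hb.1 with rfl | rfl
    · exact absurd h1 (not_lt.2 hbc)
    · exact hb.2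

/-- Distinct edges can only meet in a vertex, and `y` crosses the level in its interior. -/
theorem slicePoint_ne {x y : E3 × E3} (hg : P.IsGeneral ξ) (hL : P.IsWeaklyBelow ξ c L)
    (hx : x ∈ P.cut L) (hy : P.Adj y.1 y.2) (h1 : inner ℝ ξ y.1 < c) (h2 : c < inner ℝ ξ y.2)
    (hxy : x ≠ y) : slicePoint ξ c x ≠ slicePoint ξ c y := by
  intro h
  rw [mem_cut] at hx
  have l1 := (hL _ hx.1.mem_left).1 hx.2.1
  have l2 := (hL _ hx.1.mem_right).2 hx.2.2
  have hseg : slicePoint ξ c x ∈ convexHull ℝ (({x.1, x.2} : Finset E3) : Set E3) := by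
    rw [Finset.coe_pair, convexHull_pair]
    exact slicePoint_mem_segment l1 l2 (lt_of_le_of_ne (l1.trans l2) (hg.ne hx.1))
  rw [h] at hseg
  have hm := mem_of_slicePoint_mem hy h1 h2 hx.1.2 hseg
  simp only [Finset.mem_insert, Finset.mem_singleton] at hm
  apply hxy
  refine Prod.ext ?_ ?_
  · rcases hm.1 with e | e
    · exact e.symm
    · rw [e] at h1; exact absurd h1 (not_lt.2 l2)
  · rcases hm.2 with e | e
    · rw [e] at h2; exact absurd h2 (not_lt.2 l1)
    · exact e.symm

-- The level `c` may contain a vertex, yet the sweep seen from `y` does not jump there. By the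
-- choice of `μ` no other slice point lies on the line of the ray, and a side through the viewpoint
-- belongs to a triangle with edge `y`, whose terms vanish at every level.
open Filter Topology in
theorem eventually_sweep_eq (o : P.Orientation) {μ : E3} (hμ : cross μ ξ ≠ 0) (hg : P.IsGeneral ξ)
    (hL : P.IsWeaklyBelow ξ c L)
    (hgen : ∀ x y : E3 × E3, P.Adj x.1 x.2 → P.Adj y.1 y.2 → slicePoint ξ c x ≠ slicePoint ξ c y →
      inner ℝ μ (slicePoint ξ c x - slicePoint ξ c y) ≠ 0) {y : E3 × E3} (hy : P.Adj y.1 y.2)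
    (h1 : inner ℝ ξ y.1 < c) (h2 : c < inner ℝ ξ y.2) {s : ℝ} (hs : s ≠ 0) :
    ∀ᶠ d in 𝓝 c, sweep o ξ μ L s d y = sweep o ξ μ L s c y := by
  have key : ∀ x ∈ P.cut L, ∀ᶠ d in 𝓝 c,
      rayCrossing (planeCoord ξ μ (s • (slicePoint ξ d x - slicePoint ξ d y)))
        (planeCoord ξ μ (s • (slicePoint ξ d (o.nextEdge L x) - slicePoint ξ d y))) =
      rayCrossing (planeCoord ξ μ (s • (slicePoint ξ c x - slicePoint ξ c y)))
        (planeCoord ξ μ (s • (slicePoint ξ c (o.nextEdge L x) - slicePoint ξ c y))) := by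
    intro x hx
    by_cases hxy : x = y
    · subst hxy
      refine Eventually.of_forall fun d => ?_
      simp only [sub_self, smul_zero, map_zero, rayCrossing_zero_left]
    by_cases hnxy : o.nextEdge L x = y
    · rw [hnxy]
      refine Eventually.of_forall fun d => ?_
      simp only [sub_self, smul_zero, map_zero, rayCrossing_zero_right]
    have hnx := o.nextEdge_mem hx
    have n1 : inner ℝ μ (slicePoint ξ c x - slicePoint ξ c y) ≠ 0 :=
      hgen x y (mem_cut.1 hx).1 hy (slicePoint_ne hg hL hx hy h1 h2 hxy)
    have n2 : inner ℝ μ (slicePoint ξ c (o.nextEdge L x) - slicePoint ξ c y) ≠ 0 :=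
      hgen _ y (mem_cut.1 hnx).1 hy (slicePoint_ne hg hL hnx hy h1 h2 hnxy)
    have hcont : ∀ z : E3 × E3, Tendsto
        (fun d => planeCoord ξ μ (s • (slicePoint ξ d z - slicePoint ξ d y))) (𝓝 c)
        (𝓝 (planeCoord ξ μ (s • (slicePoint ξ c z - slicePoint ξ c y)))) := by
      intro z
      have h3 := continuous_slicePoint ξ z
      have h4 := continuous_slicePoint ξ y
      have h5 : Continuous (planeCoord ξ μ) := LinearMap.continuous_of_finiteDimensional _
      exact (h5.comp ((h3.sub h4).const_smul s)).tendsto c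
    refine eventually_rayCrossing_eq (hcont x) (hcont _) ?_ ?_ ?_
    · intro h
      rw [planeCoord_apply, inner_smul_right] at h
      exact absurd h (mul_ne_zero hs n1)
    · intro h
      rw [planeCoord_apply, inner_smul_right] at h
      exact absurd h (mul_ne_zero hs n2)
    · intro hneg hdet
      set a := planeCoord ξ μ (s • (slicePoint ξ c x - slicePoint ξ c y)) with ha
      set b := planeCoord ξ μ (s • (slicePoint ξ c (o.nextEdge L x) - slicePoint ξ c y)) with hb
      have hne : b.1 - a.1 ≠ 0 := by
        intro h
        have : b.1 = a.1 := by linarith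
        rw [this] at hneg
        nlinarith [mul_self_nonneg a.1]
      -- If the determinant vanishes, these weights exhibit the origin as a point between `a` and
      -- `b`, hence the viewpoint as a point of the side; then `y` is an edge of that triangle.
      have hpos : 0 ≤ b.1 / (b.1 - a.1) ∧ 0 ≤ -a.1 / (b.1 - a.1) := by
        rcases lt_or_gt_of_ne hne with h | h
        · have : b.1 < 0 ∧ 0 < a.1 := by
            constructor <;> by_contra hc <;> push Not at hc <;> nlinarith
          exact ⟨(div_pos_of_neg_of_neg this.1 h).le, (div_pos_of_neg_of_neg (by linarith) h).le⟩
        · have : 0 < b.1 ∧ a.1 < 0 := by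
            constructor <;> by_contra hc <;> push Not at hc <;> nlinarith
          exact ⟨(div_pos this.1 h).le, (div_pos (by linarith) h).le⟩
      have h0 : (b.1 / (b.1 - a.1)) • a + (-a.1 / (b.1 - a.1)) • b = 0 := by
        ext
        · simp; field_simp; ring
        · simp; field_simp; linarith
      have hsum : b.1 / (b.1 - a.1) + -a.1 / (b.1 - a.1) = 1 := by field_simp; ring
      set t := b.1 / (b.1 - a.1)
      set t' := -a.1 / (b.1 - a.1)
      rw [ha, hb, ← map_smul, ← map_smul, ← map_add] at h0
      have e1 := inner_slicePoint c (hg.ne (mem_cut.1 hx).1)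
      have e2 := inner_slicePoint c (hg.ne (mem_cut.1 hnx).1)
      have e3 := inner_slicePoint c (hg.ne hy)
      have hz := eq_zero_of_planeCoord_eq_zero hμ (by
        simp only [inner_add_right, inner_smul_right, inner_sub_right, e1, e2, e3]
        simp) h0
      have hz' : s • (t • slicePoint ξ c x + t' • slicePoint ξ c (o.nextEdge L x) -
          (t + t') • slicePoint ξ c y) = 0 := by
        rw [← hz]; module
      rw [hsum, one_smul] at hz'
      have hyseg : slicePoint ξ c y ∈
          segment ℝ (slicePoint ξ c x) (slicePoint ξ c (o.nextEdge L x)) :=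
        ⟨t, t', hpos.1, hpos.2, hsum, sub_eq_zero.1 ((smul_eq_zero.1 hz').resolve_left hs)⟩
      have hm := mem_of_slicePoint_mem hy h1 h2 (o.tri_mem (mem_cut.1 hx).1)
        (segment_slice_subset o hL hg hx hyseg)
      have hyL : y.1 ∈ L := by
        by_contra h
        exact absurd ((hL _ hy.mem_left).2 h) (not_le.2 h1)
      have hyL' : y.2 ∉ L := fun h => absurd ((hL _ hy.mem_right).1 h) (not_le.2 h2)
      rcases o.eq_or_eq_nextEdge hx hm.1 hm.2 hyL hyL' with e | e
      · exact hxy e.symm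
      · exact hnxy e.symm
  filter_upwards [(P.cut L).eventually_all.2 key] with d hd
  exact Finset.sum_congr rfl hd

end Limit

section Insert

variable {L : Set E3} {v : E3}

/-- The cuts of `L` and of `insert v L` differ only in the edges at `v`: those coming from `L` are
exchanged for those going out. This lemma and the next split off these edges. -/
theorem sum_cut_eq (hv : v ∉ L) {M : Type*} [AddCommMonoid M] (g : E3 × E3 → M) :
    ∑ x ∈ P.cut L, g x = ∑ x ∈ (P.cut L).filter (fun x => x.2 ≠ v), g x +
      ∑ a : P.link v, if (a : E3) ∈ L then g (a, v) else 0 := by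
  rw [← Finset.sum_filter_not_add_sum_filter _ (fun x => x.2 = v)]
  congr 1
  rw [Finset.sum_coe_sort (P.link v) (fun a => if a ∈ L then g (a, v) else 0), ← Finset.sum_filter]
  symm
  refine Finset.sum_bij (fun a _ => (a, v)) ?_ ?_ ?_ ?_
  · intro a ha
    simp only [Finset.mem_filter, mem_link, mem_cut] at ha ⊢
    exact ⟨⟨ha.1.symm, ha.2, hv⟩, by simp⟩
  · intro a _ b _ h
    exact congrArg Prod.fst h
  · rintro ⟨a, b⟩ hx
    simp only [Finset.mem_filter, mem_cut] at hx
    obtain ⟨⟨h1, h2, h3⟩, rfl⟩ := hx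
    exact ⟨a, Finset.mem_filter.2 ⟨mem_link.2 h1.symm, h2⟩, rfl⟩
  · intro a _; rfl

theorem sum_cut_insert_eq {M : Type*} [AddCommMonoid M] (g : E3 × E3 → M) (hv : v ∉ L) :
    ∑ x ∈ P.cut (insert v L), g x = ∑ x ∈ (P.cut L).filter (fun x => x.2 ≠ v), g x +
      ∑ b : P.link v, if (b : E3) ∉ L then g (v, b) else 0 := by
  rw [← Finset.sum_filter_not_add_sum_filter _ (fun x => x.1 = v)]
  congr 1
  · refine Finset.sum_congr ?_ fun _ _ => rfl
    ext x
    simp only [Finset.mem_filter, mem_cut, Set.mem_insert_iff]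
    constructor
    · rintro ⟨⟨h1, h2, h3⟩, h4⟩
      exact ⟨⟨h1, h2.resolve_left h4, fun h => h3 (Or.inr h)⟩, fun h => h3 (Or.inl h)⟩
    · rintro ⟨⟨h1, h2, h3⟩, h4⟩
      exact ⟨⟨h1, Or.inr h2, by rintro (h | h) <;> contradiction⟩, by rintro h; exact hv (h ▸ h2)⟩
  rw [Finset.sum_coe_sort (P.link v) (fun a => if a ∉ L then g (v, a) else 0), ← Finset.sum_filter]
  symm
  refine Finset.sum_bij (fun a _ => (v, a)) ?_ ?_ ?_ ?_
  · intro a ha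
    simp only [Finset.mem_filter, mem_link, mem_cut] at ha ⊢
    refine ⟨⟨ha.1, Set.mem_insert _ _, ?_⟩, by simp⟩
    rintro (h | h)
    · exact ha.1.1 h.symm
    · exact ha.2 h
  · intro a _ b _ h
    exact congrArg Prod.snd h
  · rintro ⟨a, b⟩ hx
    simp only [Finset.mem_filter, mem_cut, Set.mem_insert_iff] at hx
    obtain ⟨⟨h1, h2, h3⟩, rfl⟩ := hx
    exact ⟨b, Finset.mem_filter.2 ⟨mem_link.2 h1, fun h => h3 (Or.inr h)⟩, rfl⟩
  · intro a _; rfl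

theorem nextEdge_insert (o : P.Orientation) (x : E3 × E3) (h : o.opp x.1 x.2 ≠ v) :
    o.nextEdge (insert v L) x = o.nextEdge L x := by
  simp only [Orientation.nextEdge, Set.mem_insert_iff, h, false_or]

/-- A sum over the sides of the slice at the level of a vertex `v` is the same whether this slice is
seen as a limit from below or from above. -/
theorem sum_slices_eq (o : P.Orientation) {ξ : E3} (hg : P.IsGeneral ξ) (hv : v ∉ L) (F : E3 → E3 → ℤ)
    (hF : F v v = 0) :
    ∑ x ∈ P.cut L, F (slicePoint ξ (inner ℝ ξ v) x) (slicePoint ξ (inner ℝ ξ v) (o.nextEdge L x)) =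
      ∑ x ∈ P.cut (insert v L), F (slicePoint ξ (inner ℝ ξ v) x)
        (slicePoint ξ (inner ℝ ξ v) (o.nextEdge (insert v L) x)) := by
  rw [sum_cut_eq hv, sum_cut_insert_eq _ hv]
  congr 1
  · refine Finset.sum_congr rfl fun x hx => ?_
    simp only [Finset.mem_filter, mem_cut] at hx
    obtain ⟨⟨h1, h2, h3⟩, h4⟩ := hx
    -- If `v` is the third corner, the side ends at `v` in both readings: as the upper end of one
    -- edge and as the lower end of the other.
    by_cases h : o.opp x.1 x.2 = v
    · have hp := o.pos_opp h1
      rw [h] at hp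
      have e1 : o.nextEdge L x = (x.1, v) := by simp [Orientation.nextEdge, h, hv]
      have e2 : o.nextEdge (insert v L) x = (v, x.2) := by simp [Orientation.nextEdge, h]
      rw [e1, e2, slicePoint_fst, slicePoint_snd (hg.ne (o.adj₃ hp).symm)]
    · rw [nextEdge_insert o x h]
  · rw [← Equiv.sum_comp (o.rot v)]
    refine Finset.sum_congr rfl fun b _ => ?_
    have hp := o.pos_rot v b
    have e1 := o.opp_eq₃ hp
    have e2 := o.opp_eq hp
    set a : E3 := (o.rot v b : E3)
    have hav : a ≠ v := (o.adj₃ hp).1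
    -- If `a` is in `L` and `b` is not, the edge from `a` to `v` and the edge from `v` to `b` start
    -- the same side. In the other cases each term is absent or equal to `F v v`.
    by_cases ha : a ∈ L <;> by_cases hb : (b : E3) ∈ L
    · simp [ha, hb, Orientation.nextEdge, e1, slicePoint_snd (hg.ne (o.adj₃ hp)),
        slicePoint_snd (hg.ne (o.adj hp).symm), hF]
    · simp [ha, hb, Orientation.nextEdge, e1, e2, slicePoint_snd (hg.ne (o.adj₃ hp)),
        slicePoint_fst]
    · simp [ha, hb]
    · simp [ha, hb, hav, Orientation.nextEdge, e2, slicePoint_fst, hF]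

end Insert

namespace ThreeCritical

variable {ξ top bot mid : E3}

open Filter Topology in
/-- The Gauss image of the star of the third critical point does not wind around the axis. -/
theorem sum_edgeTurning_link (h : P.ThreeCritical ξ top bot mid) (o : P.Orientation) {μ : E3}
    (hξ : ξ ≠ 0) (hμ : cross μ ξ ≠ 0)
    (hgen : ∀ x y : E3 × E3, P.Adj x.1 x.2 → P.Adj y.1 y.2 →
      slicePoint ξ (inner ℝ ξ mid) x ≠ slicePoint ξ (inner ℝ ξ mid) y →
      inner ℝ μ (slicePoint ξ (inner ℝ ξ mid) x - slicePoint ξ (inner ℝ ξ mid) y) ≠ 0) :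
    ∑ w : P.link mid, o.edgeTurning ξ μ (mid, w) = 0 := by
  have hg := h.general
  set c := inner ℝ ξ mid with hc
  set L : Set E3 := {x | inner ℝ ξ x < c} with hLdef
  have hv : mid ∉ L := lt_irrefl c
  have hLv : ∀ x ∈ P.verts, x ∉ insert mid L → c < inner ℝ ξ x := by
    intro x hx hn
    refine lt_of_le_of_ne (not_lt.1 fun hlt => hn (Or.inr hlt)) fun e => hn (Or.inl ?_)
    exact h.inj hx h.mid_mem e.symm
  have hLw : P.IsWeaklyBelow ξ c L := fun x _ => ⟨fun h => le_of_lt h, fun h => not_lt.1 h⟩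
  have hLw' : P.IsWeaklyBelow ξ c (insert mid L) := fun x hx =>
    ⟨fun h => h.elim (fun e => by rw [e]) (fun e => le_of_lt e), fun hn => (hLv x hx hn).le⟩
  have hconn : o.CutConnected L := h.cutConnected_lt o
  have hconn' : o.CutConnected (insert mid L) := by
    refine (h.cutConnected_le o).congr fun x hx => ⟨fun hle => ?_, fun hm => ?_⟩
    · by_contra hn
      exact absurd (hLv x hx hn) (not_lt.2 hle)
    · exact (hLw' x hx).1 hm
  -- the levels just below and just above
  have hbelow : ∀ᶠ d in 𝓝[<] c, P.IsBelow ξ d L := by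
    have h1 : ∀ x ∈ P.verts, ∀ᶠ d in 𝓝[<] c, (x ∈ L → inner ℝ ξ x < d) ∧ (x ∉ L → d < inner ℝ ξ x) := by
      intro x _
      by_cases hx : x ∈ L
      · filter_upwards [eventually_nhdsWithin_of_eventually_nhds (eventually_gt_nhds hx)] with d hd
        exact ⟨fun _ => hd, fun h => absurd hx h⟩
      · filter_upwards [self_mem_nhdsWithin] with d hd
        exact ⟨fun h => absurd h hx, fun _ => lt_of_lt_of_le hd (not_lt.1 hx)⟩
    exact P.verts.eventually_all.2 h1
  have habove : ∀ᶠ d in 𝓝[>] c, P.IsBelow ξ d (insert mid L) := by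
    have h1 : ∀ x ∈ P.verts, ∀ᶠ d in 𝓝[>] c,
        (x ∈ insert mid L → inner ℝ ξ x < d) ∧ (x ∉ insert mid L → d < inner ℝ ξ x) := by
      intro x hxv
      by_cases hx : x ∈ insert mid L
      · filter_upwards [self_mem_nhdsWithin] with d hd
        exact ⟨fun _ => lt_of_le_of_lt ((hLw' x hxv).1 hx) hd, fun h => absurd hx h⟩
      · filter_upwards [eventually_nhdsWithin_of_eventually_nhds
          (eventually_lt_nhds (hLv x hxv hx))] with d hd
        exact ⟨fun h => absurd h hx, fun _ => hd⟩
    exact P.verts.eventually_all.2 h1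
  -- a triangle that crosses the level properly
  obtain ⟨a, b, hpab, ha, hb⟩ := h.exists_mixed o
  have hab := o.adj₂ hpab
  have haL : a ∈ L := ha
  have hbL : b ∉ insert mid L := by
    rintro (e | e)
    · rw [e] at hb; exact lt_irrefl _ hb
    · exact lt_asymm hb e
  have hbL0 : b ∉ L := fun h => hbL (Or.inr h)
  have hp := o.pos_opp hab.symm
  -- The third corner of the triangle beyond the edge `ab`, as seen from `mid`. This triangle avoids
  -- `mid`, so its slice is a side of the polygons on both sides of the level; they are cut open
  -- there.
  set d := o.opp b a with hd
  have hdm : d ≠ mid := by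
    intro e
    rw [e] at hp
    exact o.asymm _ _ _ hp (o.rotate _ _ _ hpab)
  obtain ⟨y, hyc, hyn, hy1, hy2, hynext, hynext'⟩ : ∃ y : E3 × E3, y ∈ P.cut L ∧
      y ∈ P.cut (insert mid L) ∧ inner ℝ ξ y.1 < c ∧ c < inner ℝ ξ y.2 ∧
      o.nextEdge L y = (a, b) ∧ o.nextEdge (insert mid L) y = (a, b) := by
    have m1 : (a, b) ∈ P.cut L := mem_cut.2 ⟨hab, haL, hbL0⟩
    have m2 : (a, b) ∈ P.cut (insert mid L) := mem_cut.2 ⟨hab, Or.inr haL, hbL⟩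
    have e : o.prevEdge (insert mid L) (a, b) = o.prevEdge L (a, b) := by
      simp only [Orientation.prevEdge, Set.mem_insert_iff, ← hd, hdm, false_or]
    refine ⟨o.prevEdge L (a, b), o.prevEdge_mem m1, e ▸ o.prevEdge_mem m2, ?_, ?_,
      o.nextEdge_prevEdge m1, e ▸ o.nextEdge_prevEdge m2⟩
    · exact (mem_cut.1 (o.prevEdge_mem m1)).2.1
    · have := mem_cut.1 (o.prevEdge_mem m2)
      rw [e] at this
      exact hLv _ this.1.mem_right this.2.2
  have hyadj := (mem_cut.1 hyc).1
  have ev : ∀ K : Set E3, P.IsWeaklyBelow ξ c K → ∀ᶠ d in 𝓝 c,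
      sweep o ξ μ K 1 d (a, b) = sweep o ξ μ K 1 c (a, b) ∧
        sweep o ξ μ K (-1) d y = sweep o ξ μ K (-1) c y := fun K hK =>
    (eventually_sweep_eq o hμ hg hK hgen hab ha hb one_ne_zero).and
      (eventually_sweep_eq o hμ hg hK hgen hyadj hy1 hy2 (by norm_num))
  obtain ⟨d₁, hd₁, hs₁⟩ := (hbelow.and (eventually_nhdsWithin_of_eventually_nhds (ev L hLw))).exists
  obtain ⟨d₂, hd₂, hs₂⟩ := (habove.and
    (eventually_nhdsWithin_of_eventually_nhds (ev _ hLw'))).exists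
  have t₁ := sum_edgeTurning o hξ hμ hg hd₁ hconn hyc
  have t₂ := sum_edgeTurning o hξ hμ hg hd₂ hconn' hyn
  rw [hynext, hs₁.1, hs₁.2] at t₁
  rw [hynext', hs₂.1, hs₂.2] at t₂
  -- At the level of `mid` both sweeps are sums over the same limit polygon, so the total turnings
  -- just below and just above agree.
  have hsw : ∀ (s : ℝ) (z : E3 × E3), sweep o ξ μ L s c z = sweep o ξ μ (insert mid L) s c z := by
    intro s z
    exact sum_slices_eq o hg hv (fun p q => rayCrossing (planeCoord ξ μ (s • (p - slicePoint ξ c z)))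
      (planeCoord ξ μ (s • (q - slicePoint ξ c z)))) (rayCrossing_self _)
  rw [hsw, hsw, ← t₂, sum_cut_eq hv, sum_cut_insert_eq _ hv] at t₁
  -- The edges away from `mid` cancel. What remains are the edges into `mid` below and the edges out
  -- of it above, and reversal changes the sign of a turning.
  have t₃ := add_left_cancel t₁
  rw [eq_comm, ← sub_eq_zero, ← Finset.sum_sub_distrib] at t₃
  rw [← t₃]
  refine Finset.sum_congr rfl fun w _ => ?_
  by_cases hw : (w : E3) ∈ L
  · simp only [hw, not_true_eq_false, if_true, if_false, zero_sub]
    rw [o.edgeTurning_swap]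
  · simp only [hw, not_false_eq_true, if_true, if_false, sub_zero]

end ThreeCritical

end SimplicialSurface

/-! ### Generic directions and crossings with meridians -/

open Filter Topology

/-- Linear functionals that vanish at none of finitely many given nonzero vectors are dense. -/
theorem frequently_inner_ne_zero {s : Set E3} (hs : s.Finite) (h : ∀ d ∈ s, d ≠ 0) (x : E3) :
    ∃ᶠ μ in 𝓝 x, ∀ d ∈ s, inner ℝ μ d ≠ 0 := by
  have hc : ∀ d : E3, Continuous fun μ : E3 => (inner ℝ μ d : ℝ) := fun d => by fun_prop
  have hd : Dense (⋂ d ∈ s, {μ : E3 | inner ℝ μ d ≠ 0}) := by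
    refine dense_biInter_of_isOpen (fun d _ => isOpen_ne.preimage (hc d)) hs.countable ?_
    intro d hd
    have : {μ : E3 | inner ℝ μ d ≠ 0} = ((innerSL ℝ d : E3 →L[ℝ] ℝ).ker : Set E3)ᶜ := by
      ext μ
      simp [real_inner_comm]
    rw [this, ← interior_eq_empty_iff_dense_compl]
    by_contra hne
    have htop := Submodule.eq_top_of_nonempty_interior' _ (Set.nonempty_iff_ne_empty.2 hne)
    have : d ∈ (innerSL ℝ d : E3 →L[ℝ] ℝ).ker := by rw [htop]; trivial
    have h0 : inner ℝ d d = (0 : ℝ) := by simpa using this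
    exact h d hd (inner_self_eq_zero.1 h0)
  have := mem_closure_iff_frequently.1 (hd x)
  simpa using this

theorem norm_inv_norm_smul {x : E3} (hx : x ≠ 0) : ‖‖x‖⁻¹ • x‖ = 1 := by
  rw [norm_smul, norm_inv, norm_norm, inv_mul_cancel₀ (norm_ne_zero_iff.2 hx)]

theorem continuous_cross {α : Type*} [TopologicalSpace α] {f g : α → E3} (hf : Continuous f)
    (hg : Continuous g) : Continuous fun x => cross (f x) (g x) := by
  have hf' : ∀ i, Continuous fun x => f x i := fun i => by fun_prop
  have hg' : ∀ i, Continuous fun x => g x i := fun i => by fun_prop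
  refine (PiLp.continuous_toLp 2 _).comp (continuous_pi fun i => ?_)
  fin_cases i
  all_goals
    simp [crossProduct]
    fun_prop

/-- The coordinates of the vector `n × ξ` with respect to `μ` and `μ × ξ`. -/
def normalCoord (ξ μ : E3) (n : E3) : ℝ × ℝ := planeCoord ξ μ (cross n ξ)

theorem normalCoord_smul (ξ μ : E3) (r : ℝ) (n : E3) :
    normalCoord ξ μ (r • n) = r • normalCoord ξ μ n := by
  rw [normalCoord, normalCoord, ← map_smul]
  congr 1
  apply ext_three <;> simp <;> ring

theorem continuous_normalCoord (n : E3) :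
    Continuous fun x : E3 × E3 => normalCoord x.1 x.2 n := by
  have h : Continuous fun x : E3 × E3 => cross n x.1 := continuous_cross continuous_const continuous_fst
  have h' : Continuous fun x : E3 × E3 => cross x.2 x.1 := continuous_cross continuous_snd continuous_fst
  simp only [normalCoord, planeCoord_apply]
  exact (continuous_snd.inner h).prodMk (h'.inner h)

section Frame

variable {ξ u : E3}

theorem normalCoord_snd (hξ : ‖ξ‖ = 1) (hξu : inner ℝ ξ u = 0) (n : E3) :
    (normalCoord ξ u n).2 = inner ℝ u n := by
  have h1 : inner ℝ ξ ξ = (1 : ℝ) := by rw [real_inner_self_eq_norm_sq, hξ]; norm_num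
  have : (normalCoord ξ u n).2 = inner ℝ ξ ξ * inner ℝ u n - inner ℝ ξ u * inner ℝ ξ n := by
    simp only [normalCoord, planeCoord_apply, inner_eq]; simp; ring
  rw [this, h1, hξu]; ring

/-- This identifies the determinant in `rayCrossing` with the number whose sign counts a crossing of
the Gauss image. -/
theorem normalCoord_det (hξ : ‖ξ‖ = 1) (hu : ‖u‖ = 1) (hξu : inner ℝ ξ u = 0) (n n' : E3) :
    (normalCoord ξ u n).2 * (normalCoord ξ u n').1 - (normalCoord ξ u n').2 * (normalCoord ξ u n).1 =
      inner ℝ (cross n n') ξ := by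
  have h1 : inner ℝ ξ ξ = (1 : ℝ) := by rw [real_inner_self_eq_norm_sq, hξ]; norm_num
  have h2 : inner ℝ u u = (1 : ℝ) := by rw [real_inner_self_eq_norm_sq, hu]; norm_num
  rw [normalCoord_snd hξ hξu, normalCoord_snd hξ hξu]
  have : inner ℝ u n * (normalCoord ξ u n').1 - inner ℝ u n' * (normalCoord ξ u n).1 =
      inner ℝ u u * inner ℝ (cross n n') ξ - inner ℝ ξ u * inner ℝ (cross n n') u := by
    simp only [normalCoord, planeCoord_apply, inner_eq]; simp; ring
  rw [this, h2, hξu]; ring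

theorem eq_of_normalCoord_fst_eq_zero (hξ : ‖ξ‖ = 1) (hu : ‖u‖ = 1) (hξu : inner ℝ ξ u = 0) {n : E3}
    (h : (normalCoord ξ u n).1 = 0) : n = (inner ℝ ξ n) • ξ + (inner ℝ u n) • u := by
  have h1 : inner ℝ ξ ξ = (1 : ℝ) := by rw [real_inner_self_eq_norm_sq, hξ]; norm_num
  have h2 : inner ℝ u u = (1 : ℝ) := by rw [real_inner_self_eq_norm_sq, hu]; norm_num
  have h3 : inner ℝ u ξ = (0 : ℝ) := by rw [real_inner_comm, hξu]
  have hc : cross ξ u ≠ 0 := by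
    intro h0
    have := lagrange_identity ξ u
    rw [h0, h1, h2, hξu] at this
    simp at this
  have hd : inner ℝ (cross ξ u) (n - ((inner ℝ ξ n) • ξ + (inner ℝ u n) • u)) = (0 : ℝ) := by
    rw [inner_sub_right, inner_add_right, inner_smul_right, inner_smul_right, inner_cross_left_self,
      inner_cross_right_self]
    have : (inner ℝ (cross ξ u) n : ℝ) = (normalCoord ξ u n).1 := by
      simp only [normalCoord, planeCoord_apply, inner_eq]; simp; ring
    rw [this, h]; simp
  have := eq_zero_of_cross_eq_zero_of_inner_eq_zero hc (by
    rw [cross_cross_left]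
    simp only [inner_sub_right, inner_add_right, inner_smul_right, h1, h2, hξu, h3]
    simp) hd
  exact sub_eq_zero.1 this

theorem normalCoord_add_smul (a b : ℝ) (n n' : E3) : normalCoord ξ u (a • n + b • n') =
    a • normalCoord ξ u n + b • normalCoord ξ u n' := by
  rw [normalCoord, normalCoord, normalCoord, ← map_smul, ← map_smul, ← map_add]
  congr 1
  apply ext_three <;> simp <;> ring

theorem mem_meridian (hξ : ‖ξ‖ = 1) (hu : ‖u‖ = 1) (hξu : inner ℝ ξ u = 0) {n : E3} :
    n ∈ meridian ξ u ↔ ‖n‖ = 1 ∧ (normalCoord ξ u n).1 = 0 ∧ 0 ≤ (normalCoord ξ u n).2 := by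
  have h2 : inner ℝ u u = (1 : ℝ) := by rw [real_inner_self_eq_norm_sq, hu]; norm_num
  have h3 : inner ℝ u ξ = (0 : ℝ) := by rw [real_inner_comm, hξu]
  constructor
  · rintro ⟨hn, a, b, hb, rfl⟩
    refine ⟨hn, ?_, ?_⟩
    · simp only [normalCoord, planeCoord_apply, inner_eq]; simp; ring
    · rw [normalCoord_snd hξ hξu, inner_add_right, inner_smul_right, inner_smul_right, h2, h3]
      simpa using hb
  · rintro ⟨hn, h0, hp⟩
    rw [normalCoord_snd hξ hξu] at hp
    exact ⟨hn, _, _, hp, eq_of_normalCoord_fst_eq_zero hξ hu hξu h0⟩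

/-- The crossing of a great circle arc with a meridian, in terms of coordinates. -/
theorem crossingSign_eq_rayCrossing (hξ : ‖ξ‖ = 1) (hu : ‖u‖ = 1) (hξu : inner ℝ ξ u = 0) {p q : E3}
    (hd : inner ℝ (cross p q) ξ ≠ 0) (hp : (normalCoord ξ u p).1 = 0 → (normalCoord ξ u p).2 < 0)
    (hq : (normalCoord ξ u q).1 = 0 → (normalCoord ξ u q).2 < 0) :
    crossingSign p q ξ u = rayCrossing (normalCoord ξ u p) (normalCoord ξ u q) := by
  rw [← normalCoord_det hξ hu hξu p q] at hd
  -- In coordinates, the arc meets the meridian iff some nontrivial nonnegative combination lies on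
  -- the closed ray. Normalizing it requires a nonzero vector, which `hd` guarantees.
  have hiff : (shortArc p q ∩ meridian ξ u).Nonempty ↔ ∃ a b : ℝ, 0 ≤ a ∧ 0 ≤ b ∧
      (a ≠ 0 ∨ b ≠ 0) ∧ a * (normalCoord ξ u p).1 + b * (normalCoord ξ u q).1 = 0 ∧
      0 ≤ a * (normalCoord ξ u p).2 + b * (normalCoord ξ u q).2 := by
    constructor
    · rintro ⟨x, ⟨hx, a, b, ha, hb, rfl⟩, hm⟩
      rw [mem_meridian hξ hu hξu, normalCoord_add_smul] at hm
      refine ⟨a, b, ha, hb, ?_, by simpa using hm.2.1, by simpa using hm.2.2⟩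
      by_contra hcon
      push Not at hcon
      rw [hcon.1, hcon.2] at hx
      simp at hx
    · rintro ⟨a, b, ha, hb, hab, h0, h1⟩
      have hne : a • p + b • q ≠ 0 := by
        intro h
        have := normalCoord_add_smul (ξ := ξ) (u := u) a b p q
        rw [h] at this
        have z : normalCoord ξ u 0 = 0 := by simpa using normalCoord_smul ξ u 0 0
        rw [z] at this
        have e1 : a * (normalCoord ξ u p).1 + b * (normalCoord ξ u q).1 = 0 := by
          simpa using (congrArg Prod.fst this).symm
        have e2 : a * (normalCoord ξ u p).2 + b * (normalCoord ξ u q).2 = 0 := by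
          simpa using (congrArg Prod.snd this).symm
        rcases hab with h | h
        · refine hd (mul_left_cancel₀ h ?_)
          linear_combination e2 * (normalCoord ξ u q).1 - e1 * (normalCoord ξ u q).2
        · refine hd (mul_left_cancel₀ h ?_)
          linear_combination e1 * (normalCoord ξ u p).2 - e2 * (normalCoord ξ u p).1
      have hpos : 0 < ‖a • p + b • q‖⁻¹ := inv_pos.2 (norm_pos_iff.2 hne)
      have hn : ‖‖a • p + b • q‖⁻¹ • (a • p + b • q)‖ = 1 := norm_inv_norm_smul hne
      refine ⟨‖a • p + b • q‖⁻¹ • (a • p + b • q), ⟨hn, ‖a • p + b • q‖⁻¹ * a,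
        ‖a • p + b • q‖⁻¹ * b, by positivity, by positivity, by rw [smul_add, smul_smul, smul_smul]⟩, ?_⟩
      rw [mem_meridian hξ hu hξu, normalCoord_smul, normalCoord_add_smul]
      refine ⟨hn, ?_, ?_⟩
      · simp [← mul_add, h0]
      · simpa [mul_add] using mul_nonneg hpos.le h1
  rw [crossingSign, ← normalCoord_det hξ hu hξu p q, hiff]
  generalize normalCoord ξ u p = z at *
  generalize normalCoord ξ u q = z' at *
  clear hiff
  obtain ⟨t, p⟩ := z
  obtain ⟨t', p'⟩ := z'
  simp only [rayCrossing] at *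
  -- Only plane geometry is left. Neither end lies on the closed ray, so both weights of a crossing
  -- point are positive, and the determinant gives the direction of the crossing.
  by_cases hex : ∃ a b : ℝ, 0 ≤ a ∧ 0 ≤ b ∧ (a ≠ 0 ∨ b ≠ 0) ∧ a * t + b * t' = 0 ∧ 0 ≤ a * p + b * p'
  · rw [if_pos hex]
    obtain ⟨a, b, ha, hb, hab, h0, h1⟩ := hex
    have ht : t ≠ 0 := by
      rintro rfl
      have ht' : t' ≠ 0 := by rintro rfl; simp at hd
      have hb0 : b = 0 := by simpa [ht'] using h0
      subst hb0
      have ha' : 0 < a := lt_of_le_of_ne ha (Ne.symm (by simpa using hab))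
      nlinarith [hp rfl]
    have ht' : t' ≠ 0 := by
      rintro rfl
      have ha0 : a = 0 := by simpa [ht] using h0
      subst ha0
      have hb' : 0 < b := lt_of_le_of_ne hb (Ne.symm (by simpa using hab))
      nlinarith [hq rfl]
    have ha' : 0 < a := by
      refine lt_of_le_of_ne ha fun h => ?_
      subst h
      have : b = 0 := by simpa [ht'] using h0
      simp [this] at hab
    have hb' : 0 < b := by
      refine lt_of_le_of_ne hb fun h => ?_
      subst h
      have : a = 0 := by simpa [ht] using h0
      simp [this] at hab
    have key : a * (p * t' - p' * t) = (a * p + b * p') * t' := by linear_combination p' * (-h0)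
    rcases lt_or_gt_of_ne ht' with h | h
    · have htp : 0 < t := by nlinarith
      have hD : p * t' - p' * t < 0 := by
        refine lt_of_le_of_ne ?_ hd
        have : a * (p * t' - p' * t) ≤ 0 := key ▸ mul_nonpos_of_nonneg_of_nonpos h1 h.le
        exact nonpos_of_mul_nonpos_right this ha'
      rw [sign_neg hD, if_neg (by rintro ⟨h, -⟩; linarith), if_pos ⟨h.le, htp, by linarith⟩]
      simp
    · have htn : t < 0 := by nlinarith
      have hD : 0 < p * t' - p' * t := by
        refine lt_of_le_of_ne ?_ hd.symm
        have : 0 ≤ a * (p * t' - p' * t) := key ▸ mul_nonneg h1 h.le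
        exact nonneg_of_mul_nonneg_right this ha'
      rw [sign_pos hD, if_pos ⟨htn.le, h, hD⟩, if_neg (by rintro ⟨h, -⟩; linarith)]
      simp
  · rw [if_neg hex, if_neg, if_neg, sub_zero]
    · rintro ⟨h1, h2, h3⟩
      refine hex ⟨-t', t, by linarith, h2.le, Or.inr h2.ne', by ring, by nlinarith⟩
    · rintro ⟨h1, h2, h3⟩
      refine hex ⟨t', -t, h2.le, by linarith, Or.inl h2.ne', by ring, by nlinarith⟩

end Frame

/-! ### The normal degree as a sum of edge turnings; perturbation of the direction -/

namespace SimplicialSurface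

variable {P : SimplicialSurface}

/-- A slice direction is the product of the normal with `ξ`, so the turning at an edge is the planar
image of an edge of the Gauss image. -/
theorem Orientation.edgeTurning_eq (o : P.Orientation) (ξ μ : E3) {v a w b : E3} (h : o.pos v a w)
    (h' : o.pos v w b) : o.edgeTurning ξ μ (v, w) =
      rayCrossing (normalCoord ξ μ (cross (a - v) (w - v))) (normalCoord ξ μ (cross (w - v) (b - v))) := by
  rw [edgeTurning, o.sliceDir_of_pos ξ h']
  simp only
  rw [o.sliceDir_rotate ξ (o.rotate _ _ _ h), o.sliceDir_rotate ξ h, o.sliceDir_of_pos ξ h]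
  rfl

/-- The product of adjacent normals is a nonzero multiple of the common edge, and no edge is
horizontal. -/
theorem Orientation.inner_cross_cross_ne_zero (o : P.Orientation) {ξ : E3} (hg : P.IsGeneral ξ)
    {v a w b : E3} (h : o.pos v a w) (h' : o.pos v w b) :
    inner ℝ (cross (cross (a - v) (w - v)) (cross (w - v) (b - v))) ξ ≠ 0 := by
  rw [cross_cross_cross, inner_smul_left]
  refine mul_ne_zero ?_ ?_
  · simp only [conj_trivial]
    have h1 := o.inner_cross_ne_zero h' (o.rotate' h)
    rwa [inner_cross_rotate]
  · rw [real_inner_comm, inner_sub_right, sub_ne_zero]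
    exact (hg.ne (o.adj h')).symm

/-- A normal parallel to `ξ` would make the edges of the triangle horizontal. -/
theorem Orientation.cross_cross_ne_zero (o : P.Orientation) {ξ : E3} (hg : P.IsGeneral ξ)
    {v a b : E3} (h : o.pos v a b) : cross (cross (a - v) (b - v)) ξ ≠ 0 := by
  intro h0
  have h1 : cross (a - v) (cross (cross (a - v) (b - v)) ξ) =
      (inner ℝ ξ (a - v)) • cross (a - v) (b - v) := by
    simp only [inner_eq]
    apply ext_three <;> simp <;> ring
  rw [h0] at h1
  have h2 : cross (a - v) 0 = 0 := by apply ext_three <;> simp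
  rw [h2] at h1
  rcases smul_eq_zero.1 h1.symm with h3 | h3
  · rw [inner_sub_right, sub_eq_zero] at h3
    exact (hg.ne (o.adj h)).symm h3
  · exact o.cross_ne_zero h h3

theorem Orientation.unitNormal_mem_meridian (o : P.Orientation) {ξ u v a b : E3} (hξ : ‖ξ‖ = 1)
    (hu : ‖u‖ = 1) (hξu : inner ℝ ξ u = 0) (h : o.pos v a b) :
    unitNormal v a b ∈ meridian ξ u ↔ (normalCoord ξ u (cross (a - v) (b - v))).1 = 0 ∧
      0 ≤ (normalCoord ξ u (cross (a - v) (b - v))).2 := by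
  have hne := o.cross_ne_zero h
  have hpos : 0 < ‖cross (a - v) (b - v)‖⁻¹ := inv_pos.2 (norm_pos_iff.2 hne)
  rw [mem_meridian hξ hu hξu, unitNormal, normalCoord_smul]
  rw [and_iff_right (norm_inv_norm_smul hne)]
  simp [hne]

/-- A generic vector, projected to the plane orthogonal to `ξ` and normalized, gives a meridian
whose whole great circle contains no normal of the star. -/
theorem Orientation.exists_isAdmissible (o : P.Orientation) {ξ v : E3} (hξ : ‖ξ‖ = 1)
    (hg : P.IsGeneral ξ) (hv : v ∈ P.verts) : ∃ u, o.IsAdmissible v ξ u := by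
  have hfin : (Set.range fun w : P.link v =>
      cross (cross ((w : E3) - v) ((o.rot v w : E3) - v)) ξ).Finite := Set.finite_range _
  obtain ⟨μ, hμ⟩ := (frequently_inner_ne_zero hfin (by
    rintro - ⟨w, rfl⟩
    exact o.cross_cross_ne_zero hg (o.pos_rot v w)) 0).exists
  have h1 : inner ℝ ξ ξ = (1 : ℝ) := by rw [real_inner_self_eq_norm_sq, hξ]; norm_num
  have key : ∀ a b, o.pos v a b →
      inner ℝ (μ - (inner ℝ ξ μ) • ξ) (cross (cross (a - v) (b - v)) ξ) ≠ 0 := by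
    intro a b h
    rw [inner_sub_left, inner_smul_left, real_inner_comm (cross _ ξ) ξ, inner_cross_right_self,
      mul_zero, sub_zero]
    have := hμ _ ⟨⟨a, mem_link.2 (o.adj h)⟩, rfl⟩
    simpa only [o.rot_eq h] using this
  set ν := μ - (inner ℝ ξ μ) • ξ with hν
  have hν0 : ν ≠ 0 := by
    obtain ⟨a, ha⟩ := link_nonempty hv
    obtain ⟨b, hb⟩ := o.exists_pos ha
    intro h0
    have := key a b hb
    rw [h0, inner_zero_left] at this
    exact this rfl
  have hu : ‖‖ν‖⁻¹ • ν‖ = 1 := norm_inv_norm_smul hν0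
  have hξu : inner ℝ ξ (‖ν‖⁻¹ • ν) = 0 := by
    rw [inner_smul_right, hν, inner_sub_right, inner_smul_right, h1]; simp
  refine ⟨‖ν‖⁻¹ • ν, hu, hξu, fun a b h hm => ?_⟩
  have h0 := ((o.unitNormal_mem_meridian hξ hu hξu h).1 hm).1
  rw [normalCoord, planeCoord_apply] at h0
  simp only [inner_smul_left] at h0
  simp [hν0, key a b h] at h0

/-- The middle neighbour `w` determines its predecessor and its successor, so the triple sum has one
term for each `w`. -/
theorem Orientation.degreeAlong_eq_sum (o : P.Orientation) (v ξ u : E3) : o.degreeAlong v ξ u =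
    ∑ w : P.link v, crossingSign (unitNormal v (o.opp w v) w) (unitNormal v w (o.opp v w)) ξ u := by
  rw [Finset.sum_coe_sort (P.link v) (fun w => crossingSign (unitNormal v (o.opp w v) w)
    (unitNormal v w (o.opp v w)) ξ u), degreeAlong, Finset.sum_comm, link, Finset.sum_filter]
  refine Finset.sum_congr rfl fun w _ => ?_
  split_ifs with h
  · have h1 := o.rotate _ _ _ (o.pos_opp h.symm)
    have h2 := o.pos_opp h
    rw [Finset.sum_eq_single (o.opp w v), Finset.sum_eq_single (o.opp v w), if_pos ⟨h1, h2⟩]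
    · intro b _ hb
      rw [if_neg]
      rintro ⟨-, hb'⟩
      exact hb (o.opp_eq hb').symm
    · exact fun hn => absurd (o.adj₂ h2).mem_right hn
    · intro a _ ha
      refine Finset.sum_eq_zero fun b _ => ?_
      rw [if_neg]
      rintro ⟨ha', -⟩
      exact ha (o.opp_eq₃ ha').symm
    · exact fun hn => absurd (o.adj h1).mem_right hn
  · refine Finset.sum_eq_zero fun a _ => Finset.sum_eq_zero fun b _ => ?_
    rw [if_neg]
    rintro ⟨-, h'⟩
    exact h (o.adj h')

theorem Orientation.degreeAlong_eq_sum_edgeTurning (o : P.Orientation) {v ξ u : E3} (hξ : ‖ξ‖ = 1)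
    (hg : P.IsGeneral ξ) (ha : o.IsAdmissible v ξ u) :
    o.degreeAlong v ξ u = ∑ w : P.link v, o.edgeTurning ξ u (v, w) := by
  rw [o.degreeAlong_eq_sum]
  refine Finset.sum_congr rfl fun w _ => ?_
  obtain ⟨hu, hξu, ha⟩ := ha
  have hw := mem_link.1 w.2
  have h1 := o.rotate _ _ _ (o.pos_opp hw.symm)
  have h2 := o.pos_opp hw
  rw [o.edgeTurning_eq ξ u h1 h2]
  have hr : ∀ {a b : E3}, o.pos v a b → 0 < ‖cross (a - v) (b - v)‖⁻¹ := fun h =>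
    inv_pos.2 (norm_pos_iff.2 (o.cross_ne_zero h))
  have hadm : ∀ {a b : E3}, o.pos v a b → (normalCoord ξ u (unitNormal v a b)).1 = 0 →
      (normalCoord ξ u (unitNormal v a b)).2 < 0 := by
    intro a b h h0
    have hm := ha a b h
    rw [mem_meridian hξ hu hξu] at hm
    exact not_le.1 fun h' => hm ⟨norm_inv_norm_smul (o.cross_ne_zero h), h0, h'⟩
  rw [crossingSign_eq_rayCrossing hξ hu hξu ?_ (hadm h1) (hadm h2), unitNormal, unitNormal,
    normalCoord_smul, normalCoord_smul, rayCrossing_smul (hr h1) (hr h2)]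
  have e : cross (unitNormal v (o.opp w v) w) (unitNormal v w (o.opp v w)) =
      (‖cross (o.opp w v - v) (w - v)‖⁻¹ * ‖cross ((w : E3) - v) (o.opp v w - v)‖⁻¹) •
        cross (cross (o.opp w v - v) (w - v)) (cross (w - v) (o.opp v w - v)) := by
    rw [unitNormal, unitNormal]
    apply ext_three <;> simp only [cross_zero, cross_one, cross_two, PiLp.smul_apply, smul_eq_mul] <;> ring
  rw [e, inner_smul_left]
  exact mul_ne_zero (mul_pos (hr h1) (hr h2)).ne' (o.inner_cross_cross_ne_zero hg h1 h2)

/-- The turning at the edges of a star is locally constant in the axis and the ray. -/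
theorem Orientation.eventually_edgeTurning_eq (o : P.Orientation) {v ξ u : E3} (hξ : ‖ξ‖ = 1)
    (hg : P.IsGeneral ξ) (ha : o.IsAdmissible v ξ u) :
    ∀ᶠ x : E3 × E3 in 𝓝 (ξ, u), ∀ w : P.link v,
      o.edgeTurning x.1 x.2 (v, w) = o.edgeTurning ξ u (v, w) := by
  rw [eventually_all]
  intro w
  obtain ⟨hu, hξu, ha⟩ := ha
  have hw := mem_link.1 w.2
  have h1 := o.rotate _ _ _ (o.pos_opp hw.symm)
  have h2 := o.pos_opp hw
  simp only [o.edgeTurning_eq _ _ h1 h2]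
  have hadm : ∀ {a b : E3}, o.pos v a b → (normalCoord ξ u (cross (a - v) (b - v))).1 = 0 →
      (normalCoord ξ u (cross (a - v) (b - v))).2 < 0 := by
    intro a b h h0
    exact not_le.1 fun h' => ha a b h ((o.unitNormal_mem_meridian hξ hu hξu h).2 ⟨h0, h'⟩)
  refine eventually_rayCrossing_eq ((continuous_normalCoord _).tendsto (ξ, u))
    ((continuous_normalCoord _).tendsto (ξ, u)) (hadm h1) (hadm h2) fun _ => ?_
  rw [normalCoord_det hξ hu hξu]
  exact o.inner_cross_cross_ne_zero hg h1 h2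

/-- Near a general direction, the comparison of heights along edges does not change. -/
theorem eventually_inner_lt_iff {ξ : E3} (hg : P.IsGeneral ξ) :
    ∀ᶠ ξ' in 𝓝 ξ, ∀ a b, P.Adj a b → (inner ℝ ξ' a < inner ℝ ξ' b ↔ inner ℝ ξ a < inner ℝ ξ b) := by
  have h : ∀ x ∈ P.verts ×ˢ P.verts, ∀ᶠ ξ' in 𝓝 ξ, P.Adj x.1 x.2 →
      (inner ℝ ξ' x.1 < inner ℝ ξ' x.2 ↔ inner ℝ ξ x.1 < inner ℝ ξ x.2) := by
    rintro ⟨a, b⟩ -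
    by_cases hab : P.Adj a b
    · have hc : ∀ d : E3, ContinuousAt (fun ξ' : E3 => (inner ℝ ξ' d : ℝ)) ξ := fun d => by fun_prop
      rcases lt_or_gt_of_ne (hg.ne hab) with hlt | hlt
      · filter_upwards [(hc a).eventually_lt (hc b) hlt] with ξ' h' _
        exact iff_of_true h' hlt
      · filter_upwards [(hc b).eventually_lt (hc a) hlt] with ξ' h' _
        exact iff_of_false (lt_asymm h') (lt_asymm hlt)
    · exact Eventually.of_forall fun _ h => absurd h hab
  filter_upwards [(Finset.eventually_all _).2 h] with ξ' h' a b hab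
  exact h' (a, b) (Finset.mem_product.2 ⟨hab.mem_left, hab.mem_right⟩) hab

theorem IsGeneral.of_inner_lt_iff {ξ ξ' : E3} (hg : P.IsGeneral ξ)
    (h : ∀ a b, P.Adj a b → (inner ℝ ξ' a < inner ℝ ξ' b ↔ inner ℝ ξ a < inner ℝ ξ b)) :
    P.IsGeneral ξ' := by
  intro e he v hv w hw hvw heq
  have hadj := adj_of_mem (mem_simplices.1 he).1 hv hw hvw
  have h1 := (h _ _ hadj).not.1 (by rw [heq]; exact lt_irrefl _)
  have h2 := (h _ _ hadj.symm).not.1 (by rw [heq]; exact lt_irrefl _)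
  exact hg.ne hadj (le_antisymm (not_lt.1 h2) (not_lt.1 h1))

theorem Orientation.index_congr (o : P.Orientation) {ξ ξ' : E3} (hg : P.IsGeneral ξ)
    (h : ∀ a b, P.Adj a b → (inner ℝ ξ' a < inner ℝ ξ' b ↔ inner ℝ ξ a < inner ℝ ξ b)) (v : E3) :
    P.index v ξ' = P.index v ξ := by
  rw [o.index_eq hg, o.index_eq (hg.of_inner_lt_iff h)]
  congr 3
  refine Finset.filter_congr fun a _ => ?_
  rw [h _ _ (mem_link.1 a.2).symm, h _ _ (mem_link.1 (o.rot v a).2)]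

section Critical

variable {ξ vmax vmin v₀ : E3}

/-- A height function with three critical points can be perturbed so that the heights of the
vertices become distinct, while the third critical point stays the same. -/
theorem frequently_threeCritical (o : P.Orientation) (hg : P.IsGeneral ξ)
    (hcrit : (P.criticalPoints ξ).ncard = 3) (hmax : vmax ∈ P.verts) (hmin : vmin ∈ P.verts)
    (h₀ : v₀ ∈ P.criticalPoints ξ) (hle : ∀ x ∈ P.verts, inner ℝ ξ x ≤ inner ℝ ξ vmax)
    (hge : ∀ x ∈ P.verts, inner ℝ ξ vmin ≤ inner ℝ ξ x) (h0max : v₀ ≠ vmax) (h0min : v₀ ≠ vmin)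
    {T : Set E3} (hT : T.Finite) (hT0 : ∀ d ∈ T, d ≠ 0) :
    ∃ᶠ ξ' in 𝓝 ξ, (∃ top bot, P.ThreeCritical ξ' top bot v₀) ∧ P.index v₀ ξ' = P.index v₀ ξ ∧
      ∀ d ∈ T, inner ℝ ξ' d ≠ 0 := by
  -- Directions near `ξ` that avoid the orthogonal planes of these differences separate all
  -- vertices; being near, they keep the order of heights along edges and so all indices.
  set S : Set E3 := {d | ∃ x ∈ P.verts ×ˢ P.verts, x.1 ≠ x.2 ∧ d = x.1 - x.2} with hS
  have hSf : S.Finite := by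
    refine ((P.verts ×ˢ P.verts).finite_toSet.image fun x => x.1 - x.2).subset ?_
    rintro d ⟨x, hx, -, rfl⟩
    exact ⟨x, hx, rfl⟩
  refine ((frequently_inner_ne_zero (hSf.union hT) (by
    rintro d (⟨x, -, hx, rfl⟩ | hd)
    · exact sub_ne_zero.2 hx
    · exact hT0 d hd) ξ).and_eventually
      (eventually_inner_lt_iff hg)).mono ?_
  rintro ξ' ⟨hne, hlt⟩
  have hg' := hg.of_inner_lt_iff hlt
  have hi := o.index_congr hg hlt
  refine ⟨?_, hi v₀, fun d hd => hne d (Or.inr hd)⟩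
  have hinj : Set.InjOn (fun x : E3 => inner ℝ ξ' x) P.verts := by
    intro x hx y hy hxy
    by_contra hcon
    refine hne (x - y) (Or.inl ⟨(x, y), Finset.mem_product.2 ⟨hx, hy⟩, hcon, rfl⟩) ?_
    rw [inner_sub_right, sub_eq_zero]
    exact hxy
  have hv₀ : v₀ ∈ P.verts := (P.mem_verts _).2 h₀.1
  obtain ⟨top, htop, htop'⟩ := P.verts.exists_max_image (fun x => inner ℝ ξ' x) ⟨_, hmax⟩
  obtain ⟨bot, hbot, hbot'⟩ := P.verts.exists_min_image (fun x => inner ℝ ξ' x) ⟨_, hmax⟩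
  have itop : P.index top ξ' = 1 := o.index_eq_one_of_below hg' fun a ha =>
    lt_of_le_of_ne (htop' _ ha.mem_right) (hg'.ne ha).symm
  have ibot : P.index bot ξ' = 1 := o.index_eq_one_of_above hg' fun a ha =>
    lt_of_le_of_ne (hbot' _ ha.mem_right) (hg'.ne ha)
  have imax : P.index vmax ξ = 1 := o.index_eq_one_of_below hg fun a ha =>
    lt_of_le_of_ne (hle _ ha.mem_right) (hg.ne ha).symm
  have imin : P.index vmin ξ = 1 := o.index_eq_one_of_above hg fun a ha =>
    lt_of_le_of_ne (hge _ ha.mem_right) (hg.ne ha)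
  obtain ⟨a₀, ha₀⟩ := link_nonempty hmax
  have hmm : vmax ≠ vmin := by
    rintro rfl
    exact hg.ne ha₀ (le_antisymm (hge _ ha₀.mem_right) (hle _ ha₀.mem_right))
  have hbt : top ≠ bot := by
    rintro rfl
    exact hg'.ne ha₀ (le_antisymm ((htop' _ hmax).trans (hbot' _ ha₀.mem_right))
      ((htop' _ ha₀.mem_right).trans (hbot' _ hmax)))
  have hmem : ∀ {x}, x ∈ P.verts → P.index x ξ' ≠ 0 → x ∈ P.criticalPoints ξ := fun hx hx' =>
    ⟨(P.mem_verts _).1 hx, by rwa [← hi]⟩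
  have hfin : (P.criticalPoints ξ).Finite := Set.finite_of_ncard_ne_zero (by omega)
  have hC : P.criticalPoints ξ = {vmax, vmin, v₀} := by
    symm
    refine Set.eq_of_subset_of_ncard_le ?_ ?_ hfin
    · rintro x (rfl | rfl | rfl)
      · exact hmem hmax (by rw [hi, imax]; norm_num)
      · exact hmem hmin (by rw [hi, imin]; norm_num)
      · exact h₀
    · rw [hcrit, Set.ncard_eq_three.2 ⟨vmax, vmin, v₀, hmm, h0max.symm, h0min.symm, rfl⟩]
  -- the third critical point of the perturbed direction
  obtain ⟨m, hm, hmtop, hmbot⟩ : ∃ m ∈ P.criticalPoints ξ, m ≠ top ∧ m ≠ bot := by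
    by_contra hcon
    push Not at hcon
    have hsub : P.criticalPoints ξ ⊆ {top, bot} := by
      intro m hm
      by_cases h : m = top
      · exact Or.inl h
      · exact Or.inr (hcon m hm h)
    have := Set.ncard_le_ncard hsub
    rw [hcrit, Set.ncard_pair hbt] at this
    omega
  have hC' : P.criticalPoints ξ = {top, bot, m} := by
    symm
    refine Set.eq_of_subset_of_ncard_le ?_ ?_ hfin
    · rintro x (rfl | rfl | rfl)
      · exact hmem htop (by rw [itop]; norm_num)
      · exact hmem hbot (by rw [ibot]; norm_num)
      · exact hm
    · rw [hcrit, Set.ncard_eq_three.2 ⟨top, bot, m, hbt, hmtop.symm, hmbot.symm, rfl⟩]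
  have h3 : P.ThreeCritical ξ' top bot m :=
    { general := hg', inj := hinj, top_mem := htop, bot_mem := hbot, mid_mem := (P.mem_verts _).2 hm.1
      le_top := htop', bot_le := hbot', mid_ne_top := hmtop, mid_ne_bot := hmbot
      index_eq_zero := by
        intro x hx h1 h2 h3
        by_contra hcon
        have := hmem hx hcon
        rw [hC'] at this
        rcases this with h | h | h <;> contradiction
      index_ne_zero := by rw [hi]; exact hm.2 }
  have hm' := hm
  rw [hC] at hm'
  -- The perturbed extrema need not be `vmax` and `vmin`. But the third point has neighbours both
  -- above and below, which the old extrema have not.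
  rcases hm' with rfl | rfl | rfl
  · obtain ⟨u, hu, hu'⟩ := h3.exists_above o
    exact absurd (hle _ hu.mem_right) (not_le.2 ((hlt _ _ hu).1 hu'))
  · obtain ⟨u, hu, hu'⟩ := h3.exists_below o
    exact absurd (hge _ hu.mem_right) (not_le.2 ((hlt _ _ hu.symm).1 hu'))
  · exact ⟨top, bot, h3⟩

theorem index_le_of_ncard (o : P.Orientation) (hg : P.IsGeneral ξ)
    (hcrit : (P.criticalPoints ξ).ncard = 3) (hmax : vmax ∈ P.verts) (hmin : vmin ∈ P.verts)
    (h₀ : v₀ ∈ P.criticalPoints ξ) (hle : ∀ x ∈ P.verts, inner ℝ ξ x ≤ inner ℝ ξ vmax)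
    (hge : ∀ x ∈ P.verts, inner ℝ ξ vmin ≤ inner ℝ ξ x) (h0max : v₀ ≠ vmax) (h0min : v₀ ≠ vmin) :
    P.index v₀ ξ ≤ -1 := by
  obtain ⟨ξ', ⟨top, bot, h⟩, hi, -⟩ := (frequently_threeCritical o hg hcrit hmax hmin h₀ hle hge
    h0max h0min Set.finite_empty (by simp)).exists
  rw [← hi]
  exact h.index_le o

theorem hasNormalDegree_zero (o : P.Orientation) (hξ : ‖ξ‖ = 1) (hg : P.IsGeneral ξ)
    (hcrit : (P.criticalPoints ξ).ncard = 3) (hmax : vmax ∈ P.verts) (hmin : vmin ∈ P.verts)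
    (h₀ : v₀ ∈ P.criticalPoints ξ) (hle : ∀ x ∈ P.verts, inner ℝ ξ x ≤ inner ℝ ξ vmax)
    (hge : ∀ x ∈ P.verts, inner ℝ ξ vmin ≤ inner ℝ ξ x) (h0max : v₀ ≠ vmax) (h0min : v₀ ≠ vmin) :
    o.HasNormalDegree v₀ ξ 0 := by
  refine ⟨o.exists_isAdmissible hξ hg ((P.mem_verts _).2 h₀.1), fun u hu => ?_⟩
  rw [o.degreeAlong_eq_sum_edgeTurning hξ hg hu]
  have hcont : Continuous fun x : E3 × E3 => cross x.2 x.1 :=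
    continuous_cross continuous_snd continuous_fst
  have hne : cross u ξ ≠ 0 := by
    intro h0
    have h1 := eq_zero_of_cross_eq_zero_of_inner_eq_zero (x := u) (y := ξ)
      (by rintro rfl; simpa using hu.1) h0 (by rw [real_inner_comm]; exact hu.2.1)
    rw [h1] at hξ
    simp at hξ
  have hev := (o.eventually_edgeTurning_eq hξ hg hu).and (hcont.continuousAt.eventually_ne hne)
  -- The sum is locally constant in axis and ray together. First the axis is moved to separate the
  -- vertices; then, with that axis fixed, the ray is made generic for the slice.
  have hev' := hev.curry_nhds
  obtain ⟨ξ', ⟨⟨top, bot, h3⟩, -⟩, hξ'⟩ :=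
    ((frequently_threeCritical o hg hcrit hmax hmin h₀ hle hge h0max h0min Set.finite_empty
      (by simp)).and_eventually hev').exists
  set E : Set E3 := {d | ∃ x ∈ (P.verts ×ˢ P.verts) ×ˢ (P.verts ×ˢ P.verts), d ≠ 0 ∧
    d = slicePoint ξ' (inner ℝ ξ' v₀) x.1 - slicePoint ξ' (inner ℝ ξ' v₀) x.2} with hE
  have hEf : E.Finite := by
    refine (((P.verts ×ˢ P.verts) ×ˢ (P.verts ×ˢ P.verts)).finite_toSet.image fun x =>
      slicePoint ξ' (inner ℝ ξ' v₀) x.1 - slicePoint ξ' (inner ℝ ξ' v₀) x.2).subset ?_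
    rintro d ⟨x, hx, -, rfl⟩
    exact ⟨x, hx, rfl⟩
  obtain ⟨μ, hμ, hμ', hμc⟩ := ((frequently_inner_ne_zero hEf (by
    rintro d ⟨x, -, hx, rfl⟩; exact hx) u).and_eventually hξ').exists
  have hξ0 : ξ' ≠ 0 := by
    rintro rfl
    exact hμc (by apply ext_three <;> simp)
  have := h3.sum_edgeTurning_link o hξ0 hμc (by
    intro x y hx hy hxy
    exact hμ _ ⟨(x, y), by simp [hx.mem_left, hx.mem_right, hy.mem_left, hy.mem_right],
      sub_ne_zero.2 hxy, rfl⟩)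
  rw [← this]
  exact Finset.sum_congr rfl fun w _ => (hμ' w).symm

end Critical

end SimplicialSurface

/-! ### Rotation numbers in the complex plane -/

section Winding

open Complex ComplexConjugate

theorem exists_arg_div_eq {z z' : ℂ} (hz : z ≠ 0) (hz' : z' ≠ 0) :
    ∃ k : ℤ, arg (z' / z) = arg z' - arg z + 2 * Real.pi * k := by
  have h := arg_div_coe_angle hz' hz
  rw [← Real.Angle.coe_sub, Real.Angle.angle_eq_iff_two_pi_dvd_sub] at h
  obtain ⟨k, hk⟩ := h
  exact ⟨k, by linarith⟩

theorem div_im_eq (z z' : ℂ) : (z' / z).im = (z.re * z'.im - z'.re * z.im) / normSq z := by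
  rw [div_im]; ring

/-- The angle from `z` to `z'` in terms of an angle function with a cut along the positive real
axis. -/
theorem arg_div_eq_rayCrossing {z z' : ℂ} (h : (z' / z).im ≠ 0) :
    arg (z' / z) = arg (-z') - arg (-z) +
      2 * Real.pi * rayCrossing (z.im, z.re) (z'.im, z'.re) := by
  have hz : z ≠ 0 := by rintro rfl; simp at h
  have hz' : z' ≠ 0 := by rintro rfl; simp at h
  obtain ⟨k, hk⟩ := exists_arg_div_eq (neg_ne_zero.2 hz) (neg_ne_zero.2 hz')
  rw [neg_div_neg_eq] at hk
  rw [hk]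
  congr 2
  rw [Int.cast_inj]
  have hpi := Real.pi_pos
  have hn : 0 < normSq z := normSq_pos.2 hz
  have hlt : arg (z' / z) < Real.pi := lt_of_le_of_ne (arg_le_pi _) fun e =>
    h (arg_eq_pi_iff.1 e).2
  have hgt := neg_pi_lt_arg (z' / z)
  have b1 := neg_pi_lt_arg (-z)
  have b2 := neg_pi_lt_arg (-z')
  have b3 := arg_le_pi (-z)
  have b4 := arg_le_pi (-z')
  -- The sign of `arg (-z)` is read off from the half plane of `z`. Together with the bounds on the
  -- three arguments it leaves only one integer `k` in each case.
  have im1 : ∀ w : ℂ, w.im ≤ 0 → 0 ≤ arg (-w) := fun w hw => arg_nonneg_iff.2 (by simpa using hw)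
  have im2 : ∀ w : ℂ, 0 < w.im → arg (-w) < 0 := fun w hw => arg_neg_iff.2 (by simpa using hw)
  have hk1 : ∀ j : ℤ, (k : ℝ) < j → k + 1 ≤ j := fun j hj => by exact_mod_cast hj
  have hk2 : ∀ j : ℤ, (j : ℝ) < k → j + 1 ≤ k := fun j hj => by exact_mod_cast hj
  have u1 : (k : ℝ) < (2 : ℤ) := by push_cast; nlinarith
  have u2 : ((-2 : ℤ) : ℝ) < k := by push_cast; nlinarith
  have u1' := hk1 _ u1
  have u2' := hk2 _ u2
  rw [div_im_eq] at h
  have hdet : z.re * z'.im - z'.re * z.im ≠ 0 := fun e => h (by rw [e, zero_div])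
  have pos_iff : 0 < z.re * z'.im - z'.re * z.im ↔ 0 < arg (z' / z) := by
    have e1 : 0 < (z' / z).im ↔ 0 < z.re * z'.im - z'.re * z.im := by
      rw [div_im_eq, div_pos_iff_of_pos_right hn]
    rw [← e1]
    constructor
    · intro hp
      refine lt_of_le_of_ne (arg_nonneg_iff.2 hp.le) fun e => ?_
      have := (arg_eq_zero_iff.1 e.symm).2
      rw [this] at hp
      exact lt_irrefl _ hp
    · intro hp
      by_contra hcon
      rcases lt_or_eq_of_le (not_lt.1 hcon) with h' | h'
      · exact lt_asymm hp (arg_neg_iff.2 h')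
      · rw [div_im_eq] at h'
        exact h h'
  simp only [rayCrossing]
  by_cases h1 : z.im ≤ 0 <;> by_cases h2 : z'.im ≤ 0
  · have c1 := im1 _ h1
    have c2 := im1 _ h2
    rw [if_neg (by rintro ⟨-, h, -⟩; exact absurd h2 (not_le.2 h)),
      if_neg (by rintro ⟨-, h, -⟩; exact absurd h1 (not_le.2 h))]
    have v1 : (k : ℝ) < (1 : ℤ) := by push_cast; nlinarith
    have v2 : ((-1 : ℤ) : ℝ) < k := by push_cast; nlinarith
    have := hk1 _ v1
    have := hk2 _ v2
    omega
  · have c1 := im1 _ h1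
    have c2 := im2 _ (not_le.1 h2)
    rw [if_neg (c := z'.im ≤ 0 ∧ _) (by rintro ⟨h, -⟩; exact h2 h)]
    by_cases hd : 0 < z.re * z'.im - z'.re * z.im
    · rw [if_pos ⟨h1, not_le.1 h2, hd⟩]
      have := pos_iff.1 hd
      have v2 : ((0 : ℤ) : ℝ) < k := by push_cast; nlinarith
      have := hk2 _ v2
      omega
    · rw [if_neg (by rintro ⟨-, -, h⟩; exact hd h)]
      have := not_lt.1 (pos_iff.not.1 hd)
      have v1 : (k : ℝ) < (1 : ℤ) := by push_cast; nlinarith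
      have v2 : ((-1 : ℤ) : ℝ) < k := by push_cast; nlinarith
      have := hk1 _ v1
      have := hk2 _ v2
      omega
  · have c1 := im2 _ (not_le.1 h1)
    have c2 := im1 _ h2
    rw [if_neg (c := z.im ≤ 0 ∧ _) (by rintro ⟨h, -⟩; exact h1 h)]
    by_cases hd : 0 < z.re * z'.im - z'.re * z.im
    · rw [if_neg (by rintro ⟨-, -, h⟩; linarith)]
      have := pos_iff.1 hd
      have v1 : (k : ℝ) < (1 : ℤ) := by push_cast; nlinarith
      have v2 : ((-1 : ℤ) : ℝ) < k := by push_cast; nlinarith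
      have := hk1 _ v1
      have := hk2 _ v2
      omega
    · rw [if_pos ⟨h2, not_le.1 h1, by
        have := lt_of_le_of_ne (not_lt.1 hd) hdet
        linarith⟩]
      have := not_lt.1 (pos_iff.not.1 hd)
      have v1 : (k : ℝ) < (0 : ℤ) := by push_cast; nlinarith
      have := hk1 _ v1
      omega
  · have c1 := im2 _ (not_le.1 h1)
    have c2 := im2 _ (not_le.1 h2)
    rw [if_neg (by rintro ⟨h, -, -⟩; exact h1 h), if_neg (by rintro ⟨h, -, -⟩; exact h2 h)]
    have v1 : (k : ℝ) < (1 : ℤ) := by push_cast; nlinarith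
    have v2 : ((-1 : ℤ) : ℝ) < k := by push_cast; nlinarith
    have := hk1 _ v1
    have := hk2 _ v2
    omega

variable {ι : Type*} [Fintype ι]

theorem sum_arg_div_eq_rayCrossing (σ : Equiv.Perm ι) (Z : ι → ℂ)
    (h : ∀ j, (Z (σ j) / Z j).im ≠ 0) : ∑ j, arg (Z (σ j) / Z j) =
      2 * Real.pi * (∑ j, rayCrossing ((Z j).im, (Z j).re) ((Z (σ j)).im, (Z (σ j)).re) : ℤ) := by
  rw [Finset.sum_congr rfl fun j _ => arg_div_eq_rayCrossing (h j), Finset.sum_add_distrib,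
    Finset.sum_sub_distrib, Equiv.sum_comp σ (fun j => arg (-Z j)), sub_self, zero_add]
  push_cast
  rw [Finset.mul_sum]

/-- The angle from the imaginary axis line, between `-π/2` and `π/2`, on both half planes. -/
def halfArg (z : ℂ) : ℝ := if 0 < z.re then arg z else arg (-z)

theorem abs_halfArg_lt {z : ℂ} (h : z.re ≠ 0) : |halfArg z| < Real.pi / 2 := by
  rw [halfArg]
  split_ifs with h'
  · exact abs_arg_lt_pi_div_two_iff.2 (Or.inl h')
  · refine abs_arg_lt_pi_div_two_iff.2 (Or.inl ?_)
    have := lt_of_le_of_ne (not_lt.1 h') h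
    simpa using this

/-- Both half angles are less than π/2 in absolute value, so their difference is already in the
range of `arg`. -/
theorem arg_div_of_re_pos_iff {z z' : ℂ} (h : z.re ≠ 0) (h' : z'.re ≠ 0)
    (hs : 0 < z.re ↔ 0 < z'.re) : arg (z' / z) = halfArg z' - halfArg z := by
  have hz : z ≠ 0 := by rintro rfl; simp at h
  have hz' : z' ≠ 0 := by rintro rfl; simp at h'
  have hpi := Real.pi_pos
  have b := abs_lt.1 (abs_halfArg_lt h)
  have b' := abs_lt.1 (abs_halfArg_lt h')
  have hlt := arg_le_pi (z' / z)
  have hgt := neg_pi_lt_arg (z' / z)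
  obtain ⟨k, hk⟩ : ∃ k : ℤ, arg (z' / z) = halfArg z' - halfArg z + 2 * Real.pi * k := by
    by_cases hp : 0 < z.re
    · rw [halfArg, halfArg, if_pos hp, if_pos (hs.1 hp)]
      exact exists_arg_div_eq hz hz'
    · rw [halfArg, halfArg, if_neg hp, if_neg (hs.not.1 hp), ← neg_div_neg_eq]
      exact exists_arg_div_eq (neg_ne_zero.2 hz) (neg_ne_zero.2 hz')
  have v1 : (k : ℝ) < (1 : ℤ) := by push_cast; nlinarith
  have v2 : ((-1 : ℤ) : ℝ) < k := by push_cast; nlinarith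
  have h1 : k < 1 := by exact_mod_cast v1
  have h2 : -1 < k := by exact_mod_cast v2
  have : k = 0 := by omega
  rw [hk, this]; simp

/-- In opposite half planes the angle equals the difference of half angles up to an odd multiple of
π; a clockwise rotation singles out −π. -/
theorem arg_div_of_not_re_pos_iff {z z' : ℂ} (h : z.re ≠ 0) (h' : z'.re ≠ 0)
    (hs : ¬ (0 < z.re ↔ 0 < z'.re)) (him : (z' / z).im < 0) :
    arg (z' / z) = halfArg z' - halfArg z - Real.pi := by
  have hz : z ≠ 0 := by rintro rfl; simp at h
  have hz' : z' ≠ 0 := by rintro rfl; simp at h'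
  have hpi := Real.pi_pos
  have b := abs_lt.1 (abs_halfArg_lt h)
  have b' := abs_lt.1 (abs_halfArg_lt h')
  have hlt := arg_neg_iff.2 him
  have hgt := neg_pi_lt_arg (z' / z)
  obtain ⟨k, hk⟩ : ∃ k : ℤ, arg (z' / z) = halfArg z' - halfArg z - Real.pi + 2 * Real.pi * k := by
    have hc : ((arg (z' / z) : ℝ) : Real.Angle) = (halfArg z' - halfArg z - Real.pi : ℝ) := by
      rw [arg_div_coe_angle hz' hz, Real.Angle.coe_sub, Real.Angle.coe_sub]
      by_cases hp : 0 < z.re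
      · have hp' : ¬ 0 < z'.re := fun hp' => hs (iff_of_true hp hp')
        rw [halfArg, halfArg, if_pos hp, if_neg hp', arg_neg_coe_angle hz']
        abel
      · have hp' : 0 < z'.re := by
          by_contra hp'
          exact hs (iff_of_false hp hp')
        rw [halfArg, halfArg, if_neg hp, if_pos hp', arg_neg_coe_angle hz, sub_sub, add_assoc,
          Real.Angle.coe_pi_add_coe_pi, add_zero]
    rw [Real.Angle.angle_eq_iff_two_pi_dvd_sub] at hc
    obtain ⟨k, hk⟩ := hc
    exact ⟨k, by linarith⟩
  have v1 : (k : ℝ) < (1 : ℤ) := by push_cast; nlinarith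
  have v2 : ((-1 : ℤ) : ℝ) < k := by push_cast; nlinarith
  have h1 : k < 1 := by exact_mod_cast v1
  have h2 : -1 < k := by exact_mod_cast v2
  have : k = 0 := by omega
  rw [hk, this]; simp

/-- If `Y` rotates counterclockwise and `G` is such that the scalar products of `Y j` with `G j` and
with its predecessor have the same sign, then the difference of the total rotations counts the sign
changes. -/
theorem sum_arg_div_eq_sub (σ : Equiv.Perm ι) (G Y : ι → ℂ) (p : ι → Prop)
    (hY : ∀ j, 0 < (Y (σ j) / Y j).im)
    (h1 : ∀ j, (G j * conj (Y j)).re ≠ 0 ∧ (0 < (G j * conj (Y j)).re ↔ p j))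
    (h2 : ∀ j, (G j * conj (Y (σ j))).re ≠ 0 ∧ (0 < (G j * conj (Y (σ j))).re ↔ p (σ j))) :
    ∑ j, arg (G (σ j) / G j) = ∑ j, arg (Y (σ j) / Y j) -
      2 * Real.pi * (Finset.univ.filter fun j => p j ∧ ¬ p (σ j)).card := by
  have hY0 : ∀ j, Y j ≠ 0 := fun j h => by have := hY j; simp [h] at this
  have hG0 : ∀ j, G j ≠ 0 := fun j h => by have := (h1 j).1; simp [h] at this
  have hcY : ∀ j, conj (Y j) ≠ 0 := fun j => (map_ne_zero _).2 (hY0 j)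
  -- Both vectors are measured against `Y (σ j)`, with which their scalar products have the same
  -- sign.
  have s1 : ∀ j, arg (G (σ j) / G j) =
      halfArg (G (σ j) * conj (Y (σ j))) - halfArg (G j * conj (Y (σ j))) := by
    intro j
    rw [← arg_div_of_re_pos_iff (h2 j).1 (h1 (σ j)).1 ((h2 j).2.trans (h1 (σ j)).2.symm),
      mul_div_mul_right _ _ (hcY _)]
  -- With `G j` fixed, the product turns clockwise as `Y` turns counterclockwise, and every change
  -- of half plane costs π. Departures and entries are equally many, which gives 2π for each
  -- departure.
  have s2 : ∀ j, -arg (Y (σ j) / Y j) = halfArg (G j * conj (Y (σ j))) - halfArg (G j * conj (Y j)) -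
      Real.pi * ((if p j ∧ ¬ p (σ j) then 1 else 0) + (if ¬ p j ∧ p (σ j) then 1 else 0)) := by
    intro j
    have e : G j * conj (Y (σ j)) / (G j * conj (Y j)) = conj (Y (σ j) / Y j) := by
      rw [mul_div_mul_left _ _ (hG0 j), map_div₀]
    have e' : arg (conj (Y (σ j) / Y j)) = -arg (Y (σ j) / Y j) := by
      rw [arg_conj, if_neg]
      intro hpi
      have := (arg_eq_pi_iff.1 hpi).2
      exact (hY j).ne' this
    rw [← e', ← e]
    by_cases hp : p j ↔ p (σ j)
    · rw [arg_div_of_re_pos_iff (h1 j).1 (h2 j).1 (((h1 j).2.trans hp).trans (h2 j).2.symm),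
        if_neg (by tauto), if_neg (by tauto)]
      ring
    · rw [arg_div_of_not_re_pos_iff (h1 j).1 (h2 j).1
        (by rw [(h1 j).2, (h2 j).2]; exact hp) (by rw [e, conj_im]; linarith [hY j])]
      by_cases hpj : p j
      · rw [if_pos ⟨hpj, fun h => hp (iff_of_true hpj h)⟩, if_neg (by tauto)]
        ring
      · rw [if_neg (by tauto), if_pos ⟨hpj, by tauto⟩]
        ring
  have hcard := SimplicialSurface.card_leave_eq_card_enter σ p
  have s3 : ∑ j, (-arg (Y (σ j) / Y j)) = ∑ j, halfArg (G j * conj (Y (σ j))) -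
      ∑ j, halfArg (G j * conj (Y j)) -
        Real.pi * ((Finset.univ.filter fun j => p j ∧ ¬ p (σ j)).card +
          (Finset.univ.filter fun j => ¬ p j ∧ p (σ j)).card) := by
    rw [Finset.sum_congr rfl fun j _ => s2 j, Finset.sum_sub_distrib, Finset.sum_sub_distrib,
      ← Finset.mul_sum, Finset.sum_add_distrib, Finset.sum_boole, Finset.sum_boole]
  rw [Finset.sum_congr rfl fun j _ => s1 j, Finset.sum_sub_distrib,
    Equiv.sum_comp σ (fun j => halfArg (G j * conj (Y j)))]
  rw [Finset.sum_neg_distrib, ← hcard] at s3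
  linarith

end Winding

/-! ### Stars with a transverse plane -/

theorem mem_convexHull_triple {a b c : E3} {α β γ : ℝ} (hα : 0 ≤ α) (hβ : 0 ≤ β) (hγ : 0 ≤ γ)
    (h1 : α + β + γ = 1) {s : Set E3} (ha : a ∈ s) (hb : b ∈ s) (hc : c ∈ s) :
    α • a + β • b + γ • c ∈ convexHull ℝ s := by
  have h := (convex_convexHull ℝ s).sum_mem (t := Finset.univ) (w := ![α, β, γ]) (z := ![a, b, c])
    (by simp [Fin.forall_fin_succ, hα, hβ, hγ]) (by simp [Fin.sum_univ_three, h1])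
    (by simp [Fin.forall_fin_succ, subset_convexHull ℝ s ha, subset_convexHull ℝ s hb,
      subset_convexHull ℝ s hc])
  simpa [Fin.sum_univ_three] using h

theorem inner_cross_smul_eq (a b c y : E3) : (inner ℝ (cross a b) c) • y =
    (inner ℝ a y) • cross b c + (inner ℝ b y) • cross c a + (inner ℝ c y) • cross a b := by
  simp only [inner_eq]
  apply ext_three <;> simp <;> ring

/-- The linear relation between four vectors of space. -/
theorem inner_cross_smul_add_add (x y z n : E3) : (inner ℝ (cross y z) n) • x +
    (inner ℝ (cross z x) n) • y + (inner ℝ (cross x y) n) • z = (inner ℝ (cross x y) z) • n := by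
  simp only [inner_eq]
  apply ext_three <;> simp <;> ring

theorem inner_mul_inner_sub (a b c d : E3) :
    inner ℝ a c * inner ℝ b d - inner ℝ a d * inner ℝ b c = inner ℝ (cross a b) (cross c d) := by
  simp only [inner_eq]
  simp
  ring

theorem normalCoord_fst_eq (ξ μ n : E3) : (normalCoord ξ μ n).1 = inner ℝ (cross ξ μ) n := by
  simp only [normalCoord, planeCoord_apply, inner_eq]; simp; ring

theorem normalCoord_snd_eq (ξ μ n : E3) :
    (normalCoord ξ μ n).2 = inner ℝ (cross ξ (cross μ ξ)) n := by
  simp only [normalCoord, planeCoord_apply, inner_eq]; simp; ring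

theorem normalCoord_det_eq (ξ μ n n' : E3) :
    (normalCoord ξ μ n).2 * (normalCoord ξ μ n').1 - (normalCoord ξ μ n').2 * (normalCoord ξ μ n).1 =
      inner ℝ (cross μ ξ) (cross μ ξ) * inner ℝ ξ (cross n n') := by
  have e : cross (cross ξ (cross μ ξ)) (cross ξ μ) = (inner ℝ (cross μ ξ) (cross μ ξ)) • ξ := by
    simp only [inner_eq]
    apply ext_three <;> simp <;> ring
  rw [normalCoord_fst_eq, normalCoord_fst_eq, normalCoord_snd_eq, normalCoord_snd_eq,
    inner_mul_inner_sub, e, inner_smul_left]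
  rfl

/-- The coordinates `normalCoord` are dual to the coordinates `planeCoord`. -/
theorem normalCoord_mul_add (ξ μ n : E3) {y : E3} (hy : inner ℝ ξ y = 0) :
    (normalCoord ξ μ n).2 * inner ℝ μ y - (normalCoord ξ μ n).1 * inner ℝ (cross μ ξ) y =
      inner ℝ (cross μ ξ) (cross μ ξ) * inner ℝ n y := by
  have h := inner_cross_smul_eq ξ μ (cross μ ξ) y
  rw [hy, zero_smul, zero_add] at h
  have h' := congrArg (fun z => inner ℝ n z) h
  simp only [inner_add_right, inner_smul_right] at h'
  have e1 : cross (cross μ ξ) ξ = -cross ξ (cross μ ξ) := cross_anti _ _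
  have e2 : cross ξ μ = -cross μ ξ := cross_anti _ _
  rw [e1, e2, inner_neg_left, inner_neg_right, inner_neg_right] at h'
  rw [normalCoord_fst_eq, normalCoord_snd_eq, e2, inner_neg_left,
    real_inner_comm n (cross μ ξ), real_inner_comm n (cross ξ (cross μ ξ))]
  linarith

/-- The projection along `n` to the plane orthogonal to `ξ`, up to the factor `⟨ξ, n⟩`. -/
def shear (ξ n x : E3) : E3 := (inner ℝ ξ n) • x - (inner ℝ ξ x) • n

theorem inner_shear (ξ n x : E3) : inner ℝ ξ (shear ξ n x) = 0 := by
  rw [shear, inner_sub_right, inner_smul_right, inner_smul_right]; ring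

theorem planeCoord_shear_det (ξ μ n x y : E3) :
    inner ℝ μ (shear ξ n y) * inner ℝ (cross μ ξ) (shear ξ n x) -
      inner ℝ μ (shear ξ n x) * inner ℝ (cross μ ξ) (shear ξ n y) =
    inner ℝ (cross μ ξ) (cross μ ξ) * (inner ℝ ξ n * inner ℝ (cross x y) n) := by
  have e : cross (shear ξ n y) (shear ξ n x) = -(inner ℝ ξ n * inner ℝ (cross x y) n) • ξ := by
    simp only [inner_eq, shear]
    apply ext_three <;> simp <;> ring
  have e' : inner ℝ (cross μ (cross μ ξ)) ξ = -(inner ℝ (cross μ ξ) (cross μ ξ) : ℝ) := by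
    simp only [inner_eq]; simp; ring
  rw [inner_mul_inner_sub, e, inner_smul_right, e']
  ring

namespace SimplicialSurface

variable {P : SimplicialSurface}

/-- A face that contains an interior point of another face contains that face. -/
theorem subset_of_mem_convexHull {s t : Finset E3} (hs : s ∈ P.faces) (ht : t ∈ P.faces)
    {w : E3 → ℝ} (hw : ∀ y ∈ s, 0 < w y) (h1 : ∑ y ∈ s, w y = 1)
    (hx : ∑ y ∈ s, w y • y ∈ convexHull ℝ (t : Set E3)) : s ⊆ t := by
  have hxs : ∑ y ∈ s, w y • y ∈ convexHull ℝ (s : Set E3) :=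
    (convex_convexHull ℝ _).sum_mem (fun y hy => (hw y hy).le) h1
      fun y hy => subset_convexHull ℝ _ hy
  have hx' := P.inter_subset_convexHull hs ht ⟨hxs, hx⟩
  rw [← Finset.coe_inter, Finset.mem_convexHull] at hx'
  obtain ⟨w', hw', h1', hc⟩ := hx'
  rw [Finset.centerMass_eq_of_sum_1 _ _ h1'] at hc
  have hind := (affineIndependent_iff.1 (P.indep hs)) Finset.univ
    (fun y => w y - if (y : E3) ∈ s ∩ t then w' y else 0) (by
      rw [Finset.sum_coe_sort s (fun y => w y - if y ∈ s ∩ t then w' y else 0),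
        Finset.sum_sub_distrib, h1, Finset.sum_ite_mem, ← Finset.inter_assoc, Finset.inter_self, h1',
        sub_self]) (by
      rw [Finset.sum_coe_sort s (fun y => (w y - if y ∈ s ∩ t then w' y else 0) • y)]
      simp only [sub_smul, ite_smul, zero_smul]
      rw [Finset.sum_sub_distrib, Finset.sum_ite_mem, ← Finset.inter_assoc, Finset.inter_self, ← hc]
      simp)
  intro y hy
  by_contra hyt
  have := hind ⟨y, hy⟩ (Finset.mem_univ _)
  simp only [Finset.mem_inter, hyt, and_false, if_false, sub_zero] at this
  exact (hw y hy).ne' this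

theorem triple_subset_of_mem_convexHull {a b c : E3} {t : Finset E3}
    (hs : ({a, b, c} : Finset E3) ∈ P.simplices 3) (ht : t ∈ P.faces) {α β γ : ℝ} (hα : 0 < α)
    (hβ : 0 < β) (hγ : 0 < γ) (h1 : α + β + γ = 1)
    (hx : α • a + β • b + γ • c ∈ convexHull ℝ (t : Set E3)) : ({a, b, c} : Finset E3) ⊆ t := by
  rw [mem_simplices] at hs
  obtain ⟨hab, hac, hbc⟩ := ne_of_card_eq_three hs.2
  have hsum : ∀ {M : Type} [AddCommMonoid M] (f : E3 → M), ∑ y ∈ ({a, b, c} : Finset E3), f y =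
      f a + (f b + f c) := by
    intro M _ f
    rw [Finset.sum_insert (by simp [hab, hac]), Finset.sum_pair hbc]
  refine subset_of_mem_convexHull hs.1 ht
    (w := fun y => if y = a then α else if y = b then β else γ) ?_ ?_ ?_
  · intro y _
    split_ifs <;> assumption
  · rw [hsum]
    simp only [if_true, hab.symm, hac.symm, hbc.symm, if_false]
    linarith
  · rw [hsum]
    simp only [if_true, hab.symm, hac.symm, hbc.symm, if_false]
    rwa [← add_assoc]

/-- Scaled by `ε`, which leaves positive weight for `v`, the two combinations become points of the
star with the same projection, so they coincide. The first is interior to its triangle, hence the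
triangles are the same, and the orientation matches their corners. -/
theorem eq_of_projection_eq (o : P.Orientation) {v n : E3} (hn : ‖n‖ = 1)
    (hinj : Set.InjOn (fun x : E3 => x - (inner ℝ n (x - v)) • n) (P.star v)) {a b c d : E3}
    (hab : o.pos v a b) (hcd : o.pos v c d) {α β γ δ τ : ℝ} (hα : 0 < α) (hβ : 0 < β) (hγ : 0 ≤ γ)
    (hδ : 0 ≤ δ) (h : α • (a - v) + β • (b - v) - (γ • (c - v) + δ • (d - v)) = τ • n) :
    a = c ∧ τ = 0 := by
  set ε : ℝ := (1 + α + β + γ + δ)⁻¹ with hε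
  have hpos : 0 < 1 + α + β + γ + δ := by positivity
  have hε0 : 0 < ε := inv_pos.2 hpos
  have hε1 : ε * (1 + α + β + γ + δ) = 1 := inv_mul_cancel₀ hpos.ne'
  have e1 : (1 - ε * α - ε * β) • v + (ε * α) • a + (ε * β) • b =
      v + ε • (α • (a - v) + β • (b - v)) := by module
  have e2 : (1 - ε * γ - ε * δ) • v + (ε * γ) • c + (ε * δ) • d =
      v + ε • (γ • (c - v) + δ • (d - v)) := by module
  have i1 := mul_pos hε0 hα
  have i2 := mul_pos hε0 hβ
  have i3 := mul_nonneg hε0.le hγ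
  have i4 := mul_nonneg hε0.le hδ
  have hp : v + ε • (α • (a - v) + β • (b - v)) ∈ convexHull ℝ (({v, a, b} : Finset E3) : Set E3) := by
    rw [← e1]
    exact mem_convexHull_triple (by nlinarith) i1.le i2.le (by ring) (by simp) (by simp) (by simp)
  have hq : v + ε • (γ • (c - v) + δ • (d - v)) ∈ convexHull ℝ (({v, c, d} : Finset E3) : Set E3) := by
    rw [← e2]
    exact mem_convexHull_triple (by nlinarith) i3 i4 (by ring) (by simp) (by simp) (by simp)
  have hnn : inner ℝ n n = (1 : ℝ) := by rw [real_inner_self_eq_norm_sq, hn]; norm_num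
  have heq : v + ε • (α • (a - v) + β • (b - v)) = v + ε • (γ • (c - v) + δ • (d - v)) := by
    refine hinj ?_ ?_ ?_
    · exact Set.mem_biUnion (x := ({v, a, b} : Finset E3)) (Finset.mem_filter.2 ⟨o.mem _ _ _ hab, by simp⟩) hp
    · exact Set.mem_biUnion (x := ({v, c, d} : Finset E3)) (Finset.mem_filter.2 ⟨o.mem _ _ _ hcd, by simp⟩) hq
    · rw [sub_eq_iff_eq_add] at h
      simp only [h, smul_add, inner_add_right, inner_smul_right, add_sub_cancel_left, hnn]
      module
  have hτ : τ = 0 := by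
    have h2 := smul_right_injective _ hε0.ne' (add_left_cancel heq)
    rw [h2, sub_self] at h
    refine (smul_eq_zero.1 h.symm).resolve_right ?_
    rintro rfl
    simp at hn
  refine ⟨?_, hτ⟩
  have hsub : ({v, a, b} : Finset E3) ⊆ {v, c, d} := by
    refine triple_subset_of_mem_convexHull (α := 1 - ε * α - ε * β) (o.mem _ _ _ hab) (o.face hcd)
      (by nlinarith) i1 i2 (by ring) ?_
    rw [e1, heq]
    exact hq
  have ha : a ∈ ({v, c, d} : Finset E3) := hsub (by simp)
  have hb : b ∈ ({v, c, d} : Finset E3) := hsub (by simp)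
  simp only [Finset.mem_insert, Finset.mem_singleton] at ha hb
  have hva := o.ne hab
  have hbv := (o.adj₃ hab).1
  rcases ha with rfl | ha | rfl
  · exact absurd rfl hva
  · exact ha
  · rcases hb with rfl | rfl | rfl
    · exact absurd rfl hbv
    · exact absurd (o.rotate _ _ _ hcd) (o.asymm _ _ _ (o.rotate _ _ _ hab))
    · exact absurd rfl (o.adj₂ hab).1

/-- If the triangle were parallel to `n`, a positive multiple of `n` would be a combination of its
two edges at `v`. Adding large multiples of both edges yields two different points of the triangle
with the same projection. -/
theorem inner_cross_ne_zero_of_injOn (o : P.Orientation) {v n : E3} (hn : ‖n‖ = 1)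
    (hinj : Set.InjOn (fun x : E3 => x - (inner ℝ n (x - v)) • n) (P.star v)) {a b : E3}
    (hab : o.pos v a b) : inner ℝ (cross (a - v) (b - v)) n ≠ 0 := by
  intro h0
  have h1 := inner_cross_smul_eq (a - v) (b - v) (cross (a - v) (b - v)) n
  have h2 : cross (b - v) (cross (a - v) (b - v)) = (inner ℝ (b - v) (b - v)) • (a - v) -
      (inner ℝ (a - v) (b - v)) • (b - v) := by
    simp only [inner_eq]
    apply ext_three <;> simp <;> ring
  rw [h0, cross_cross_left, h2, zero_smul, add_zero] at h1
  set x := a - v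
  set y := b - v
  set A : ℝ := inner ℝ x n * inner ℝ y y - inner ℝ y n * inner ℝ y x
  set B : ℝ := inner ℝ y n * inner ℝ x x - inner ℝ x n * inner ℝ x y
  have hA := le_abs_self A
  have hB := le_abs_self B
  have h3 := (eq_of_projection_eq o hn hinj hab hab (α := |A| + |B| + 1) (β := |A| + |B| + 1)
    (γ := |A| + |B| + 1 - A) (δ := |A| + |B| + 1 - B) (by positivity) (by positivity)
    (by linarith [abs_nonneg B]) (by linarith [abs_nonneg A])
    (τ := inner ℝ (cross x y) (cross x y)) (by rw [h1]; simp only [A, B]; module)).2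
  exact o.cross_ne_zero hab (inner_self_eq_zero.1 h3)

/-- If the sign changed between neighbouring triangles, the projection would fold along their common
edge: the linear relation between three consecutive edges and `n` provides points of both triangles
with the same projection. -/
theorem inner_cross_pos_iff_of_injOn (o : P.Orientation) {v n : E3} (hn : ‖n‖ = 1)
    (hinj : Set.InjOn (fun x : E3 => x - (inner ℝ n (x - v)) • n) (P.star v)) {a b c d : E3}
    (hab : o.pos v a b) (hcd : o.pos v c d) :
    0 < inner ℝ (cross (a - v) (b - v)) n ↔ 0 < inner ℝ (cross (c - v) (d - v)) n := by
  have key : ∀ x y, o.pos v x y → (0 < inner ℝ (cross (x - v) (o.opp v x - v)) n ↔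
      0 < inner ℝ (cross (y - v) (o.opp v y - v)) n) := by
    intro x y hxy
    have hyz := o.pos_opp (o.adj₃ hxy).symm
    rw [o.opp_eq hxy]
    set z := o.opp v y
    have n1 := inner_cross_ne_zero_of_injOn o hn hinj hxy
    have n2 := inner_cross_ne_zero_of_injOn o hn hinj hyz
    have hrel := inner_cross_smul_add_add (x - v) (y - v) (z - v) n
    set p : ℝ := inner ℝ (cross (x - v) (y - v)) n
    set q : ℝ := inner ℝ (cross (y - v) (z - v)) n
    set r : ℝ := inner ℝ (cross (z - v) (x - v)) n
    set s : ℝ := inner ℝ (cross (x - v) (y - v)) (z - v)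
    have hr := neg_abs_le r
    by_contra hcon
    rcases lt_or_gt_of_ne n1 with h1 | h1
    · have h2 : 0 < q := by
        by_contra h2
        exact hcon (iff_of_false (lt_asymm h1) h2)
      have := (eq_of_projection_eq o hn hinj hyz hxy (τ := -s) (α := |r| + 1 - r) (β := -p) (γ := q)
        (δ := |r| + 1) (by linarith [le_abs_self r]) (by linarith) h2.le (by positivity) (by
          rw [neg_smul s, ← hrel]; module)).1
      exact (o.adj₂ hxy).1 this.symm
    · have h2 : q < 0 := by
        refine lt_of_le_of_ne (not_lt.1 fun h2 => hcon (iff_of_true h1 h2)) n2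
      have := (eq_of_projection_eq o hn hinj hyz hxy (τ := s) (α := |r| + 1 + r) (β := p) (γ := -q)
        (δ := |r| + 1) (by linarith) h1 (by linarith) (by positivity) (by
          rw [← hrel]; module)).1
      exact (o.adj₂ hxy).1 this.symm
  have := o.link_connected (v := v) (g := fun x => 0 < inner ℝ (cross (x - v) (o.opp v x - v)) n)
    key (o.adj hab) (o.adj hcd)
  simpa only [o.opp_eq hab, o.opp_eq hcd] using this

namespace ThreeCritical

variable {ξ top bot mid : E3}

/-- The vectors `Y j` are the neighbours projected along `n` to the plane orthogonal to `ξ`, the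
vectors `G j` come from the normals of the triangles. `Y` turns exactly once by injectivity, `G`
does not turn by `sum_edgeTurning_link`, and the scalar products of `G` and `Y` detect the
neighbours below `mid`. So there is just one passage, and the index would be zero. -/
theorem false_of_inner_cross_pos (h : P.ThreeCritical ξ top bot mid) (o : P.Orientation) {n : E3}
    (hn : ‖n‖ = 1)
    (hinj : Set.InjOn (fun x : E3 => x - (inner ℝ n (x - mid)) • n) (P.star mid))
    (hs : 0 < inner ℝ ξ n)
    (hpos : ∀ a b, o.pos mid a b → 0 < inner ℝ (cross (a - mid) (b - mid)) n) : False := by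
  have hg := h.general
  have hξ : ξ ≠ 0 := by rintro rfl; simp at hs
  obtain ⟨a₀, ha₀⟩ := link_nonempty h.mid_mem
  set j₀ : P.link mid := ⟨a₀, mem_link.2 ha₀⟩
  -- a generic direction
  obtain ⟨μ, hgen, hμ⟩ : ∃ μ, (∀ x y : E3 × E3, P.Adj x.1 x.2 → P.Adj y.1 y.2 →
      slicePoint ξ (inner ℝ ξ mid) x ≠ slicePoint ξ (inner ℝ ξ mid) y →
      inner ℝ μ (slicePoint ξ (inner ℝ ξ mid) x - slicePoint ξ (inner ℝ ξ mid) y) ≠ 0) ∧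
        cross μ ξ ≠ 0 := by
    set E : Set E3 := {d | ∃ x ∈ (P.verts ×ˢ P.verts) ×ˢ (P.verts ×ˢ P.verts), d ≠ 0 ∧
      d = slicePoint ξ (inner ℝ ξ mid) x.1 - slicePoint ξ (inner ℝ ξ mid) x.2} with hE
    have hEf : E.Finite := by
      refine (((P.verts ×ˢ P.verts) ×ˢ (P.verts ×ˢ P.verts)).finite_toSet.image fun x =>
        slicePoint ξ (inner ℝ ξ mid) x.1 - slicePoint ξ (inner ℝ ξ mid) x.2).subset ?_
      rintro d ⟨x, hx, -, rfl⟩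
      exact ⟨x, hx, rfl⟩
    have hne := o.cross_cross_ne_zero hg (o.pos_rot mid j₀)
    obtain ⟨μ, h1, h2⟩ := ((frequently_inner_ne_zero hEf (by rintro d ⟨x, -, hx, rfl⟩; exact hx)
      _).and_eventually
        ((continuous_cross continuous_id continuous_const).continuousAt.eventually_ne hne)).exists
    refine ⟨μ, fun x y hx hy hxy => ?_, h2⟩
    exact h1 _ ⟨(x, y), by simp [hx.mem_left, hx.mem_right, hy.mem_left, hy.mem_right],
      sub_ne_zero.2 hxy, rfl⟩
  have hsum := h.sum_edgeTurning_link o hξ hμ hgen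
  have hD : 0 < inner ℝ (cross μ ξ) (cross μ ξ) := real_inner_self_pos.2 hμ
  set D : ℝ := inner ℝ (cross μ ξ) (cross μ ξ) with hDdef
  set σ := o.rot mid with hσ
  set N : P.link mid → E3 := fun j => cross ((j : E3) - mid) ((σ j : E3) - mid) with hN
  have hNpos : ∀ j, 0 < inner ℝ (N j) n := fun j => hpos _ _ (o.pos_rot mid j)
  set G : P.link mid → ℂ := fun j => ⟨(normalCoord ξ μ (N j)).2, (normalCoord ξ μ (N j)).1⟩ with hG
  -- The signs and the order of the coordinates make the real part of `G j * conj (Y k)` the pairing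
  -- in `normalCoord_mul_add`, with `Y` turning counterclockwise.
  set Y : P.link mid → ℂ := fun j => ⟨inner ℝ μ (shear ξ n ((j : E3) - mid)),
    -inner ℝ (cross μ ξ) (shear ξ n ((j : E3) - mid))⟩ with hY
  have hYdet : ∀ j, (Y j).re * (Y (σ j)).im - (Y (σ j)).re * (Y j).im =
      D * (inner ℝ ξ n * inner ℝ (N j) n) := by
    intro j
    rw [← planeCoord_shear_det]
    simp only [hY]
    ring
  have hYdet' : ∀ j, 0 < (Y j).re * (Y (σ j)).im - (Y (σ j)).re * (Y j).im := fun j => by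
    rw [hYdet]
    exact mul_pos hD (mul_pos hs (hNpos j))
  have hY0 : ∀ j, Y j ≠ 0 := fun j hj => by
    have := hYdet' j
    rw [hj] at this
    simp at this
  have hYim : ∀ j, 0 < (Y (σ j) / Y j).im := fun j => by
    rw [div_im_eq]
    exact div_pos (hYdet' j) (Complex.normSq_pos.2 (hY0 j))
  have hGdet : ∀ j, (G j).re * (G (σ j)).im - (G (σ j)).re * (G j).im ≠ 0 := by
    intro j
    have e := normalCoord_det_eq ξ μ (N j) (N (σ j))
    simp only [hG]
    rw [e]
    refine mul_ne_zero hD.ne' ?_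
    rw [real_inner_comm]
    exact o.inner_cross_cross_ne_zero hg (o.pos_rot mid j) (o.pos_rot mid (σ j))
  have hGim : ∀ j, (G (σ j) / G j).im ≠ 0 := fun j => by
    rw [div_im_eq]
    refine div_ne_zero (hGdet j) fun h0 => ?_
    have := hGdet j
    rw [Complex.normSq_eq_zero.1 h0] at this
    simp at this
  -- For `x` in the plane of the triangle, the normal sees only the component of the shear along
  -- `n`, which is proportional to the height of `x`.
  have hre : ∀ j x, inner ℝ (N j) x = 0 → (normalCoord ξ μ (N j)).2 * inner ℝ μ (shear ξ n x) -
      (normalCoord ξ μ (N j)).1 * inner ℝ (cross μ ξ) (shear ξ n x) =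
        -(inner ℝ ξ x * (D * inner ℝ (N j) n)) := by
    intro j x hx
    rw [normalCoord_mul_add ξ μ (N j) (inner_shear ξ n x), shear, inner_sub_right, inner_smul_right,
      inner_smul_right, hx]
    ring
  have hsign : ∀ j (k : P.link mid), inner ℝ (N j) ((k : E3) - mid) = 0 →
      (G j * (starRingEnd ℂ) (Y k)).re ≠ 0 ∧
      (0 < (G j * (starRingEnd ℂ) (Y k)).re ↔ inner ℝ ξ (k : E3) < inner ℝ ξ mid) := by
    intro j k hjk
    have e : (G j * (starRingEnd ℂ) (Y k)).re =
        (inner ℝ ξ mid - inner ℝ ξ (k : E3)) * (D * inner ℝ (N j) n) := by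
      have := hre j _ hjk
      rw [inner_sub_right] at this
      simp only [hG, hY, Complex.mul_re, Complex.conj_re, Complex.conj_im]
      linarith
    have hp := mul_pos hD (hNpos j)
    rw [e, mul_pos_iff_of_pos_right hp, sub_pos]
    exact ⟨mul_ne_zero (sub_ne_zero.2 (hg.ne (mem_link.1 k.2))) hp.ne', Iff.rfl⟩
  have main := sum_arg_div_eq_sub σ G Y (fun j => inner ℝ ξ (j : E3) < inner ℝ ξ mid) hYim
    (fun j => hsign j j (inner_cross_left_self _ _)) (fun j => hsign j (σ j) (inner_cross_right_self _ _))
  have hGsum : ∑ j, (G (σ j) / G j).arg = 0 := by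
    rw [sum_arg_div_eq_rayCrossing σ G hGim]
    rw [← Equiv.sum_comp σ] at hsum
    have : ∑ j, rayCrossing ((G j).im, (G j).re) ((G (σ j)).im, (G (σ j)).re) = 0 := by
      rw [← hsum]
      exact Finset.sum_congr rfl fun j _ =>
        (o.edgeTurning_eq ξ μ (o.pos_rot mid j) (o.pos_rot mid (σ j))).symm
    rw [this]; simp
  -- Division by `c` turns the total rotation into a count of crossings with the ray through `c`.
  -- This ray runs inside the projected triangle of `j₀`; a second triangle that crosses it would
  -- overlap that one in projection.
  have hYsum : ∑ j, (Y (σ j) / Y j).arg = 2 * Real.pi := by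
    set c := Y j₀ + Y (σ j₀) with hc
    have hc0 : c ≠ 0 := by
      intro h0
      have := hYdet' j₀
      rw [hc, add_eq_zero_iff_eq_neg] at h0
      rw [h0] at this
      simp at this
    have hcn := Complex.normSq_pos.2 hc0
    have e : ∀ j, Y (σ j) / Y j = (Y (σ j) / c) / (Y j / c) := fun j =>
      (div_div_div_cancel_right₀ hc0 _ _).symm
    have hcim : ∀ z : ℂ, (z / c).im = (c.re * z.im - z.re * c.im) / Complex.normSq c := fun z =>
      div_im_eq c z
    have hZdet : ∀ j, 0 < (Y j / c).re * (Y (σ j) / c).im - (Y (σ j) / c).re * (Y j / c).im := by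
      intro j
      have h1 := hYim j
      rw [e j, div_im_eq] at h1
      exact (div_pos_iff_of_pos_right (Complex.normSq_pos.2 (div_ne_zero (hY0 j) hc0))).1 h1
    rw [Finset.sum_congr rfl fun j _ => by rw [e j],
      sum_arg_div_eq_rayCrossing σ (fun j => Y j / c) (fun j => by rw [← e j]; exact (hYim j).ne')]
    have hone : ∑ j, rayCrossing ((Y j / c).im, (Y j / c).re) ((Y (σ j) / c).im, (Y (σ j) / c).re) =
        1 := by
      have hterm : ∀ j, rayCrossing ((Y j / c).im, (Y j / c).re)
          ((Y (σ j) / c).im, (Y (σ j) / c).re) =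
            if (Y j / c).im ≤ 0 ∧ 0 < (Y (σ j) / c).im then 1 else 0 := by
        intro j
        simp only [rayCrossing]
        rw [if_neg (c := (Y (σ j) / c).im ≤ 0 ∧ _) (by
          rintro ⟨-, -, h'⟩; exact lt_asymm h' (by linarith [hZdet j])), sub_zero]
        simp only [hZdet j, and_true]
      rw [Finset.sum_congr rfl fun j _ => hterm j, Finset.sum_eq_single j₀]
      · rw [if_pos]
        have h1 := hYdet' j₀
        rw [hcim, hcim]
        constructor
        · refine div_nonpos_of_nonpos_of_nonneg ?_ hcn.le
          simp only [hc, Complex.add_re, Complex.add_im]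
          linarith
        · refine div_pos ?_ hcn
          simp only [hc, Complex.add_re, Complex.add_im]
          linarith
      · intro j _ hj
        rw [if_neg]
        rintro ⟨h1, h2⟩
        set α := (Y (σ j) / c).im with hα
        set β := -(Y j / c).im with hβ
        set r := (Y j / c).re * (Y (σ j) / c).im - (Y (σ j) / c).re * (Y j / c).im with hr
        have hr0 : 0 < r := hZdet j
        have hcomb : (α : ℂ) * (Y j / c) + (β : ℂ) * (Y (σ j) / c) = (r : ℂ) := by
          apply Complex.ext
          · simp only [Complex.add_re, Complex.mul_re, Complex.ofReal_re, Complex.ofReal_im]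
            rw [hα, hβ, hr]; ring
          · simp only [Complex.add_im, Complex.mul_im, Complex.ofReal_re, Complex.ofReal_im]
            rw [hα, hβ]; ring
        have hcomb' : (α : ℂ) * Y j + (β : ℂ) * Y (σ j) = (r : ℂ) * Y j₀ + (r : ℂ) * Y (σ j₀) := by
          have h3 : (α : ℂ) * Y j + (β : ℂ) * Y (σ j) =
              ((α : ℂ) * (Y j / c) + (β : ℂ) * (Y (σ j) / c)) * c := by
            field_simp
          rw [h3, hcomb, hc]; ring
        set X : E3 := r • ((j₀ : E3) - mid) + r • ((σ j₀ : E3) - mid) -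
          (α • ((j : E3) - mid) + β • ((σ j : E3) - mid)) with hX
        have hlin : ∀ w : E3, inner ℝ w (shear ξ n X) =
            r * inner ℝ w (shear ξ n ((j₀ : E3) - mid)) + r * inner ℝ w (shear ξ n ((σ j₀ : E3) - mid)) -
            (α * inner ℝ w (shear ξ n ((j : E3) - mid)) +
              β * inner ℝ w (shear ξ n ((σ j : E3) - mid))) := by
          intro w
          simp only [hX, shear, inner_sub_right, inner_add_right, inner_smul_right]
          ring
        have hX0 : shear ξ n X = 0 := by
          refine eq_zero_of_planeCoord_eq_zero hμ (inner_shear _ _ _) ?_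
          have e1 := congrArg Complex.re hcomb'
          have e2 := congrArg Complex.im hcomb'
          simp only [hY, Complex.add_re, Complex.add_im, Complex.mul_re, Complex.mul_im,
            Complex.ofReal_re, Complex.ofReal_im] at e1 e2
          rw [planeCoord_apply, hlin, hlin, Prod.mk_eq_zero]
          constructor <;> linarith
        have hXn : X = (inner ℝ ξ X / inner ℝ ξ n) • n := by
          rw [shear, sub_eq_zero] at hX0
          rw [div_eq_inv_mul, mul_smul, ← hX0, smul_smul, inv_mul_cancel₀ hs.ne', one_smul]
        have := (eq_of_projection_eq o hn hinj (o.pos_rot mid j₀) (o.pos_rot mid j) hr0 hr0 h2.le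
          (by rw [hβ]; linarith) hXn).1
        exact hj (Subtype.ext this.symm)
      · simp
    rw [hone]; simp
  rw [hGsum, hYsum] at main
  have hcard : (Finset.univ.filter fun j : P.link mid =>
      inner ℝ ξ (j : E3) < inner ℝ ξ mid ∧ ¬ inner ℝ ξ (σ j : E3) < inner ℝ ξ mid).card = 1 := by
    have hpi := Real.pi_pos
    have h1 : ((Finset.univ.filter fun j : P.link mid =>
      inner ℝ ξ (j : E3) < inner ℝ ξ mid ∧ ¬ inner ℝ ξ (σ j : E3) < inner ℝ ξ mid).card : ℝ) = 1 :=
      mul_left_cancel₀ (mul_pos two_pos hpi).ne' (by linarith)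
    exact_mod_cast h1
  apply h.index_ne_zero
  have hfil : (Finset.univ.filter fun j : P.link mid =>
      inner ℝ ξ (j : E3) < inner ℝ ξ mid ∧ inner ℝ ξ mid < inner ℝ ξ (o.rot mid j : E3)).card = 1 := by
    refine Eq.trans (congrArg Finset.card ?_) hcard
    refine Finset.filter_congr fun j _ => and_congr_right fun _ => ?_
    rw [not_lt]
    exact ⟨fun h' => h'.le, fun h' => lt_of_le_of_ne h' (hg.ne (mem_link.1 (σ j).2))⟩
  rw [o.index_eq hg]
  rw [sub_eq_zero]
  exact_mod_cast hfil.symm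

/-- The third critical point possesses no transverse plane. -/
theorem not_hasTransversePlane (h : P.ThreeCritical ξ top bot mid) (o : P.Orientation) {n : E3}
    (hn : ‖n‖ = 1)
    (hinj : Set.InjOn (fun x : E3 => x - (inner ℝ n (x - mid)) • n) (P.star mid))
    (hs : inner ℝ ξ n ≠ 0) : False := by
  obtain ⟨a, ha⟩ := link_nonempty h.mid_mem
  obtain ⟨b, hab⟩ := o.exists_pos ha
  -- The two signs are adjusted by passing to `-n` and to `-ξ`, which exchanges top and bottom.
  have key : ∀ (n : E3), ‖n‖ = 1 →
      Set.InjOn (fun x : E3 => x - (inner ℝ n (x - mid)) • n) (P.star mid) → inner ℝ ξ n ≠ 0 →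
      0 < inner ℝ (cross (a - mid) (b - mid)) n → False := by
    intro n hn hinj hs hp
    have hpos : ∀ c d, o.pos mid c d → 0 < inner ℝ (cross (c - mid) (d - mid)) n := fun c d hcd =>
      (inner_cross_pos_iff_of_injOn o hn hinj hab hcd).1 hp
    rcases lt_or_gt_of_ne hs with hs' | hs'
    · exact (h.neg o).false_of_inner_cross_pos o hn hinj (by simpa using hs') hpos
    · exact h.false_of_inner_cross_pos o hn hinj hs' hpos
  rcases lt_or_gt_of_ne (inner_cross_ne_zero_of_injOn o hn hinj hab) with hp | hp
  · exact key (-n) (by simpa using hn) (by simpa using hinj) (by simpa using hs) (by simpa using hp)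
  · exact key n hn hinj hs hp

end ThreeCritical

/-- The perturbation of `ξ` is also used to make its scalar product with `n` nonzero, so that one
can project along `n` to a horizontal plane. -/
theorem not_hasTransversePlane_of_ncard (o : P.Orientation) {ξ vmax vmin v₀ : E3}
    (hg : P.IsGeneral ξ) (hcrit : (P.criticalPoints ξ).ncard = 3) (hmax : vmax ∈ P.verts)
    (hmin : vmin ∈ P.verts) (h₀ : v₀ ∈ P.criticalPoints ξ)
    (hle : ∀ x ∈ P.verts, inner ℝ ξ x ≤ inner ℝ ξ vmax)
    (hge : ∀ x ∈ P.verts, inner ℝ ξ vmin ≤ inner ℝ ξ x) (h0max : v₀ ≠ vmax) (h0min : v₀ ≠ vmin) :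
    ¬ P.HasTransversePlane v₀ := by
  rintro ⟨n, hn, hinj⟩
  have hn0 : n ≠ 0 := by rintro rfl; simp at hn
  obtain ⟨ξ', ⟨top, bot, h⟩, -, hs⟩ := (frequently_threeCritical o hg hcrit hmax hmin h₀ hle hge
    h0max h0min (Set.finite_singleton n) (by simpa using hn0)).exists
  exact h.not_hasTransversePlane o hn hinj (hs n rfl)

end SimplicialSurface

/-! ### Parity of intersections in a half strip -/

section Strip

variable {t t' v v' : ℝ}

/-- A segment in the plane with coordinates `(t, v)` that misses the interval `[0, 1]` on the first
axis: the half lines above `(0, 0)` and `(1, 0)` are hit by it as often, modulo 2, as its ends lie in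
the half strip above the interval. -/
theorem strip_parity (h0 : t ≠ 0) (h1 : t ≠ 1) (h0' : t' ≠ 0) (h1' : t' ≠ 1)
    (hne : ∀ l : ℝ, 0 ≤ l → l ≤ 1 → 0 ≤ (1 - l) * t + l * t' → (1 - l) * t + l * t' ≤ 1 →
      (1 - l) * v + l * v' ≠ 0) :
    (if ∃ l : ℝ, 0 ≤ l ∧ l ≤ 1 ∧ (1 - l) * t + l * t' = 1 ∧ 0 < (1 - l) * v + l * v' then 1 else 0 :
        ZMod 2) +
      (if ∃ l : ℝ, 0 ≤ l ∧ l ≤ 1 ∧ (1 - l) * t + l * t' = 0 ∧ 0 < (1 - l) * v + l * v' then 1 else 0) =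
    (if 0 < t ∧ t < 1 ∧ 0 < v then 1 else 0) + (if 0 < t' ∧ t' < 1 ∧ 0 < v' then 1 else 0) := by
  -- Over the interval the segment keeps its sign; otherwise it would hit the interval, at the
  -- convex combination with weight `s`.
  have hsign : ∀ l l' : ℝ, 0 ≤ l → l ≤ 1 → 0 ≤ (1 - l) * t + l * t' → (1 - l) * t + l * t' ≤ 1 →
      0 ≤ l' → l' ≤ 1 → 0 ≤ (1 - l') * t + l' * t' → (1 - l') * t + l' * t' ≤ 1 →
      0 < (1 - l) * v + l * v' → 0 < (1 - l') * v + l' * v' := by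
    intro l l' a1 a2 a3 a4 b1 b2 b3 b4 hp
    by_contra hcon
    have hn : (1 - l') * v + l' * v' < 0 := lt_of_le_of_ne (not_lt.1 hcon) (hne l' b1 b2 b3 b4)
    have hd : 0 < ((1 - l) * v + l * v') - ((1 - l') * v + l' * v') := by linarith
    obtain ⟨s, hs⟩ : ∃ s : ℝ, s * (((1 - l) * v + l * v') - ((1 - l') * v + l' * v')) =
        (1 - l) * v + l * v' := ⟨_, div_mul_cancel₀ _ hd.ne'⟩
    have hs0 : 0 ≤ s := by
      by_contra hs0
      nlinarith [mul_neg_of_neg_of_pos (not_le.1 hs0) hd]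
    have hs1 : 0 ≤ 1 - s := by
      by_contra hs1
      nlinarith [mul_neg_of_neg_of_pos (not_le.1 hs1) hd]
    have e : (1 - ((1 - s) * l + s * l')) * t + ((1 - s) * l + s * l') * t' =
        (1 - s) * ((1 - l) * t + l * t') + s * ((1 - l') * t + l' * t') := by ring
    refine hne ((1 - s) * l + s * l') (by positivity) (by nlinarith) ?_ ?_ (by linarith)
    · rw [e]; positivity
    · rw [e]; nlinarith
  -- `E` says that the segment passes above the interval. Given `E`, only the positions of `t` and
  -- `t'` relative to 0 and 1 matter.
  set E : Prop := ∃ l : ℝ, 0 ≤ l ∧ l ≤ 1 ∧ 0 ≤ (1 - l) * t + l * t' ∧ (1 - l) * t + l * t' ≤ 1 ∧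
    0 < (1 - l) * v + l * v'
  have hit : ∀ k : ℝ, 0 ≤ k → k ≤ 1 → t ≠ k → t' ≠ k →
      ((∃ l : ℝ, 0 ≤ l ∧ l ≤ 1 ∧ (1 - l) * t + l * t' = k ∧ 0 < (1 - l) * v + l * v') ↔
        E ∧ ((t < k ∧ k < t') ∨ (t' < k ∧ k < t))) := by
    intro k k0 k1 hk hk'
    constructor
    · rintro ⟨l, a1, a2, a3, a4⟩
      refine ⟨⟨l, a1, a2, by linarith, by linarith, a4⟩, ?_⟩
      rcases lt_or_gt_of_ne hk with h | h <;> rcases lt_or_gt_of_ne hk' with h' | h'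
      · rcases a1.eq_or_lt with rfl | hl
        · linarith
        · nlinarith [mul_pos hl (sub_pos.2 h'), mul_nonneg (sub_nonneg.2 a2) (sub_pos.2 h).le]
      · exact Or.inl ⟨h, h'⟩
      · exact Or.inr ⟨h', h⟩
      · rcases a1.eq_or_lt with rfl | hl
        · linarith
        · nlinarith [mul_pos hl (sub_pos.2 h'), mul_nonneg (sub_nonneg.2 a2) (sub_pos.2 h).le]
    · rintro ⟨⟨l, a1, a2, a3, a4, a5⟩, h⟩
      have hd : t' - t ≠ 0 := by rcases h with h | h <;> intro h' <;> linarith [h.1, h.2]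
      obtain ⟨r, hr⟩ : ∃ r : ℝ, r * (t' - t) = k - t := ⟨_, div_mul_cancel₀ _ hd⟩
      have hr0 : 0 ≤ r := by
        by_contra hr0
        rcases h with h | h <;> nlinarith [h.1, h.2]
      have hr1 : r ≤ 1 := by
        by_contra hr1
        rcases h with h | h <;> nlinarith [h.1, h.2]
      have e : (1 - r) * t + r * t' = k := by linarith
      exact ⟨r, hr0, hr1, e, hsign l r a1 a2 a3 a4 hr0 hr1 (by rw [e]; exact k0) (by rw [e]; exact k1) a5⟩
  have hv : 0 < t ∧ t < 1 ∧ 0 < v ↔ E ∧ 0 < t ∧ t < 1 := by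
    constructor
    · rintro ⟨a, b, c⟩
      exact ⟨⟨0, by simp, by simp, by simpa using a.le, by simpa using b.le, by simpa using c⟩, a, b⟩
    · rintro ⟨⟨l, a1, a2, a3, a4, a5⟩, a, b⟩
      refine ⟨a, b, ?_⟩
      simpa using hsign l 0 a1 a2 a3 a4 le_rfl zero_le_one (by simpa using a.le) (by simpa using b.le) a5
  have hv' : 0 < t' ∧ t' < 1 ∧ 0 < v' ↔ E ∧ 0 < t' ∧ t' < 1 := by
    constructor
    · rintro ⟨a, b, c⟩
      exact ⟨⟨1, by simp, by simp, by simpa using a.le, by simpa using b.le, by simpa using c⟩, a, b⟩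
    · rintro ⟨⟨l, a1, a2, a3, a4, a5⟩, a, b⟩
      refine ⟨a, b, ?_⟩
      simpa using hsign l 1 a1 a2 a3 a4 zero_le_one le_rfl (by simpa using a.le) (by simpa using b.le) a5
  simp only [hit 1 zero_le_one le_rfl h1 h1', hit 0 le_rfl zero_le_one h0 h0', hv, hv']
  by_cases hE : E
  · simp only [hE, true_and]
    have two : (1 : ZMod 2) + 1 = 0 := by decide
    rcases lt_or_gt_of_ne h0 with a | a <;> rcases lt_or_gt_of_ne h1 with b | b <;>
      rcases lt_or_gt_of_ne h0' with c | c <;> rcases lt_or_gt_of_ne h1' with d | d <;>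
      first
      | (exfalso; linarith)
      | simp [a, b, c, d, a.le, b.le, c.le, d.le, not_lt.2, two]
  · simp [hE]

end Strip

section Plane

variable (θ : E3 →ᵃ[ℝ] ℝ)

theorem affine_combo₃ (f : E3 →ᵃ[ℝ] ℝ) {x y z : E3} {α β γ : ℝ} (h : α + β + γ = 1) :
    f (α • x + β • y + γ • z) = α * f x + β * f y + γ * f z := by
  have h1 : ∀ u : E3, f u = f.linear u + f 0 := fun u => by
    rw [f.decomp']; simp
  rw [h1, h1 x, h1 y, h1 z]
  simp only [map_add, map_smul, smul_eq_mul]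
  linear_combination (f 0) * (-h)

/-- The point of the line through `p` and `q` at which `θ` vanishes. -/
def zeroPoint (p q : E3) : E3 := (θ q / (θ q - θ p)) • p + (-θ p / (θ q - θ p)) • q

variable {θ}

theorem zeroPoint_comm (p q : E3) : zeroPoint θ p q = zeroPoint θ q p := by
  have e1 : θ q / (θ q - θ p) = -θ q / (θ p - θ q) := by
    rw [← neg_sub (θ p), div_neg, neg_div]
  have e2 : -θ p / (θ q - θ p) = θ p / (θ p - θ q) := by
    rw [← neg_sub (θ p), neg_div_neg_eq]
  rw [zeroPoint, zeroPoint, e1, e2, add_comm]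

/-- The corner `p` is alone on its side of the plane. The weights `β` and `γ`, multiplied by `1 - θ
q / θ p` and `1 - θ r / θ p`, become the weights of the two zero points. -/
theorem mem_segment_zeroPoint {p q r z : E3} {α β γ : ℝ} (hβ : 0 ≤ β) (hγ : 0 ≤ γ)
    (h1 : α + β + γ = 1) (hz : z = α • p + β • q + γ • r) (h0 : θ z = 0) (hq : θ p * θ q < 0)
    (hr : θ p * θ r < 0) : ∃ l : ℝ, 0 ≤ l ∧ l ≤ 1 ∧
      z = (1 - l) • zeroPoint θ p q + l • zeroPoint θ p r := by
  have hp : θ p ≠ 0 := by rintro h; simp [h] at hq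
  have hdq : θ q - θ p ≠ 0 := by intro h; rw [sub_eq_zero.1 h] at hq; nlinarith
  have hdr : θ r - θ p ≠ 0 := by intro h; rw [sub_eq_zero.1 h] at hr; nlinarith
  rw [hz, affine_combo₃ θ h1] at h0
  have e1 : β * (1 - θ q / θ p) + γ * (1 - θ r / θ p) = 1 := by
    field_simp
    linear_combination (θ p) * h1 - h0
  have hq' : 0 ≤ 1 - θ q / θ p := by
    have : θ q / θ p = (θ p * θ q) / (θ p * θ p) := by field_simp
    have h2 : θ q / θ p ≤ 0 := by
      rw [this]; exact div_nonpos_of_nonpos_of_nonneg hq.le (mul_self_nonneg _)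
    linarith
  have hr' : 0 ≤ 1 - θ r / θ p := by
    have : θ r / θ p = (θ p * θ r) / (θ p * θ p) := by field_simp
    have h2 : θ r / θ p ≤ 0 := by
      rw [this]; exact div_nonpos_of_nonpos_of_nonneg hr.le (mul_self_nonneg _)
    linarith
  have g1 := mul_nonneg hβ hq'
  have g2 := mul_nonneg hγ hr'
  refine ⟨γ * (1 - θ r / θ p), g2, by linarith, ?_⟩
  have e2 : 1 - γ * (1 - θ r / θ p) = β * (1 - θ q / θ p) := by linarith
  rw [e2, hz, zeroPoint, zeroPoint]
  have c1 : α = β * (1 - θ q / θ p) * (θ q / (θ q - θ p)) +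
      γ * (1 - θ r / θ p) * (θ r / (θ r - θ p)) := by
    have : α = -(β * θ q + γ * θ r) / θ p := by field_simp; linarith
    rw [this]
    field_simp
    ring
  have c2 : β = β * (1 - θ q / θ p) * (-θ p / (θ q - θ p)) := by
    field_simp; ring
  have c3 : γ = γ * (1 - θ r / θ p) * (-θ p / (θ r - θ p)) := by
    field_simp; ring
  rw [smul_add, smul_add, smul_smul, smul_smul, smul_smul, smul_smul, ← c2, ← c3]
  nth_rw 1 [c1]
  rw [add_smul]
  abel

theorem exists_zeroPoint_eq {p q : E3} (h : θ p * θ q < 0) : ∃ l : ℝ, 0 < l ∧ l < 1 ∧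
    zeroPoint θ p q = (1 - l) • p + l • q ∧ (1 - l) * θ p + l * θ q = 0 := by
  have hd : θ q - θ p ≠ 0 := by intro h'; rw [sub_eq_zero.1 h'] at h; nlinarith
  have h1 : (θ q / (θ q - θ p)) = 1 - -θ p / (θ q - θ p) := by field_simp; ring
  have hsq : 0 < (θ q - θ p) * (θ q - θ p) := mul_self_pos.2 hd
  have e1 : -θ p / (θ q - θ p) = (θ p * θ p - θ p * θ q) / ((θ q - θ p) * (θ q - θ p)) := by
    field_simp
    ring
  refine ⟨-θ p / (θ q - θ p), ?_, ?_, by rw [zeroPoint, h1], by field_simp; ring⟩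
  · rw [e1]
    exact div_pos (by nlinarith [mul_self_nonneg (θ p)]) hsq
  · rw [e1, div_lt_one hsq]
    nlinarith [mul_self_nonneg (θ p), mul_self_pos.2 (show θ q ≠ 0 by rintro h'; simp [h'] at h)]

theorem mem_convexHull_triple_iff {p q r z : E3} : z ∈ convexHull ℝ ({p, q, r} : Set E3) ↔
    ∃ α β γ : ℝ, 0 ≤ α ∧ 0 ≤ β ∧ 0 ≤ γ ∧ α + β + γ = 1 ∧ z = α • p + β • q + γ • r := by
  constructor
  · intro h
    rw [convexHull_insert (by simp), convexHull_pair, mem_convexJoin] at h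
    obtain ⟨p', hp', y, ⟨β, γ, hβ, hγ, h1, rfl⟩, ⟨u, v, hu, hv, huv, rfl⟩⟩ := h
    rw [Set.mem_singleton_iff] at hp'
    subst hp'
    refine ⟨u, v * β, v * γ, hu, by positivity, by positivity, ?_, ?_⟩
    · linear_combination huv + v * h1
    · rw [smul_add, smul_smul, smul_smul, add_assoc]
  · rintro ⟨α, β, γ, hα, hβ, hγ, h1, rfl⟩
    exact mem_convexHull_triple hα hβ hγ h1 (by simp) (by simp) (by simp)

theorem mem_convexHull_and_eq_zero_iff {p q r z : E3} (hq : θ p * θ q < 0) (hr : θ p * θ r < 0) :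
    (z ∈ convexHull ℝ ({p, q, r} : Set E3) ∧ θ z = 0) ↔ ∃ l : ℝ, 0 ≤ l ∧ l ≤ 1 ∧
      z = (1 - l) • zeroPoint θ p q + l • zeroPoint θ p r := by
  constructor
  · rintro ⟨hz, h0⟩
    obtain ⟨α, β, γ, -, hβ, hγ, h1, hz⟩ := mem_convexHull_triple_iff.1 hz
    exact mem_segment_zeroPoint hβ hγ h1 hz h0 hq hr
  · rintro ⟨l, hl0, hl1, rfl⟩
    obtain ⟨x, hx0, hx1, ex, ex'⟩ := exists_zeroPoint_eq hq
    obtain ⟨y, hy0, hy1, ey, ey'⟩ := exists_zeroPoint_eq hr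
    have e : (1 - l) • zeroPoint θ p q + l • zeroPoint θ p r =
        ((1 - l) * (1 - x) + l * (1 - y)) • p + ((1 - l) * x) • q + (l * y) • r := by
      rw [ex, ey]; module
    have s1 : ((1 - l) * (1 - x) + l * (1 - y)) + ((1 - l) * x) + (l * y) = 1 := by ring
    constructor
    · rw [e, mem_convexHull_triple_iff]
      have a1 : 0 ≤ 1 - l := by linarith
      have a2 : 0 ≤ 1 - x := by linarith
      have a3 : 0 ≤ 1 - y := by linarith
      exact ⟨_, _, _, by positivity, by positivity, by positivity, s1, rfl⟩
    · rw [e, affine_combo₃ θ s1]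
      linear_combination (1 - l) * ex' + l * ey'

variable (T ν : E3 →ᵃ[ℝ] ℝ)

theorem affine_combo₂ (f : E3 →ᵃ[ℝ] ℝ) (x y : E3) (l : ℝ) :
    f ((1 - l) • x + l • y) = (1 - l) * f x + l * f y :=
  Convex.combo_affine_apply (by ring)

/-- Whether the point of the line `pq` with `θ = 0` lies in the half strip `0 < T < 1`, `0 < ν`. -/
def inStrip (θ T ν : E3 →ᵃ[ℝ] ℝ) (p q : E3) : ZMod 2 :=
  if 0 < T (zeroPoint θ p q) ∧ T (zeroPoint θ p q) < 1 ∧ 0 < ν (zeroPoint θ p q) then 1 else 0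

theorem inStrip_comm (p q : E3) : inStrip θ T ν p q = inStrip θ T ν q p := by
  rw [inStrip, inStrip, zeroPoint_comm]

/-- The edges of `t` that enter the half strip. -/
def stripSum (θ T ν : E3 →ᵃ[ℝ] ℝ) (t : Finset E3) : ZMod 2 :=
  ∑ p ∈ t, ∑ q ∈ t, if θ p < 0 ∧ 0 < θ q then inStrip θ T ν p q else 0

theorem stripSum_triple {p q r : E3} (hpq : p ≠ q) (hpr : p ≠ r) (hqr : q ≠ r)
    (hq : θ p * θ q < 0) (hr : θ p * θ r < 0) :
    stripSum θ T ν {p, q, r} = inStrip θ T ν p q + inStrip θ T ν p r := by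
  have hsum : ∀ f : E3 → ZMod 2, ∑ y ∈ ({p, q, r} : Finset E3), f y = f p + (f q + f r) := by
    intro f
    rw [Finset.sum_insert (by simp [hpq, hpr]), Finset.sum_pair hqr]
  simp only [stripSum, hsum]
  rcases mul_neg_iff.1 hq with ⟨h1, h2⟩ | ⟨h1, h2⟩
  · have h3 : θ r < 0 := by
      by_contra h3
      nlinarith [mul_nonneg h1.le (not_lt.1 h3)]
    simp [h1, h2, h3, h1.le, h2.le, h3.le, not_lt.2, inStrip_comm T ν p]
  · have h3 : 0 < θ r := by
      by_contra h3
      nlinarith [mul_nonneg_of_nonpos_of_nonpos h1.le (not_lt.1 h3)]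
    simp [h1, h2, h3, h1.le, h2.le, h3.le, not_lt.2]

/-- The set of points of `t` in the plane `θ = 0` above the point with `T = k`. -/
def HitAt (θ T ν : E3 →ᵃ[ℝ] ℝ) (k : ℝ) (t : Finset E3) : Prop :=
  ∃ z ∈ convexHull ℝ (t : Set E3), θ z = 0 ∧ T z = k ∧ 0 < ν z

variable {T ν}

theorem hitAt_triple_iff {p q r : E3} (hq : θ p * θ q < 0) (hr : θ p * θ r < 0) (k : ℝ) :
    HitAt θ T ν k {p, q, r} ↔ ∃ l : ℝ, 0 ≤ l ∧ l ≤ 1 ∧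
      (1 - l) * T (zeroPoint θ p q) + l * T (zeroPoint θ p r) = k ∧
      0 < (1 - l) * ν (zeroPoint θ p q) + l * ν (zeroPoint θ p r) := by
  have hc : ∀ z, z ∈ convexHull ℝ (({p, q, r} : Finset E3) : Set E3) ∧ θ z = 0 ↔ ∃ l : ℝ, 0 ≤ l ∧
      l ≤ 1 ∧ z = (1 - l) • zeroPoint θ p q + l • zeroPoint θ p r := by
    intro z
    rw [← mem_convexHull_and_eq_zero_iff hq hr]
    simp
  constructor
  · rintro ⟨z, hz, h0, h1, h2⟩
    obtain ⟨l, hl0, hl1, rfl⟩ := (hc z).1 ⟨hz, h0⟩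
    rw [affine_combo₂] at h1 h2
    exact ⟨l, hl0, hl1, h1, h2⟩
  · rintro ⟨l, hl0, hl1, h1, h2⟩
    obtain ⟨hz, h0⟩ := (hc _).2 ⟨l, hl0, hl1, rfl⟩
    exact ⟨_, hz, h0, by rw [affine_combo₂, h1], by rwa [affine_combo₂]⟩

theorem exists_separated {t : Finset E3} (ht : t.card = 3) (h0 : ∀ p ∈ t, θ p ≠ 0)
    (hpos : ¬ ∀ p ∈ t, 0 < θ p) (hneg : ¬ ∀ p ∈ t, θ p < 0) :
    ∃ p q r, t = {p, q, r} ∧ θ p * θ q < 0 ∧ θ p * θ r < 0 := by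
  obtain ⟨a, b, c, hab, hac, hbc, rfl⟩ := Finset.card_eq_three.1 ht
  have e1 : ({a, b, c} : Finset E3) = {c, a, b} := by ext; simp; tauto
  have e2 : ({a, b, c} : Finset E3) = {b, a, c} := by ext; simp; tauto
  have ha := h0 a (by simp)
  have hb := h0 b (by simp)
  have hc := h0 c (by simp)
  have hpos' : ¬ (0 < θ a ∧ 0 < θ b ∧ 0 < θ c) := fun h => hpos (by simpa using h)
  have hneg' : ¬ (θ a < 0 ∧ θ b < 0 ∧ θ c < 0) := fun h => hneg (by simpa using h)
  clear hpos hneg h0 ht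
  have m : ∀ {x y : ℝ}, x < 0 → 0 < y → x * y < 0 ∧ y * x < 0 := fun hx hy =>
    ⟨mul_neg_of_neg_of_pos hx hy, mul_neg_of_pos_of_neg hy hx⟩
  rcases lt_or_gt_of_ne ha with ha | ha <;> rcases lt_or_gt_of_ne hb with hb | hb <;>
    rcases lt_or_gt_of_ne hc with hc | hc
  · exact absurd ⟨ha, hb, hc⟩ hneg'
  · exact ⟨c, a, b, e1, (m ha hc).2, (m hb hc).2⟩
  · exact ⟨b, a, c, e2, (m ha hb).2, (m hc hb).2⟩
  · exact ⟨a, b, c, rfl, (m ha hb).1, (m ha hc).1⟩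
  · exact ⟨a, b, c, rfl, (m hb ha).2, (m hc ha).2⟩
  · exact ⟨b, a, c, e2, (m hb ha).1, (m hb hc).1⟩
  · exact ⟨c, a, b, e1, (m hc ha).1, (m hc hb).1⟩
  · exact absurd ⟨ha, hb, hc⟩ hpos'

theorem not_hitAt_of_pos {t : Finset E3} (hpos : ∀ p ∈ t, 0 < θ p) (k : ℝ) : ¬ HitAt θ T ν k t := by
  rintro ⟨z, hz, h0, -⟩
  have hc : Convex ℝ (θ ⁻¹' Set.Ioi 0) := (convex_Ioi 0).affine_preimage θ
  have h : 0 < θ z := convexHull_min (s := (t : Set E3)) (fun p hp => hpos p hp) hc hz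
  exact h.ne' h0

theorem not_hitAt_of_neg {t : Finset E3} (hneg : ∀ p ∈ t, θ p < 0) (k : ℝ) : ¬ HitAt θ T ν k t := by
  rintro ⟨z, hz, h0, -⟩
  have hc : Convex ℝ (θ ⁻¹' Set.Iio 0) := (convex_Iio 0).affine_preimage θ
  have h : θ z < 0 := convexHull_min (s := (t : Set E3)) (fun p hp => hneg p hp) hc hz
  exact h.ne h0

/-- A triangle that misses the interval `ν = 0`, `0 ≤ T ≤ 1` of the plane `θ = 0`. -/
theorem hitAt_add_hitAt {t : Finset E3} (ht : t.card = 3) (h0 : ∀ p ∈ t, θ p ≠ 0)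
    (hne : ∀ z ∈ convexHull ℝ (t : Set E3), θ z = 0 → 0 ≤ T z → T z ≤ 1 → ν z ≠ 0)
    (hT : ∀ p ∈ t, ∀ q ∈ t, θ p * θ q < 0 → T (zeroPoint θ p q) ≠ 0 ∧ T (zeroPoint θ p q) ≠ 1) :
    (if HitAt θ T ν 1 t then 1 else 0 : ZMod 2) + (if HitAt θ T ν 0 t then 1 else 0) =
      stripSum θ T ν t := by
  by_cases hpos : ∀ p ∈ t, 0 < θ p
  · rw [if_neg (not_hitAt_of_pos hpos 1), if_neg (not_hitAt_of_pos hpos 0), add_zero, stripSum]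
    refine (Finset.sum_eq_zero fun p hp => Finset.sum_eq_zero fun q _ => ?_).symm
    rw [if_neg]
    rintro ⟨h, -⟩
    exact lt_asymm h (hpos p hp)
  by_cases hneg : ∀ p ∈ t, θ p < 0
  · rw [if_neg (not_hitAt_of_neg hneg 1), if_neg (not_hitAt_of_neg hneg 0), add_zero, stripSum]
    refine (Finset.sum_eq_zero fun p hp => Finset.sum_eq_zero fun q hq => ?_).symm
    rw [if_neg]
    rintro ⟨-, h⟩
    exact lt_asymm h (hneg q hq)
  obtain ⟨p, q, r, rfl, hq, hr⟩ := exists_separated ht h0 hpos hneg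
  obtain ⟨hpq, hpr, hqr⟩ := SimplicialSurface.ne_of_card_eq_three ht
  obtain ⟨a0, a1⟩ := hT p (by simp) q (by simp) hq
  obtain ⟨b0, b1⟩ := hT p (by simp) r (by simp) hr
  -- The triangle meets the plane in the segment between two zero points, here in the coordinates
  -- `T` and `ν`.
  have := strip_parity (v := ν (zeroPoint θ p q)) (v' := ν (zeroPoint θ p r)) a0 a1 b0 b1 (by
    intro l hl0 hl1 ht0 ht1
    obtain ⟨hz, hz0⟩ := (mem_convexHull_and_eq_zero_iff hq hr).2 ⟨l, hl0, hl1, rfl⟩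
    have := hne _ (by simpa using hz) hz0 (by rwa [affine_combo₂]) (by rwa [affine_combo₂])
    rwa [affine_combo₂] at this)
  rw [stripSum_triple T ν hpq hpr hqr hq hr]
  simp only [hitAt_triple_iff hq hr]
  exact this

end Plane

namespace SimplicialSurface

variable {P : SimplicialSurface}

theorem card_filter_mem_mem {a b : E3} (h : P.Adj a b) :
    ((P.simplices 3).filter fun t => a ∈ t ∧ b ∈ t).card = 2 := by
  obtain ⟨c, d, hcd, hca, hcb, hda, hdb, hc, hd, hall⟩ := h.exists_third
  have : (P.simplices 3).filter (fun t => a ∈ t ∧ b ∈ t) = {{a, b, c}, {a, b, d}} := by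
    ext t
    simp only [Finset.mem_filter, Finset.mem_insert, Finset.mem_singleton]
    constructor
    · rintro ⟨h1, h2, h3⟩
      exact hall t h1 h2 h3
    · rintro (rfl | rfl)
      · exact ⟨hc, by simp, by simp⟩
      · exact ⟨hd, by simp, by simp⟩
  rw [this, Finset.card_pair]
  intro he
  have : c ∈ ({a, b, d} : Finset E3) := he ▸ (by simp)
  simp only [Finset.mem_insert, Finset.mem_singleton] at this
  rcases this with h | h | h <;> contradiction

/-- Every edge is counted twice. -/
theorem sum_stripSum (θ T ν : E3 →ᵃ[ℝ] ℝ) : ∑ t ∈ P.simplices 3, stripSum θ T ν t = 0 := by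
  set g : E3 → E3 → ZMod 2 := fun p q => if θ p < 0 ∧ 0 < θ q then inStrip θ T ν p q else 0 with hg
  have e : ∀ t ∈ P.simplices 3, stripSum θ T ν t =
      ∑ p ∈ P.verts, ∑ q ∈ P.verts, if p ∈ t ∧ q ∈ t then g p q else 0 := by
    intro t ht
    have hsub : t ⊆ P.verts := fun x hx => mem_verts_of_mem (mem_simplices.1 ht).1 hx
    have h1 : ∀ f : E3 → ZMod 2, ∑ p ∈ t, f p = ∑ p ∈ P.verts, if p ∈ t then f p else 0 := by
      intro f
      rw [Finset.sum_ite_mem, Finset.inter_eq_right.2 hsub]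
    rw [stripSum, h1]
    refine Finset.sum_congr rfl fun p _ => ?_
    split_ifs with hp
    · rw [h1]
      refine Finset.sum_congr rfl fun q _ => ?_
      simp [hp, hg]
    · simp [hp]
  rw [Finset.sum_congr rfl e, Finset.sum_comm]
  refine Finset.sum_eq_zero fun p _ => ?_
  rw [Finset.sum_comm]
  refine Finset.sum_eq_zero fun q _ => ?_
  rw [← Finset.sum_filter, Finset.sum_const]
  by_cases hpq : p = q
  · have : g p q = 0 := by
      simp only [hg]
      rw [if_neg]
      rintro ⟨h1, h2⟩
      rw [hpq] at h1
      exact lt_asymm h1 h2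
    rw [this, smul_zero]
  by_cases hadj : P.Adj p q
  · rw [card_filter_mem_mem hadj, two_nsmul]
    exact CharTwo.add_self_eq_zero _
  · rw [Finset.card_eq_zero.2, zero_smul]
    rw [Finset.filter_eq_empty_iff]
    rintro t ht ⟨h1, h2⟩
    exact hadj (adj_of_mem (mem_simplices.1 ht).1 h1 h2 hpq)

end SimplicialSurface

/-! ### Orientability by counting triangles above generic points -/

open Filter Topology

/-- Finitely many planes have a dense complement. -/
theorem frequently_inner_sub_ne_zero {s : Set (E3 × E3)} (hs : s.Finite) (h : ∀ d ∈ s, d.1 ≠ 0)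
    (x : E3) : ∃ᶠ u in 𝓝 x, ∀ d ∈ s, inner ℝ d.1 (u - d.2) ≠ 0 := by
  have hd : Dense (⋂ d ∈ s, {u : E3 | inner ℝ d.1 (u - d.2) ≠ 0}) := by
    refine dense_biInter_of_isOpen (fun d _ => isOpen_ne.preimage (by fun_prop)) hs.countable ?_
    intro d hd
    have hsurj : Function.Surjective (innerSL ℝ d.1 : E3 →L[ℝ] ℝ) := by
      refine ((innerSL ℝ d.1 : E3 →L[ℝ] ℝ) : E3 →ₗ[ℝ] ℝ).surjective fun h0 => h d hd ?_
      have := LinearMap.congr_fun h0 d.1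
      simpa using this
    have hopen := (innerSL ℝ d.1 : E3 →L[ℝ] ℝ).isOpenMap hsurj
    have := (dense_compl_singleton (inner ℝ d.1 d.2 : ℝ)).preimage hopen
    have hset : {u : E3 | inner ℝ d.1 (u - d.2) ≠ 0} =
        (innerSL ℝ d.1 : E3 →L[ℝ] ℝ) ⁻¹' {(inner ℝ d.1 d.2 : ℝ)}ᶜ := Set.ext fun u => by
      rw [Set.mem_preimage, Set.mem_compl_singleton_iff, innerSL_apply_apply]
      exact (by rw [inner_sub_right, sub_ne_zero] :
        inner ℝ d.1 (u - d.2) ≠ 0 ↔ (inner ℝ d.1 u : ℝ) ≠ inner ℝ d.1 d.2)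
    rw [hset]
    exact this
  have := mem_closure_iff_frequently.1 (hd x)
  simpa using this

theorem exists_eq_smul_of_cross_eq_zero {x y : E3} (h : cross x y = 0) (hy : y ≠ 0) :
    ∃ k : ℝ, x = k • y := by
  have e : cross y (cross x y) = (inner ℝ y y) • x - (inner ℝ x y) • y := by
    simp only [inner_eq]
    apply ext_three <;> simp <;> ring
  have h0 : cross y 0 = 0 := by apply ext_three <;> simp
  rw [h, h0] at e
  have hyy : (inner ℝ y y : ℝ) ≠ 0 := inner_self_ne_zero.2 hy
  refine ⟨inner ℝ x y / inner ℝ y y, ?_⟩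
  rw [div_eq_inv_mul, mul_smul, ← sub_eq_zero.1 e.symm, smul_smul, inv_mul_cancel₀ hyy, one_smul]

/-- The affine function `z ↦ ⟨n, z - x₀⟩`. -/
def affineForm (n x₀ : E3) : E3 →ᵃ[ℝ] ℝ where
  toFun z := inner ℝ n (z - x₀)
  linear := ((innerSL ℝ n : E3 →L[ℝ] ℝ) : E3 →ₗ[ℝ] ℝ)
  map_vadd' p v := by simp [inner_add_right, inner_sub_right]; ring

@[simp] theorem affineForm_apply (n x₀ z : E3) : affineForm n x₀ z = inner ℝ n (z - x₀) := rfl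

/-- The ray from `x` in direction `w` meets the triangle `t`. -/
def Hits (w x : E3) (t : Finset E3) : Prop := ∃ s : ℝ, 0 < s ∧ x + s • w ∈ convexHull ℝ (t : Set E3)

namespace SimplicialSurface

variable {P : SimplicialSurface}

/-- `w` lies in no plane parallel to two differences of vertices. -/
def IsGenericDir (P : SimplicialSurface) (w : E3) : Prop :=
  ∀ a ∈ P.verts, ∀ b ∈ P.verts, ∀ c ∈ P.verts, ∀ d ∈ P.verts,
    cross (b - a) (d - c) ≠ 0 → inner ℝ w (cross (b - a) (d - c)) ≠ 0

theorem exists_isGenericDir (P : SimplicialSurface) : ∃ w, P.IsGenericDir w := by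
  set S : Set E3 := {e | e ≠ 0 ∧ ∃ x ∈ (P.verts ×ˢ P.verts) ×ˢ (P.verts ×ˢ P.verts),
    e = cross (x.1.2 - x.1.1) (x.2.2 - x.2.1)} with hS
  have hSf : S.Finite := by
    refine (((P.verts ×ˢ P.verts) ×ˢ (P.verts ×ˢ P.verts)).finite_toSet.image fun x =>
      cross (x.1.2 - x.1.1) (x.2.2 - x.2.1)).subset ?_
    rintro e ⟨-, x, hx, rfl⟩
    exact ⟨x, hx, rfl⟩
  obtain ⟨w, hw⟩ := (frequently_inner_ne_zero hSf (fun d hd => hd.1) 0).exists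
  exact ⟨w, fun a ha b hb c hc d hd h => hw _ ⟨h, ((a, b), (c, d)), by simp [ha, hb, hc, hd], rfl⟩⟩

theorem IsGenericDir.inner_ne_zero {w : E3} (hw : P.IsGenericDir w) {a b c : E3}
    (h : ({a, b, c} : Finset E3) ∈ P.simplices 3) : inner ℝ w (cross (b - a) (c - a)) ≠ 0 := by
  have h' := mem_simplices.1 h
  refine hw a ?_ b ?_ a ?_ c ?_ (cross_ne_zero_of_face h'.1 h'.2) <;>
    exact mem_verts_of_mem h'.1 (by simp)

theorem IsGenericDir.cross_ne_zero {w : E3} (hw : P.IsGenericDir w) {a b : E3} (h : P.Adj a b) :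
    cross (b - a) w ≠ 0 := by
  obtain ⟨c, -, -, -, -, -, -, hc, -⟩ := h.exists_third
  intro h0
  apply hw.inner_ne_zero hc
  have : inner ℝ w (cross (b - a) (c - a)) = -inner ℝ (cross (b - a) w) (c - a) := by
    simp only [inner_eq]; simp; ring
  rw [this, h0]; simp

/-- A generic interior point of the edge `ab`. -/
structure IsGenericOnEdge (P : SimplicialSurface) (w a b m : E3) : Prop where
  exists_eq : ∃ r : ℝ, 0 < r ∧ r < 1 ∧ m = (1 - r) • a + r • b
  ne : ∀ v ∈ P.verts, v ≠ m
  inner_ne : ∀ p ∈ P.verts, ∀ q ∈ P.verts, inner ℝ (m - p) (cross (q - p) w) = 0 →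
    inner ℝ (a - p) (cross (q - p) w) = 0 ∧ inner ℝ (b - a) (cross (q - p) w) = 0

/-- For each pair of vertices the expression is affine in the position on the edge, so unless it
vanishes along all of the edge it excludes at most one position. -/
theorem exists_isGenericOnEdge (w : E3) {a b : E3} (h : P.Adj a b) :
    ∃ m, P.IsGenericOnEdge w a b m := by
  have key : ∀ x y : ℝ, {r : ℝ | x + r * y = 0 ∧ ¬ (x = 0 ∧ y = 0)}.Finite := by
    intro x y
    refine (Set.finite_singleton (-x / y)).subset ?_
    rintro r ⟨h1, h2⟩
    have hy : y ≠ 0 := by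
      rintro rfl
      exact h2 ⟨by simpa using h1, rfl⟩
    rw [Set.mem_singleton_iff, eq_div_iff hy]
    linarith
  have hinj : Function.Injective fun r : ℝ => a + r • (b - a) := by
    intro r r' hr
    exact smul_left_injective ℝ (sub_ne_zero.2 h.1.symm) (add_left_cancel hr)
  set B : Set ℝ := (⋃ x ∈ P.verts ×ˢ P.verts,
    {r : ℝ | inner ℝ (a - x.1) (cross (x.2 - x.1) w) + r * inner ℝ (b - a) (cross (x.2 - x.1) w) = 0 ∧
      ¬ (inner ℝ (a - x.1) (cross (x.2 - x.1) w) = 0 ∧ inner ℝ (b - a) (cross (x.2 - x.1) w) = 0)}) ∪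
    (fun r : ℝ => a + r • (b - a)) ⁻¹' (P.verts : Set E3) with hB
  have hBf : B.Finite := by
    refine Set.Finite.union ?_ (P.verts.finite_toSet.preimage hinj.injOn)
    exact Set.Finite.biUnion (P.verts ×ˢ P.verts).finite_toSet fun x _ => key _ _
  obtain ⟨r, ⟨hr0, hr1⟩, hrB⟩ := (Set.Ioo_infinite (zero_lt_one (α := ℝ))).exists_notMem_finite hBf
  have e : (1 - r) • a + r • b = a + r • (b - a) := by module
  refine ⟨(1 - r) • a + r • b, ⟨r, hr0, hr1, rfl⟩, ?_, ?_⟩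
  · rintro v hv rfl
    exact hrB (Or.inr (by simpa [e] using hv))
  · intro p hp q hq h0
    by_contra hcon
    refine hrB (Or.inl (Set.mem_biUnion (x := (p, q)) (by simp [hp, hq]) ⟨?_, hcon⟩))
    have e' : (1 - r) • a + r • b - p = (a - p) + r • (b - a) := by module
    rw [e', inner_add_left, inner_smul_left] at h0
    simpa using h0

/-- A vertex on the line through `m` in direction `w` would put `w` into the plane of `a`, `b`, `v`
or, if these are collinear, make the edge parallel to `w`. -/
theorem IsGenericOnEdge.cross_ne_zero {w a b m v : E3} (hm : P.IsGenericOnEdge w a b m)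
    (hw : P.IsGenericDir w) (h : P.Adj a b) (hv : v ∈ P.verts) : cross w (v - m) ≠ 0 := by
  intro h0
  obtain ⟨k, hk⟩ := exists_eq_smul_of_cross_eq_zero h0 (sub_ne_zero.2 (hm.ne v hv))
  obtain ⟨r, -, -, hr⟩ := hm.exists_eq
  have e : v - m = (v - a) - r • (b - a) := by rw [hr]; module
  have hz : inner ℝ w (cross (b - a) (v - a)) = 0 := by
    rw [hk, e]
    simp only [inner_eq]; simp; ring
  have hc : cross (b - a) (v - a) = 0 := by
    by_contra hc
    exact hw a h.mem_left b h.mem_right a h.mem_left v hv hc hz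
  have : cross (b - a) w = 0 := by
    have e2 : cross (b - a) w = k • cross (b - a) (v - a) := by
      rw [hk, e]
      apply ext_three <;> simp <;> ring
    rw [e2, hc, smul_zero]
  exact hw.cross_ne_zero h this

/-- A generic interior point of the triangle `f`. -/
structure IsGenericOnTriangle (P : SimplicialSurface) (w : E3) (m : E3 → E3 → E3) (f : Finset E3)
    (y : E3) : Prop where
  exists_eq : ∃ r : E3 → ℝ, (∀ v ∈ f, 0 < r v) ∧ ∑ v ∈ f, r v = 1 ∧ y = ∑ v ∈ f, r v • v
  inner_ne : ∀ p q, P.Adj p q → inner ℝ (y - p) (cross (q - p) w) ≠ 0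
  inner_cross_ne : ∀ a b, P.Adj a b → ∀ v ∈ P.verts, inner ℝ (cross (m a b - y) w) (v - y) ≠ 0

/-- The conditions to be avoided do not change when `y` moves along `w`. So a generic point of space
near the centroid is chosen and moved along `w` into the triangle. -/
theorem exists_isGenericOnTriangle {w : E3} (hw : P.IsGenericDir w) {m : E3 → E3 → E3}
    (hm : ∀ a b, P.Adj a b → P.IsGenericOnEdge w a b (m a b)) {f : Finset E3}
    (hf : f ∈ P.simplices 3) : ∃ y, P.IsGenericOnTriangle w m f y := by
  obtain ⟨a, b, c, hab, hac, hbc, rfl⟩ := Finset.card_eq_three.1 (mem_simplices.1 hf).2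
  set S₁ : Set (E3 × E3) := {d | ∃ x ∈ P.verts ×ˢ P.verts, P.Adj x.1 x.2 ∧
    d = (cross (x.2 - x.1) w, x.1)} with hS₁
  set S₂ : Set (E3 × E3) := {d | ∃ x ∈ (P.verts ×ˢ P.verts) ×ˢ P.verts, P.Adj x.1.1 x.1.2 ∧
    d = (cross w (x.2 - m x.1.1 x.1.2), m x.1.1 x.1.2)} with hS₂
  have hf₁ : S₁.Finite := by
    refine ((P.verts ×ˢ P.verts).finite_toSet.image fun x => (cross (x.2 - x.1) w, x.1)).subset ?_
    rintro e ⟨x, hx, -, rfl⟩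
    exact ⟨x, hx, rfl⟩
  have hf₂ : S₂.Finite := by
    refine (((P.verts ×ˢ P.verts) ×ˢ P.verts).finite_toSet.image fun x =>
      (cross w (x.2 - m x.1.1 x.1.2), m x.1.1 x.1.2)).subset ?_
    rintro e ⟨x, hx, -, rfl⟩
    exact ⟨x, hx, rfl⟩
  have hD := hw.inner_ne_zero hf
  set D : ℝ := inner ℝ w (cross (b - a) (c - a)) with hDdef
  set g : E3 := a + (3⁻¹ : ℝ) • (b - a) + (3⁻¹ : ℝ) • (c - a) with hg
  -- Barycentric coordinates of the projection along `w` to the plane of the triangle; they equal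
  -- 1/3 at the centroid `g` and stay positive nearby.
  set β : E3 → ℝ := fun u => inner ℝ (cross (c - a) w) (u - a) / D with hβ
  set γ : E3 → ℝ := fun u => inner ℝ (cross w (b - a)) (u - a) / D with hγ
  have hβc : Continuous β := by simp only [hβ]; fun_prop
  have hγc : Continuous γ := by simp only [hγ]; fun_prop
  have hβg : β g = 3⁻¹ := by
    simp only [hβ]
    rw [div_eq_iff hD, hDdef, hg]
    simp only [inner_eq]; simp; ring
  have hγg : γ g = 3⁻¹ := by
    simp only [hγ]
    rw [div_eq_iff hD, hDdef, hg]
    simp only [inner_eq]; simp; ring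
  have ev1 : ∀ᶠ u in 𝓝 g, 0 < β u := hβc.continuousAt.eventually_const_lt (by rw [hβg]; norm_num)
  have ev2 : ∀ᶠ u in 𝓝 g, 0 < γ u := hγc.continuousAt.eventually_const_lt (by rw [hγg]; norm_num)
  have ev3 : ∀ᶠ u in 𝓝 g, β u + γ u < 1 :=
    (hβc.add hγc).continuousAt.eventually_lt_const (by
      simp only [Pi.add_apply]; rw [hβg, hγg]; norm_num)
  obtain ⟨u, hu, h1, h2, h3⟩ := ((frequently_inner_sub_ne_zero (hf₁.union hf₂) (by
    rintro d (⟨x, -, hx, rfl⟩ | ⟨x, hx, hx', rfl⟩)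
    · exact hw.cross_ne_zero hx
    · exact (hm _ _ hx').cross_ne_zero hw hx' (Finset.mem_product.1 hx).2) g).and_eventually
      (ev1.and (ev2.and ev3))).exists
  set κ : ℝ := inner ℝ (cross (b - a) (c - a)) (u - a) / D with hκ
  have hy : u = (1 - β u - γ u) • a + β u • b + γ u • c + κ • w := by
    have h4 := inner_cross_smul_add_add (b - a) (c - a) w (u - a)
    have e1 : inner ℝ (cross (b - a) (c - a)) w = D := by rw [real_inner_comm]
    have e2 : (D * β u) • (b - a) + (D * γ u) • (c - a) + (D * κ) • w = D • (u - a) := by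
      rw [← e1, ← h4, e1]
      simp only [hβ, hγ, hκ]
      rw [mul_div_cancel₀ _ hD, mul_div_cancel₀ _ hD, mul_div_cancel₀ _ hD]
    have e3 : D • (β u • (b - a) + γ u • (c - a) + κ • w) = D • (u - a) := by
      rw [← e2]; module
    have e4 := smul_right_injective _ hD e3
    have e5 : (1 - β u - γ u) • a + β u • b + γ u • c + κ • w =
        a + (β u • (b - a) + γ u • (c - a) + κ • w) := by module
    rw [e5, e4]
    abel
  set y : E3 := (1 - β u - γ u) • a + β u • b + γ u • c with hydef
  have hyu : y = u - κ • w := by rw [hy]; simp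
  have hsum : ∀ {M : Type} [AddCommMonoid M] (f : E3 → M), ∑ y ∈ ({a, b, c} : Finset E3), f y =
      f a + (f b + f c) := by
    intro M _ f
    rw [Finset.sum_insert (by simp [hab, hac]), Finset.sum_pair hbc]
  refine ⟨y, ⟨fun v => if v = a then 1 - β u - γ u else if v = b then β u else γ u, ?_, ?_, ?_⟩, ?_, ?_⟩
  · intro v _
    beta_reduce
    split_ifs
    · linarith
    · exact h1
    · exact h2
  · rw [hsum]
    simp only [if_true, hab.symm, hac.symm, hbc.symm, if_false]
    ring
  · rw [hsum]
    simp only [if_true, hab.symm, hac.symm, hbc.symm, if_false]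
    rw [← add_assoc]
  · intro p q hpq
    have h4 := hu _ (Or.inl ⟨(p, q), by simp [hpq.mem_left, hpq.mem_right], hpq, rfl⟩)
    have e : y - p = (u - p) - κ • w := by rw [hyu]; abel
    rw [e, inner_sub_left, inner_smul_left, real_inner_comm _ w, inner_cross_right_self]
    rw [real_inner_comm] at h4
    simpa using h4
  · intro a' b' hab' v hv
    have h4 := hu _ (Or.inr ⟨((a', b'), v), by simp [hab'.mem_left, hab'.mem_right, hv], hab', rfl⟩)
    have e : inner ℝ (cross (m a' b' - y) w) (v - y) =
        -inner ℝ (cross w (v - m a' b')) (u - m a' b') := by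
      rw [hyu]
      simp only [inner_eq]; simp; ring
    rw [e]
    exact neg_ne_zero.2 h4

end SimplicialSurface

/-- A triangle with an edge through the foot of one of the rays. -/
theorem hitAt_add_stripSum {θ T ν : E3 →ᵃ[ℝ] ℝ} {p q d : E3} (hpq : p ≠ q) (hpd : p ≠ d) (hqd : q ≠ d)
    (hTp : T p = 0) (hTq : T q = 0) (hνp : ν p = 0) (hνq : ν q = 0) (hlt : θ p * θ q < 0)
    (hlt' : θ p * θ d < 0) (hT1 : T (zeroPoint θ p d) ≠ 1) :
    (if HitAt θ T ν 1 {p, q, d} then 1 else 0 : ZMod 2) + stripSum θ T ν {p, q, d} =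
      if 0 < T d ∧ 0 < ν d then 1 else 0 := by
  rw [stripSum_triple T ν hpq hpd hqd hlt hlt']
  obtain ⟨k, -, -, hk, -⟩ := exists_zeroPoint_eq hlt
  obtain ⟨l, hl0, hl1, hz', -⟩ := exists_zeroPoint_eq hlt'
  have TM : T (zeroPoint θ p q) = 0 := by rw [hk, affine_combo₂, hTp, hTq]; ring
  have νM : ν (zeroPoint θ p q) = 0 := by rw [hk, affine_combo₂, hνp, hνq]; ring
  have Tz : T (zeroPoint θ p d) = l * T d := by rw [hz', affine_combo₂, hTp]; ring
  have νz : ν (zeroPoint θ p d) = l * ν d := by rw [hz', affine_combo₂, hνp]; ring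
  have h2 : 0 < T d ↔ 0 < T (zeroPoint θ p d) := by rw [Tz, mul_pos_iff_of_pos_left hl0]
  have h3 : 0 < ν d ↔ 0 < ν (zeroPoint θ p d) := by rw [νz, mul_pos_iff_of_pos_left hl0]
  rw [hitAt_triple_iff hlt hlt', inStrip, inStrip, TM, νM]
  simp only [h2, h3]
  generalize T (zeroPoint θ p d) = t at *
  generalize ν (zeroPoint θ p d) = v at *
  clear hz' hk TM νM Tz νz h2 h3
  have h1 : (∃ l' : ℝ, 0 ≤ l' ∧ l' ≤ 1 ∧ (1 - l') * 0 + l' * t = 1 ∧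
      0 < (1 - l') * 0 + l' * v) ↔ 1 < t ∧ 0 < v := by
    constructor
    · rintro ⟨l', a1, a2, a3, a4⟩
      rw [mul_zero, zero_add] at a3 a4
      have hl' : 0 < l' := by
        rcases a1.eq_or_lt with rfl | h
        · simp at a3
        · exact h
      refine ⟨lt_of_le_of_ne ?_ hT1.symm, (mul_pos_iff_of_pos_left hl').1 a4⟩
      by_contra hcon
      have := mul_lt_mul_of_pos_left (not_le.1 hcon) hl'
      linarith
    · rintro ⟨a1, a2⟩
      have hpos : 0 < t := by linarith
      refine ⟨t⁻¹, by positivity, inv_le_one_of_one_le₀ a1.le, ?_, ?_⟩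
      · rw [mul_zero, zero_add, inv_mul_cancel₀ hpos.ne']
      · rw [mul_zero, zero_add]; positivity
  simp only [h1]
  by_cases hν0 : 0 < v
  · rcases lt_or_gt_of_ne hT1 with h | h
    · simp [hν0, h, h.le, not_lt.2]
    · simp [hν0, h, h.le, not_lt.2, zero_lt_one.trans h]
  · simp [hν0]

namespace SimplicialSurface

variable {P : SimplicialSurface}

theorem eq_or_eq_of_mem {a b c d : E3} (hc : ({a, b, c} : Finset E3) ∈ P.simplices 3)
    (hd : ({a, b, d} : Finset E3) ∈ P.simplices 3) (hcd : c ≠ d) {t : Finset E3}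
    (ht : t ∈ P.simplices 3) (ha : a ∈ t) (hb : b ∈ t) : t = {a, b, c} ∨ t = {a, b, d} := by
  obtain ⟨hab, hac, hbc⟩ := ne_of_card_eq_three (mem_simplices.1 hc).2
  have hadj : P.Adj a b := adj_of_mem (mem_simplices.1 hc).1 (by simp) (by simp) hab
  have hne : ({a, b, c} : Finset E3) ≠ {a, b, d} := by
    intro he
    have : c ∈ ({a, b, d} : Finset E3) := he ▸ (by simp)
    simp only [Finset.mem_insert, Finset.mem_singleton] at this
    rcases this with h | h | h
    · exact hac h.symm
    · exact hbc h.symm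
    · exact hcd h
  have hsub : ({{a, b, c}, {a, b, d}} : Finset (Finset E3)) ⊆
      (P.simplices 3).filter fun t => a ∈ t ∧ b ∈ t := by
    intro s hs
    simp only [Finset.mem_insert, Finset.mem_singleton] at hs
    rcases hs with rfl | rfl
    · exact Finset.mem_filter.2 ⟨hc, by simp, by simp⟩
    · exact Finset.mem_filter.2 ⟨hd, by simp, by simp⟩
  have heq := Finset.eq_of_subset_of_card_le hsub
    (by rw [card_filter_mem_mem hadj, Finset.card_pair hne])
  have : t ∈ ({{a, b, c}, {a, b, d}} : Finset (Finset E3)) := heq ▸ Finset.mem_filter.2 ⟨ht, ha, hb⟩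
  simpa using this

theorem mem_of_mem_convexHull {a b : E3} (h : P.Adj a b) {t : Finset E3} (ht : t ∈ P.faces) {r : ℝ}
    (hr0 : 0 < r) (hr1 : r < 1) (hz : (1 - r) • a + r • b ∈ convexHull ℝ (t : Set E3)) :
    a ∈ t ∧ b ∈ t := by
  have := subset_of_mem_convexHull h.2 ht (w := fun v => if v = a then 1 - r else r) (by
      intro v _
      beta_reduce
      split_ifs <;> linarith) (by rw [Finset.sum_pair h.1]; simp [h.1.symm]) (by
      rw [Finset.sum_pair h.1]; simpa [h.1.symm] using hz)
  exact ⟨this (by simp), this (by simp)⟩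

set_option maxHeartbeats 1000000 in
/-- Moving from a point of a triangle to a point of one of its edges, the number of triangles above
changes only due to the neighbouring triangle. -/
theorem sum_hits {w : E3} (hw : P.IsGenericDir w) {m : E3 → E3 → E3} {a b c d y : E3}
    (hc : ({a, b, c} : Finset E3) ∈ P.simplices 3) (hd : ({a, b, d} : Finset E3) ∈ P.simplices 3)
    (hcd : c ≠ d) (hm : P.IsGenericOnEdge w a b (m a b))
    (hy : P.IsGenericOnTriangle w m {a, b, c} y) :
    ∑ t ∈ (P.simplices 3).erase {a, b, c}, (if Hits w y t then 1 else 0 : ZMod 2) =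
      ∑ t ∈ ((P.simplices 3).erase {a, b, c}).erase {a, b, d},
        (if Hits w (m a b) t then 1 else 0 : ZMod 2) +
      if 0 < inner ℝ w (cross (b - a) (c - a)) * inner ℝ w (cross (b - a) (d - a)) ∧
        0 < inner ℝ w (cross (b - a) (c - a)) * inner ℝ (cross (b - a) (c - a)) (d - a)
        then 1 else 0 := by
  have hcf := mem_simplices.1 hc
  have hdf := mem_simplices.1 hd
  obtain ⟨hab, hac, hbc⟩ := ne_of_card_eq_three hcf.2
  obtain ⟨-, had, hbd⟩ := ne_of_card_eq_three hdf.2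
  have hadj : P.Adj a b := adj_of_mem hcf.1 (by simp) (by simp) hab
  have hav := hadj.mem_left
  have hbv := hadj.mem_right
  have hne : ({a, b, d} : Finset E3) ≠ {a, b, c} := by
    intro he
    have : d ∈ ({a, b, c} : Finset E3) := he ▸ (by simp)
    simp only [Finset.mem_insert, Finset.mem_singleton] at this
    rcases this with h | h | h
    · exact had h.symm
    · exact hbd h.symm
    · exact hcd h.symm
  obtain ⟨r, hr0, hr1, hM⟩ := hm.exists_eq
  set M := m a b with hMdef
  have hyint := hy.inner_ne
  have hplane := hy.inner_cross_ne a b hadj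
  rw [← hMdef] at hplane
  obtain ⟨wt, hwt, hwt1, hyw⟩ := hy.exists_eq
  rw [Finset.sum_insert (by simp [hab, hac]), Finset.sum_pair hbc, ← add_assoc] at hwt1 hyw
  have hα : 0 < wt a := hwt a (by simp)
  have hβ : 0 < wt b := hwt b (by simp)
  have hγ : 0 < wt c := hwt c (by simp)
  set α := wt a
  set β := wt b
  set γ := wt c
  have hD := hw.inner_ne_zero hc
  have hDd := hw.inner_ne_zero hd
  set D : ℝ := inner ℝ w (cross (b - a) (c - a)) with hDdef
  have hγD : γ * D ≠ 0 := mul_ne_zero hγ.ne' hD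
  set n := cross (b - a) (c - a) with hn
  set A := cross (M - y) w with hA
  set B := cross w (b - a) with hB
  -- Affine coordinates: `θ` vanishes on the plane through `M` and `y` parallel to `w`, `T` is 0 at
  -- `M` and, thanks to the factor `γ`, 1 at `y`, and `ν` is the height in direction `w` over the
  -- plane of `a`, `b`, `c`.
  set θ := affineForm A y with hθ
  set T := affineForm ((γ * D)⁻¹ • B) a with hT
  set ν := affineForm (D⁻¹ • n) a with hν
  have Tx : ∀ x, T x = (γ * D)⁻¹ * inner ℝ w (cross (b - a) (x - a)) := by
    intro x
    rw [hT, affineForm_apply, inner_smul_left, hB, inner_cross_rotate, real_inner_comm]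
    rfl
  have νx : ∀ x, ν x = D⁻¹ * inner ℝ n (x - a) := by
    intro x
    rw [hν, affineForm_apply, inner_smul_left]
    rfl
  have Ta : T a = 0 := by rw [Tx]; simp [inner_eq]
  have Tb : T b = 0 := by
    have : cross (b - a) (b - a) = 0 := by apply ext_three <;> simp <;> ring
    rw [Tx, this]; simp
  have Tc : T c = γ⁻¹ := by rw [Tx, ← hDdef, mul_inv, mul_assoc, inv_mul_cancel₀ hD, mul_one]
  have νa : ν a = 0 := by rw [νx]; simp
  have νb : ν b = 0 := by rw [νx, hn, inner_cross_left_self, mul_zero]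
  have νc : ν c = 0 := by rw [νx, hn, inner_cross_right_self, mul_zero]
  have Ty : T y = 1 := by
    rw [hyw, affine_combo₃ T hwt1, Ta, Tb, Tc, mul_inv_cancel₀ hγ.ne']; ring
  have TM : T M = 0 := by rw [hM, affine_combo₂, Ta, Tb]; ring
  have νy : ν y = 0 := by rw [hyw, affine_combo₃ ν hwt1, νa, νb, νc]; ring
  have νM : ν M = 0 := by rw [hM, affine_combo₂, νa, νb]; ring
  have θy : θ y = 0 := by rw [hθ, affineForm_apply, sub_self, inner_zero_right]
  have θM : θ M = 0 := by rw [hθ, affineForm_apply, hA, inner_cross_left_self]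
  have hAba : inner ℝ A (b - a) ≠ 0 := by
    intro h0
    have h1 : T M - T y = (γ * D)⁻¹ * inner ℝ A (b - a) := by
      rw [Tx, Tx, ← mul_sub]
      congr 1
      rw [hA]
      simp only [inner_eq]; simp; ring
    rw [TM, Ty, h0] at h1
    norm_num at h1
  have inj : ∀ u u', θ u = θ u' → T u = T u' → ν u = ν u' → u = u' := by
    intro u u' h1 h2 h3
    have e1 : inner ℝ A (u - u') = 0 := by
      have : u - u' = (u - y) - (u' - y) := by abel
      rw [this, inner_sub_right]
      exact sub_eq_zero.2 h1
    have e2 : inner ℝ B (u - u') = 0 := by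
      have e : u - u' = (u - a) - (u' - a) := by abel
      rw [hT, affineForm_apply, affineForm_apply, inner_smul_left, inner_smul_left] at h2
      rw [e, inner_sub_right, mul_left_cancel₀ (by simpa using inv_ne_zero hγD) h2, sub_self]
    have e3 : inner ℝ n (u - u') = 0 := by
      have e : u - u' = (u - a) - (u' - a) := by abel
      rw [νx, νx] at h3
      rw [e, inner_sub_right, mul_left_cancel₀ (inv_ne_zero hD) h3, sub_self]
    have h4 := inner_cross_smul_eq A B n (u - u')
    rw [e1, e2, e3, hA, hB, cross_cross_cross, inner_smul_left, zero_smul, zero_smul, zero_smul,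
      add_zero, add_zero] at h4
    exact sub_eq_zero.1 ((smul_eq_zero.1 h4).resolve_left (mul_ne_zero hAba hD))
  have shift : ∀ z (s : ℝ), θ (z + s • w) = θ z ∧ T (z + s • w) = T z ∧ ν (z + s • w) = ν z + s := by
    intro z s
    refine ⟨?_, ?_, ?_⟩
    · have e : z + s • w - y = (z - y) + s • w := by abel
      rw [hθ, affineForm_apply, affineForm_apply, e, inner_add_right, inner_smul_right, hA,
        inner_cross_right_self, mul_zero, add_zero]
    · rw [Tx, Tx]
      congr 1
      simp only [inner_eq]; simp; ring
    · have e : z + s • w - a = (z - a) + s • w := by abel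
      rw [νx, νx, e, inner_add_right, inner_smul_right, real_inner_comm w n, ← hDdef]
      field_simp
  have ray : ∀ x z, θ x = 0 → ν x = 0 → θ z = 0 → T z = T x → x + ν z • w = z := by
    intro x z h1 h2 h3 h4
    obtain ⟨s1, s2, s3⟩ := shift x (ν z)
    exact inj _ _ (by rw [s1, h1, h3]) (by rw [s2, h4]) (by rw [s3, h2, zero_add])
  have hits_iff : ∀ x t, θ x = 0 → ν x = 0 → (Hits w x t ↔ HitAt θ T ν (T x) t) := by
    intro x t h1 h2
    constructor
    · rintro ⟨s, hs, hz⟩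
      obtain ⟨s1, s2, s3⟩ := shift x s
      exact ⟨_, hz, by rw [s1, h1], s2, by rw [s3, h2, zero_add]; exact hs⟩
    · rintro ⟨z, hz, h3, h4, h5⟩
      exact ⟨ν z, h5, by rwa [ray x z h1 h2 h3 h4]⟩
  have hits_y : ∀ t, Hits w y t ↔ HitAt θ T ν 1 t := fun t => by rw [hits_iff y t θy νy, Ty]
  have hits_M : ∀ t, Hits w M t ↔ HitAt θ T ν 0 t := fun t => by rw [hits_iff M t θM νM, TM]
  have hθv : ∀ v ∈ P.verts, θ v ≠ 0 := fun v hv => hplane v hv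
  -- crossings of edges with the plane avoid the rays
  have hT1 : ∀ p q, P.Adj p q → θ p * θ q < 0 → T (zeroPoint θ p q) ≠ 1 := by
    intro p q hpq hlt h1
    obtain ⟨l, -, -, hz, hz0⟩ := exists_zeroPoint_eq hlt
    have hθz : θ (zeroPoint θ p q) = 0 := by rw [hz, affine_combo₂, hz0]
    have hr := ray y _ θy νy hθz (by rw [h1, Ty])
    apply hyint p q hpq
    have e : y - p = l • (q - p) - ν (zeroPoint θ p q) • w := by
      have : y = zeroPoint θ p q - ν (zeroPoint θ p q) • w := by rw [eq_sub_iff_add_eq, hr]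
      rw [this]
      nth_rw 1 [hz]
      module
    rw [e, inner_sub_left, inner_smul_left, inner_smul_left, real_inner_comm, inner_cross_left_self,
      real_inner_comm, inner_cross_right_self]
    simp
  -- By the choice of `M`, an edge that meets the line through `M` along `w` is collinear with `ab`,
  -- so it meets this line in `M` itself.
  have hT0 : ∀ p q, P.Adj p q → θ p * θ q < 0 → T (zeroPoint θ p q) = 0 → zeroPoint θ p q = M := by
    intro p q hpq hlt h1
    obtain ⟨l, -, -, hz, hz0⟩ := exists_zeroPoint_eq hlt
    have hθz : θ (zeroPoint θ p q) = 0 := by rw [hz, affine_combo₂, hz0]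
    have hr := ray M _ θM νM hθz (by rw [h1, TM])
    have hp := hpq.mem_left
    have hq := hpq.mem_right
    obtain ⟨g1, g2⟩ := hm.inner_ne p hp q hq (by
      have e : M - p = l • (q - p) - ν (zeroPoint θ p q) • w := by
        have : M = zeroPoint θ p q - ν (zeroPoint θ p q) • w := by rw [eq_sub_iff_add_eq, hr]
        rw [this]
        nth_rw 1 [hz]
        module
      rw [e, inner_sub_left, inner_smul_left, inner_smul_left, real_inner_comm, inner_cross_left_self,
        real_inner_comm, inner_cross_right_self]
      simp)
    have hrot : ∀ x, inner ℝ x (cross (q - p) w) = inner ℝ w (cross x (q - p)) := by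
      intro x; simp only [inner_eq]; simp; ring
    rw [hrot] at g1 g2
    have c1 : cross (a - p) (q - p) = 0 := by
      by_contra h; exact hw p hp a hav p hp q hq h g1
    have c2 : cross (b - a) (q - p) = 0 := by
      by_contra h; exact hw a hav b hbv p hp q hq h g2
    have hqp : q - p ≠ 0 := sub_ne_zero.2 hpq.1.symm
    obtain ⟨k1, hk1⟩ := exists_eq_smul_of_cross_eq_zero c1 hqp
    obtain ⟨k2, hk2⟩ := exists_eq_smul_of_cross_eq_zero c2 hqp
    have hk20 : k2 ≠ 0 := by
      rintro rfl
      rw [zero_smul, sub_eq_zero] at hk2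
      exact hab hk2.symm
    have hnq : inner ℝ n (q - p) = 0 := by
      have h0 : inner ℝ n (b - a) = 0 := inner_cross_left_self _ _
      rw [hk2, inner_smul_right] at h0
      exact (mul_eq_zero.1 h0).resolve_left hk20
    have hν0 : ν (zeroPoint θ p q) = 0 := by
      have e : zeroPoint θ p q - a = (l - k1) • (q - p) := by
        rw [hz, sub_smul l, ← hk1]; module
      rw [νx, e, inner_smul_right, hnq]; simp
    rw [hν0, zero_smul, add_zero] at hr
    exact hr.symm
  -- the triangles other than the two at the edge
  have hrest : ∀ t ∈ ((P.simplices 3).erase {a, b, c}).erase {a, b, d},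
      (if Hits w y t then 1 else 0 : ZMod 2) + (if Hits w M t then 1 else 0) = stripSum θ T ν t := by
    intro t ht
    simp only [Finset.mem_erase] at ht
    obtain ⟨htd, htc, htS⟩ := ht
    have htf := mem_simplices.1 htS
    have hMt : M ∉ convexHull ℝ (t : Set E3) := by
      intro h
      rw [hM] at h
      obtain ⟨h1, h2⟩ := mem_of_mem_convexHull hadj htf.1 hr0 hr1 h
      rcases eq_or_eq_of_mem hc hd hcd htS h1 h2 with h | h <;> contradiction
    simp only [hits_y, hits_M]
    refine hitAt_add_hitAt htf.2 (fun p hp => hθv p (mem_verts_of_mem htf.1 hp)) ?_ ?_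
    -- Such a point would lie on the segment from `M` to `y`: either at `M`, or in the interior of
    -- the triangle `a b c`.
    · intro z hz h1 h2 h3 h4
      have e : z = (1 - T z) • M + T z • y :=
        inj _ _ (by rw [affine_combo₂, h1, θM, θy]; ring) (by rw [affine_combo₂, TM, Ty]; ring)
          (by rw [affine_combo₂, h4, νM, νy]; ring)
      rcases h2.eq_or_lt with h5 | h5
      · rw [← h5] at e
        simp only [sub_zero, one_smul, zero_smul, add_zero] at e
        exact hMt (e ▸ hz)
      · have e' : z = ((1 - T z) * (1 - r) + T z * α) • a + ((1 - T z) * r + T z * β) • b +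
            (T z * γ) • c := by
          nth_rw 1 [e]
          rw [hM, hyw]
          module
        have g0 : 0 ≤ 1 - T z := by linarith
        have g1 : 0 < 1 - r := by linarith
        rw [e'] at hz
        have hsub := triple_subset_of_mem_convexHull hc htf.1 (by positivity) (by positivity)
          (by positivity) (by linear_combination (T z) * hwt1) hz
        exact htc (Finset.eq_of_subset_of_card_le hsub (by rw [htf.2, hcf.2])).symm
    · intro p hp q hq hlt
      have hpq : P.Adj p q := adj_of_mem htf.1 hp hq (by
        rintro rfl
        nlinarith [mul_self_nonneg (θ p)])
      refine ⟨fun h0 => hMt ?_, hT1 p q hpq hlt⟩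
      rw [← hT0 p q hpq hlt h0]
      obtain ⟨l, hl0, hl1, hz, -⟩ := exists_zeroPoint_eq hlt
      rw [hz]
      exact (convex_convexHull ℝ _) (subset_convexHull ℝ _ hp) (subset_convexHull ℝ _ hq)
        (by linarith) hl0.le (by ring)
  -- the triangle itself
  have hself : stripSum θ T ν {a, b, c} = 0 := by
    refine Finset.sum_eq_zero fun p hp => Finset.sum_eq_zero fun q hq => ?_
    split_ifs with h
    · obtain ⟨l, -, -, hz, -⟩ := exists_zeroPoint_eq (mul_neg_of_neg_of_pos h.1 h.2)
      have hν0 : ∀ x ∈ ({a, b, c} : Finset E3), ν x = 0 := by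
        intro x hx
        simp only [Finset.mem_insert, Finset.mem_singleton] at hx
        rcases hx with rfl | rfl | rfl <;> assumption
      rw [inStrip, if_neg]
      rintro ⟨-, -, h3⟩
      rw [hz, affine_combo₂, hν0 p hp, hν0 q hq] at h3
      simp at h3
    · rfl
  -- the neighbouring triangle
  have hnb : (if Hits w y {a, b, d} then 1 else 0 : ZMod 2) + stripSum θ T ν {a, b, d} =
      if 0 < T d ∧ 0 < ν d then 1 else 0 := by
    have key : ∀ p q, ({p, q, d} : Finset E3) ∈ P.simplices 3 → T p = 0 → T q = 0 → ν p = 0 →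
        ν q = 0 → θ p * θ q < 0 → θ p * θ d < 0 →
        (if Hits w y {p, q, d} then 1 else 0 : ZMod 2) + stripSum θ T ν {p, q, d} =
          if 0 < T d ∧ 0 < ν d then 1 else 0 := by
      intro p q ht hTp hTq hνp hνq hlt hlt'
      have htf := mem_simplices.1 ht
      obtain ⟨hpq, hpd, hqd⟩ := ne_of_card_eq_three htf.2
      rw [hits_y]
      exact hitAt_add_stripSum hpq hpd hqd hTp hTq hνp hνq hlt hlt'
        (hT1 p d (adj_of_mem htf.1 (by simp) (by simp) hpd) hlt')
    have hθab : θ a * θ b < 0 := by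
      have h0 := θM
      rw [hM, affine_combo₂] at h0
      have ha0 := hθv a hav
      have hb0 := hθv b hbv
      have h1 : 0 < θ a * θ a := mul_self_pos.2 ha0
      have h2 : (1 - r) * (θ a * θ a) + r * (θ a * θ b) = 0 := by linear_combination (θ a) * h0
      have h3 : 0 < (1 - r) * (θ a * θ a) := mul_pos (by linarith) h1
      by_contra hcon
      nlinarith [mul_nonneg hr0.le (not_lt.1 hcon)]
    have hd0 : θ d ≠ 0 := hθv d (mem_verts_of_mem hdf.1 (by simp))
    by_cases hs : θ a * θ d < 0
    · exact key a b hd Ta Tb νa νb hθab hs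
    · have hs' : θ b * θ d < 0 := by
        have h1 : 0 < θ a * θ d :=
          lt_of_le_of_ne (not_lt.1 hs) (mul_ne_zero (hθv a hav) hd0).symm
        have h2 : (θ a * θ a) * (θ b * θ d) < 0 := by
          have : (θ a * θ a) * (θ b * θ d) = (θ a * θ b) * (θ a * θ d) := by ring
          rw [this]
          exact mul_neg_of_neg_of_pos hθab h1
        by_contra hcon
        nlinarith [mul_nonneg (mul_self_nonneg (θ a)) (not_lt.1 hcon)]
      have hcomm : ({a, b, d} : Finset E3) = {b, a, d} := Finset.insert_comm _ _ _
      rw [hcomm]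
      exact key b a (hcomm ▸ hd) Tb Ta νb νa (by rwa [mul_comm]) hs'
  have hTd : 0 < T d ↔ 0 < D * inner ℝ w (cross (b - a) (d - a)) := by
    have : T d = (γ * (D * D))⁻¹ * (D * inner ℝ w (cross (b - a) (d - a))) := by
      rw [Tx]; field_simp
    rw [this, mul_pos_iff_of_pos_left (inv_pos.2 (mul_pos hγ (mul_self_pos.2 hD)))]
  have hνd : 0 < ν d ↔ 0 < D * inner ℝ n (d - a) := by
    have : ν d = (D * D)⁻¹ * (D * inner ℝ n (d - a)) := by
      rw [νx]; field_simp
    rw [this, mul_pos_iff_of_pos_left (inv_pos.2 (mul_self_pos.2 hD))]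
  simp only [← hTd, ← hνd]
  rw [← hnb]
  have hdS : ({a, b, d} : Finset E3) ∈ (P.simplices 3).erase {a, b, c} :=
    Finset.mem_erase.2 ⟨hne, hd⟩
  -- All strip sums cancel modulo 2 because each edge lies in two triangles. The first triangle
  -- contributes nothing, so only the neighbour accounts for the difference of the two counts.
  have htot := P.sum_stripSum θ T ν
  rw [← Finset.add_sum_erase _ _ hc, ← Finset.add_sum_erase _ _ hdS, hself, zero_add,
    ← Finset.sum_congr rfl hrest, Finset.sum_add_distrib] at htot
  rw [← Finset.add_sum_erase _ _ hdS]
  set x1 : ZMod 2 := if Hits w y {a, b, d} then 1 else 0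
  set x2 := ∑ t ∈ ((P.simplices 3).erase {a, b, c}).erase {a, b, d},
    (if Hits w y t then 1 else 0 : ZMod 2)
  set x3 := ∑ t ∈ ((P.simplices 3).erase {a, b, c}).erase {a, b, d},
    (if Hits w M t then 1 else 0 : ZMod 2)
  have htwo : ∀ u v x : ZMod 2, u + (v + x) = 0 → v = x + u := by decide
  rw [htwo _ _ _ htot]
  ring

end SimplicialSurface

theorem inner_cross_swap (w a b c : E3) :
    inner ℝ w (cross (a - b) (c - b)) = -inner ℝ w (cross (b - a) (c - a)) := by
  simp only [inner_eq, cross, PiLp.sub_apply, crossProduct, LinearMap.mk₂_apply]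
  simp
  ring

theorem inner_cross_cycle (w a b c : E3) :
    inner ℝ w (cross (c - b) (a - b)) = inner ℝ w (cross (b - a) (c - a)) := by
  simp only [inner_eq, cross, PiLp.sub_apply, crossProduct, LinearMap.mk₂_apply]
  simp
  ring

theorem inner_cross_swap_right (a b c d : E3) :
    inner ℝ (cross (b - a) (d - a)) (c - a) = -inner ℝ (cross (b - a) (c - a)) (d - a) := by
  simp only [inner_eq, cross, PiLp.sub_apply, crossProduct, LinearMap.mk₂_apply]
  simp
  ring

namespace SimplicialSurface

variable {P : SimplicialSurface}

/-- A closed polyhedral surface in space is orientable: the parity of the number of intersections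
of the surface with a generic ray tells the inside from the outside. -/
theorem nonempty_orientation (P : SimplicialSurface) : Nonempty P.Orientation := by
  obtain ⟨w, hw⟩ := P.exists_isGenericDir
  have h₁ : ∀ a b, ∃ m, P.Adj a b → P.IsGenericOnEdge w a b m := fun a b => by
    by_cases h : P.Adj a b
    · obtain ⟨m, hm⟩ := exists_isGenericOnEdge w h
      exact ⟨m, fun _ => hm⟩
    · exact ⟨0, fun h' => absurd h' h⟩
  choose m hm using h₁
  have h₂ : ∀ f, ∃ y, f ∈ P.simplices 3 → P.IsGenericOnTriangle w m f y := fun f => by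
    by_cases h : f ∈ P.simplices 3
    · obtain ⟨y, hy⟩ := exists_isGenericOnTriangle hw hm h
      exact ⟨y, fun _ => hy⟩
    · exact ⟨0, fun h' => absurd h' h⟩
  choose y hy using h₂
  -- The parity of the other triangles above a point of `f` tells inside from outside. A cyclic
  -- order is declared positive when its sense as seen along `w` matches this parity.
  set N : Finset E3 → ZMod 2 := fun f =>
    ∑ t ∈ (P.simplices 3).erase f, if Hits w (y f) t then 1 else 0 with hN
  refine ⟨⟨fun a b c => ({a, b, c} : Finset E3) ∈ P.simplices 3 ∧
    (0 < inner ℝ w (cross (b - a) (c - a)) ↔ N {a, b, c} = 0), fun a b c h => h.1, ?_, ?_, ?_, ?_⟩⟩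
  · rintro a b c ⟨h, h'⟩
    have hs : ({b, c, a} : Finset E3) = {a, b, c} := by
      ext x; simp only [Finset.mem_insert, Finset.mem_singleton]; tauto
    beta_reduce
    rw [hs, inner_cross_cycle]
    exact ⟨h, h'⟩
  · intro a b c h
    have hs : ({b, a, c} : Finset E3) = {a, b, c} := Finset.insert_comm _ _ _
    beta_reduce
    rw [hs, inner_cross_swap w a b c]
    rcases lt_or_gt_of_ne (hw.inner_ne_zero h) with h0 | h0 <;> by_cases h1 : N {a, b, c} = 0 <;>
      simp [h, h0, h1, not_lt.2 h0.le]
  · rintro a b c ⟨h, h'⟩ ⟨-, h''⟩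
    have hs : ({b, a, c} : Finset E3) = {a, b, c} := Finset.insert_comm _ _ _
    rw [hs, inner_cross_swap w a b c] at h''
    rcases lt_or_gt_of_ne (hw.inner_ne_zero h) with h0 | h0
    · exact absurd (h'.2 (h''.1 (by linarith))) (by linarith)
    · exact absurd (h''.2 (h'.1 h0)) (by linarith)
  -- Both parities are compared with the count at the common edge. If the triangles project to the
  -- same side of `ab`, exactly one has the other above it and the parities differ; if to different
  -- sides, the parities agree. Either way the two orders cannot both be positive.
  · rintro a b c d ⟨hc, hc'⟩ ⟨hd, hd'⟩
    by_contra hcd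
    obtain ⟨hab, -, -⟩ := ne_of_card_eq_three (mem_simplices.1 hc).2
    have hadj : P.Adj a b := adj_of_mem (mem_simplices.1 hc).1 (by simp) (by simp) hab
    have e₁ := sum_hits hw hc hd hcd (hm a b hadj) (hy _ hc)
    have e₂ := sum_hits hw hd hc (Ne.symm hcd) (hm a b hadj) (hy _ hd)
    rw [Finset.erase_right_comm] at e₂
    have hκ := inner_cross_ne_zero_of_faces hc hd hcd
    have hDc := hw.inner_ne_zero hc
    have hDd := hw.inner_ne_zero hd
    rw [inner_cross_swap_right a b c d] at e₂
    change N {a, b, c} = _ at e₁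
    change N {a, b, d} = _ at e₂
    rw [e₁] at hc'
    rw [e₂] at hd'
    generalize (inner ℝ (cross (b - a) (c - a)) (d - a) : ℝ) = κ at *
    generalize (inner ℝ w (cross (b - a) (c - a)) : ℝ) = x at *
    generalize (inner ℝ w (cross (b - a) (d - a)) : ℝ) = z at *
    generalize (∑ t ∈ ((P.simplices 3).erase {a, b, c}).erase {a, b, d},
        (if Hits w (m a b) t then 1 else 0 : ZMod 2)) = s at *
    have hs : s = 0 ∨ s = 1 := (by decide : ∀ s : ZMod 2, s = 0 ∨ s = 1) s
    have h10 : (1 : ZMod 2) ≠ 0 := by decide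
    have h11 : (1 : ZMod 2) + 1 = 0 := by decide
    clear e₁ e₂
    simp only [mul_pos_iff] at hc' hd'
    rcases lt_or_gt_of_ne hDc with hx | hx <;> rcases lt_or_gt_of_ne hDd with hz | hz <;>
      rcases lt_or_gt_of_ne hκ with hk | hk <;> rcases hs with rfl | rfl <;>
      simp [hx, hz, hk, not_lt.2 hx.le, not_lt.2 hz.le, not_lt.2 hk.le, h11] at hc' hd'

end SimplicialSurface

/-! ### Lifting circle valued maps on the sphere -/

theorem isDiscrete_range_intCast : IsDiscrete (Set.range ((↑) : ℤ → ℝ)) := by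
  rw [isDiscrete_iff_discreteTopology]
  exact Int.isClosedEmbedding_coe_real.isEmbedding.toHomeomorph.symm.isEmbedding.discreteTopology

theorem coe_addCircle_eq_iff {x y : ℝ} :
    (x : AddCircle (1 : ℝ)) = y ↔ x - y ∈ Set.range ((↑) : ℤ → ℝ) := by
  rw [← sub_eq_zero, ← AddCircle.coe_sub, AddCircle.coe_eq_zero_iff]
  simp [Set.mem_range]

/-- Two lifts of the same circle valued map on a connected set differ by a constant. -/
theorem sub_eq_sub_of_coe_eq {X : Type*} [TopologicalSpace X] {S : Set X} (hS : IsPreconnected S)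
    {f g : X → ℝ} (hf : ContinuousOn f S) (hg : ContinuousOn g S)
    (h : ∀ x ∈ S, (f x : AddCircle (1 : ℝ)) = g x) {x y : X} (hx : x ∈ S) (hy : y ∈ S) :
    f x - g x = f y - g y :=
  hS.constant_of_mapsTo isDiscrete_range_intCast (hf.sub hg)
    (fun z hz => coe_addCircle_eq_iff.1 (h z hz)) hx hy

theorem finrank_orthogonal_E3 {v : E3} (hv : ‖v‖ = 1) : Module.finrank ℝ (ℝ ∙ v)ᗮ = 2 := by
  have : Fact (Module.finrank ℝ E3 = 2 + 1) := ⟨by simp⟩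
  exact Submodule.finrank_orthogonal_span_singleton (by rintro rfl; simp at hv)

/-- A circle valued map on the sphere lifts over the complement of a point. -/
theorem exists_lift_compl_singleton {f : Metric.sphere (0 : E3) 1 → AddCircle (1 : ℝ)}
    (hf : Continuous f) (v : Metric.sphere (0 : E3) 1) :
    ∃ g : Metric.sphere (0 : E3) 1 → ℝ, ContinuousOn g {v}ᶜ ∧
      ∀ x, x ≠ v → (g x : AddCircle (1 : ℝ)) = f x := by
  have hv : ‖(v : E3)‖ = 1 := by simp
  set e := stereographic hv with he
  have hsrc : e.source = {v}ᶜ := stereographic_source hv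
  have hc : Continuous e.symm := by
    rw [← continuousOn_univ, ← stereographic_target hv]
    exact e.continuousOn_symm
  let F : C((ℝ ∙ (v : E3))ᗮ, AddCircle (1 : ℝ)) := ⟨fun y => f (e.symm y), hf.comp hc⟩
  obtain ⟨t, ht⟩ := QuotientAddGroup.mk_surjective (F 0)
  -- Through stereographic projection the map lives on a plane, which is simply connected.
  obtain ⟨G, ⟨-, hG⟩, -⟩ :=
    (AddCircle.isCoveringMap_coe (1 : ℝ)).existsUnique_continuousMap_lifts F 0 t ht
  refine ⟨fun x => G (e x), ?_, fun x hx => ?_⟩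
  · rw [← hsrc]
    exact G.continuous.comp_continuousOn e.continuousOn
  · have h1 := congrFun hG (e x)
    change (G (e x) : AddCircle (1 : ℝ)) = f (e.symm (e x)) at h1
    rwa [e.left_inv (by rw [hsrc]; exact hx)] at h1

/-- Stereographic projection from `v` takes `-v` to the origin, and a punctured plane is connected.
-/
theorem isPreconnected_compl_pair (v : Metric.sphere (0 : E3) 1) :
    IsPreconnected ({v}ᶜ ∩ {-v}ᶜ : Set (Metric.sphere (0 : E3) 1)) := by
  have hv : ‖(v : E3)‖ = 1 := by simp
  set e := stereographic hv with he
  have hsrc : e.source = {v}ᶜ := stereographic_source hv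
  have htgt : e.target = Set.univ := stereographic_target hv
  have hc : Continuous e.symm := by
    rw [← continuousOn_univ, ← htgt]
    exact e.continuousOn_symm
  have hneg : e (-v) = 0 := stereographic_apply_neg v
  have h1 : IsPreconnected ({0}ᶜ : Set (ℝ ∙ (v : E3))ᗮ) :=
    (isConnected_compl_singleton_of_one_lt_rank (by
      rw [← Module.finrank_eq_rank, finrank_orthogonal_E3 hv]; norm_num) 0).isPreconnected
  have hvs : -v ∈ e.source := by
    rw [hsrc]
    intro h
    exact ne_neg_of_mem_unit_sphere ℝ v h.symm
  have h2 : ({v}ᶜ ∩ {-v}ᶜ : Set (Metric.sphere (0 : E3) 1)) = e.symm '' {0}ᶜ := by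
    ext x
    constructor
    · rintro ⟨hx, hx'⟩
      have hxs : x ∈ e.source := by rw [hsrc]; exact hx
      refine ⟨e x, fun h0 => hx' (e.injOn hxs hvs ?_), e.left_inv hxs⟩
      rw [hneg]; exact h0
    · rintro ⟨y, hy, rfl⟩
      have hyt : y ∈ e.target := by rw [htgt]; trivial
      refine ⟨by rw [← hsrc]; exact e.map_target hyt, fun h0 => hy ?_⟩
      rw [Set.mem_singleton_iff] at h0 ⊢
      rw [← e.right_inv hyt, h0, hneg]
  rw [h2]
  exact h1.image _ hc.continuousOn

/-- Every circle valued map on the sphere lifts to a real valued map. -/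
theorem exists_lift_sphere {f : Metric.sphere (0 : E3) 1 → AddCircle (1 : ℝ)} (hf : Continuous f) :
    ∃ g : Metric.sphere (0 : E3) 1 → ℝ, Continuous g ∧ ∀ x, (g x : AddCircle (1 : ℝ)) = f x := by
  obtain ⟨v₀, hv₀⟩ : ∃ v : E3, ‖v‖ = 1 := ⟨EuclideanSpace.single 0 1, by simp⟩
  let v : Metric.sphere (0 : E3) 1 := ⟨v₀, by simpa using hv₀⟩
  have hvne : v ≠ -v := ne_neg_of_mem_unit_sphere ℝ v
  obtain ⟨g₁, hg₁, hf₁⟩ := exists_lift_compl_singleton hf v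
  obtain ⟨g₂, hg₂, hf₂⟩ := exists_lift_compl_singleton hf (-v)
  -- On the connected overlap the two lifts differ by a constant that is zero in the circle; after a
  -- shift by it they can be glued.
  obtain ⟨k, hk0, hk⟩ : ∃ k : ℝ, (k : AddCircle (1 : ℝ)) = 0 ∧
      ∀ x, x ≠ v → x ≠ -v → g₁ x = g₂ x + k := by
    by_cases hne : ∃ z, z ≠ v ∧ z ≠ -v
    · obtain ⟨z, hz, hz'⟩ := hne
      refine ⟨g₁ z - g₂ z, ?_, fun x hx hx' => ?_⟩
      · rw [AddCircle.coe_sub, hf₁ z hz, hf₂ z hz', sub_self]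
      · have := sub_eq_sub_of_coe_eq (isPreconnected_compl_pair v)
          (hg₁.mono Set.inter_subset_left) (hg₂.mono Set.inter_subset_right)
          (fun y hy => (hf₁ y hy.1).trans (hf₂ y hy.2).symm) (x := x) (y := z) ⟨hx, hx'⟩ ⟨hz, hz'⟩
        linarith
    · exact ⟨0, AddCircle.coe_zero _, fun x hx hx' => absurd ⟨x, hx, hx'⟩ hne⟩
  refine ⟨fun x => if x = v then g₂ x + k else g₁ x, ?_, fun x => ?_⟩
  · refine continuous_iff_continuousAt.2 fun x => ?_
    by_cases hx : x = v
    · have hx' : x ≠ -v := by rw [hx]; exact hvne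
      have h1 : ContinuousAt (fun y => g₂ y + k) x :=
        (hg₂.continuousAt (isOpen_compl_singleton.mem_nhds hx')).add continuousAt_const
      refine h1.congr ?_
      filter_upwards [isOpen_compl_singleton.mem_nhds hx'] with y hy
      by_cases hyv : y = v
      · simp [hyv]
      · rw [if_neg hyv, hk y hyv hy]
    · refine (hg₁.continuousAt (isOpen_compl_singleton.mem_nhds hx)).congr ?_
      filter_upwards [isOpen_compl_singleton.mem_nhds hx] with y hy
      exact (if_neg hy).symm
  · by_cases hx : x = v
    · beta_reduce
      rw [if_pos hx, AddCircle.coe_add, hk0, add_zero, hf₂ x (by rw [hx]; exact hvne)]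
    · beta_reduce
      rw [if_neg hx, hf₁ x hx]

/-- The vector is written in the basis dual to `x`, `y`, `x × y`. -/
theorem exists_inner_eq {x y : E3} (h : cross x y ≠ 0) (p q : ℝ) :
    ∃ φ : E3, inner ℝ φ x = p ∧ inner ℝ φ y = q := by
  set n := cross x y with hn
  have hnn : inner ℝ n n ≠ 0 := inner_self_ne_zero.2 h
  have h1 : inner ℝ (cross y n) x = inner ℝ n n := by
    rw [← inner_cross_rotate, ← hn]
  have h2 : inner ℝ (cross n x) y = inner ℝ n n := by
    rw [inner_cross_rotate, ← hn]
  refine ⟨(inner ℝ n n)⁻¹ • (p • cross y n + q • cross n x), ?_, ?_⟩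
  · rw [inner_smul_left, inner_add_left, inner_smul_left, inner_smul_left, h1,
      inner_cross_right_self]
    simp only [conj_trivial]
    field_simp
    ring
  · rw [inner_smul_left, inner_add_left, inner_smul_left, inner_smul_left, h2,
      inner_cross_left_self]
    simp only [conj_trivial]
    field_simp
    ring

/-! ### Integral cocycles and the Euler characteristic of a sphere -/

namespace SimplicialSurface

variable {P : SimplicialSurface}

/-- Take the affine function with value 0 at one corner and the prescribed increments along the two
edges there; the cocycle condition settles the third edge. -/
theorem exists_affine_primitive {c : E3 → E3 → ℤ} (hanti : ∀ a b, P.Adj a b → c b a = -c a b)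
    (hcyc : ∀ a b d, ({a, b, d} : Finset E3) ∈ P.simplices 3 → c a b + c b d + c d a = 0)
    {t : Finset E3} (ht : t ∈ P.simplices 3) :
    ∃ G : E3 →ᵃ[ℝ] ℝ, (∀ v ∈ t, ∃ n : ℤ, G v = n) ∧ ∀ a ∈ t, ∀ b ∈ t, a ≠ b → G b - G a = c a b := by
  obtain ⟨a, b, d, hab, had, hbd, rfl⟩ := Finset.card_eq_three.1 (mem_simplices.1 ht).2
  have hf := mem_simplices.1 ht
  obtain ⟨φ, hφb, hφd⟩ := exists_inner_eq (cross_ne_zero_of_face hf.1 hf.2) (c a b) (c a d)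
  have e₁ := hanti a b (adj_of_mem hf.1 (by simp) (by simp) hab)
  have e₂ := hanti a d (adj_of_mem hf.1 (by simp) (by simp) had)
  have e₃ := hanti b d (adj_of_mem hf.1 (by simp) (by simp) hbd)
  have e₄ := hcyc a b d ht
  have f₁ : (c b a : ℝ) = -c a b := by exact_mod_cast e₁
  have f₂ : (c d a : ℝ) = -c a d := by exact_mod_cast e₂
  have f₃ : (c d b : ℝ) = -c b d := by exact_mod_cast e₃
  have f₄ : (c a b : ℝ) + c b d + c d a = 0 := by exact_mod_cast e₄
  have ga : affineForm φ a a = 0 := by simp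
  have gb : affineForm φ a b = c a b := by rw [affineForm_apply, hφb]
  have gd : affineForm φ a d = c a d := by rw [affineForm_apply, hφd]
  refine ⟨affineForm φ a, ?_, ?_⟩
  · intro v hv
    simp only [Finset.mem_insert, Finset.mem_singleton] at hv
    rcases hv with rfl | rfl | rfl
    · exact ⟨0, by rw [ga]; simp⟩
    · exact ⟨_, gb⟩
    · exact ⟨_, gd⟩
  · intro x hx y hy hxy
    simp only [Finset.mem_insert, Finset.mem_singleton] at hx hy
    rcases hx with rfl | rfl | rfl <;> rcases hy with rfl | rfl | rfl <;>
      first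
      | exact absurd rfl hxy
      | (simp only [ga, gb, gd]; linarith)

theorem exists_triangle_of_mem_space {x : E3} (hx : x ∈ P.space) :
    ∃ t ∈ P.simplices 3, x ∈ convexHull ℝ (t : Set E3) := by
  obtain ⟨s, hs, hxs⟩ := Geometry.SimplicialComplex.mem_space_iff.1 hx
  obtain ⟨t, ht, ht3, hst⟩ := P.pure s hs
  exact ⟨t, mem_simplices.2 ⟨ht, ht3⟩, convexHull_mono (by exact_mod_cast hst) hxs⟩

/-- If the surface is a sphere, then every integral cocycle is a coboundary. -/
theorem exists_primitive (h : P.space ≃ₜ Metric.sphere (0 : E3) 1) {c : E3 → E3 → ℤ}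
    (hanti : ∀ a b, P.Adj a b → c b a = -c a b)
    (hcyc : ∀ a b d, ({a, b, d} : Finset E3) ∈ P.simplices 3 → c a b + c b d + c d a = 0) :
    ∃ g : E3 → ℤ, ∀ a b, P.Adj a b → c a b = g b - g a := by
  have h₁ : ∀ t, ∃ G : E3 →ᵃ[ℝ] ℝ, t ∈ P.simplices 3 → (∀ v ∈ t, ∃ n : ℤ, G v = n) ∧
      ∀ a ∈ t, ∀ b ∈ t, a ≠ b → G b - G a = c a b := fun t => by
    by_cases ht : t ∈ P.simplices 3
    · obtain ⟨G, hG⟩ := exists_affine_primitive hanti hcyc ht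
      exact ⟨G, fun _ => hG⟩
    · exact ⟨0, fun h' => absurd h' ht⟩
  choose G hG using h₁
  -- On a common face the affine primitives of two triangles differ by an integer constant, so they
  -- define one map to the circle.
  have hoverlap : ∀ t ∈ P.simplices 3, ∀ t' ∈ P.simplices 3, ∀ x ∈ convexHull ℝ (t : Set E3),
      x ∈ convexHull ℝ (t' : Set E3) → (G t x : AddCircle (1 : ℝ)) = G t' x := by
    intro t ht t' ht' x hx hx'
    have hx2 := P.inter_subset_convexHull (mem_simplices.1 ht).1 (mem_simplices.1 ht').1 ⟨hx, hx'⟩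
    obtain ⟨v, hv, hv'⟩ : ((t : Set E3) ∩ t').Nonempty := convexHull_nonempty_iff.1 ⟨x, hx2⟩
    obtain ⟨n, hn⟩ := (hG t ht).1 v hv
    obtain ⟨n', hn'⟩ := (hG t' ht').1 v hv'
    have hconv : Convex ℝ {z : E3 | (G t - G t') z = n - n'} :=
      (convex_singleton ((n : ℝ) - n')).affine_preimage (G t - G t')
    have hsub : ((t : Set E3) ∩ t') ⊆ {z : E3 | (G t - G t') z = n - n'} := by
      rintro z ⟨hz, hz'⟩
      change G t z - G t' z = n - n'
      by_cases hvz : v = z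
      · rw [← hvz, hn, hn']
      · have e₁ := (hG t ht).2 v hv z hz hvz
        have e₂ := (hG t' ht').2 v hv' z hz' hvz
        linarith
    have h2 : G t x - G t' x = n - n' := convexHull_min hsub hconv hx2
    rw [coe_addCircle_eq_iff, h2]
    exact ⟨n - n', by push_cast; rfl⟩
  have h₂ : ∀ x : P.space, ∃ y : AddCircle (1 : ℝ), ∀ t ∈ P.simplices 3,
      (x : E3) ∈ convexHull ℝ (t : Set E3) → y = G t x := by
    rintro ⟨x, hx⟩
    obtain ⟨t, ht, hxt⟩ := exists_triangle_of_mem_space hx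
    exact ⟨G t x, fun t' ht' hxt' => hoverlap t ht t' ht' x hxt hxt'⟩
  choose F hF using h₂
  have hFc : Continuous F := by
    refine LocallyFinite.continuous (f := fun t : P.simplices 3 =>
      {x : P.space | (x : E3) ∈ convexHull ℝ ((t : Finset E3) : Set E3)})
      (locallyFinite_of_finite _) ?_ ?_ ?_
    · refine Set.eq_univ_of_forall fun x => ?_
      obtain ⟨t, ht, hxt⟩ := exists_triangle_of_mem_space x.2
      exact Set.mem_iUnion.2 ⟨⟨t, ht⟩, hxt⟩
    · intro t
      exact ((t : Finset E3).finite_toSet.isClosed_convexHull (𝕜 := ℝ)).preimage continuous_subtype_val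
    · intro t
      have : Continuous fun x : P.space => ((G t x : ℝ) : AddCircle (1 : ℝ)) :=
        (AddCircle.continuous_mk' (1 : ℝ)).comp
          ((G t).continuous_of_finiteDimensional.comp continuous_subtype_val)
      exact this.continuousOn.congr fun x hx => hF x t t.2 hx
  -- The topology of the sphere enters here. The circle valued map is zero at the vertices, so the
  -- lift is integral there, and these integers are the primitive.
  obtain ⟨g, hg, hgF⟩ := exists_lift_sphere (hFc.comp h.symm.continuous)
  let L : E3 → ℝ := fun x => if hx : x ∈ P.space then g (h ⟨x, hx⟩) else 0
  have hL : ∀ x (hx : x ∈ P.space), L x = g (h ⟨x, hx⟩) := fun x hx => dif_pos hx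
  have hLc : ContinuousOn L P.space := by
    rw [continuousOn_iff_continuous_domRestrict]
    refine (hg.comp h.continuous).congr fun x => ?_
    exact (hL x x.2).symm
  have hLG : ∀ t ∈ P.simplices 3, ∀ x ∈ convexHull ℝ (t : Set E3),
      (L x : AddCircle (1 : ℝ)) = G t x := by
    intro t ht x hx
    have hxs : x ∈ P.space := P.convexHull_subset_space (mem_simplices.1 ht).1 hx
    rw [hL x hxs, hgF, ← hF ⟨x, hxs⟩ t ht hx]
    simp
  have hLint : ∀ v, ∃ n : ℤ, v ∈ P.verts → L v = n := by
    intro v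
    by_cases hv : v ∈ P.verts
    · obtain ⟨t, ht, ht3, hvt⟩ := P.pure {v} ((P.mem_verts v).1 hv)
      have ht' := mem_simplices.2 ⟨ht, ht3⟩
      have hvt' : v ∈ t := hvt (Finset.mem_singleton_self v)
      have h1 := hLG t ht' v (subset_convexHull ℝ _ hvt')
      obtain ⟨n, hn⟩ := (hG t ht').1 v hvt'
      obtain ⟨k, hk⟩ := coe_addCircle_eq_iff.1 h1
      exact ⟨k + n, fun _ => by push_cast; rw [hk, ← hn]; ring⟩
    · exact ⟨0, fun h' => absurd h' hv⟩
  choose k hk using hLint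
  refine ⟨k, fun a b hab => ?_⟩
  obtain ⟨t, ht, ht3, habt⟩ := P.pure {a, b} hab.2
  have ht' := mem_simplices.2 ⟨ht, ht3⟩
  have hat : a ∈ t := habt (by simp)
  have hbt : b ∈ t := habt (by simp)
  have h1 := sub_eq_sub_of_coe_eq (convex_convexHull ℝ (t : Set E3)).isPreconnected
    (hLc.mono (P.convexHull_subset_space ht)) (G t).continuous_of_finiteDimensional.continuousOn
    (hLG t ht') (subset_convexHull ℝ _ hat) (subset_convexHull ℝ _ hbt)
  have h2 := (hG t ht').2 a hat b hbt hab.1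
  rw [hk a hab.mem_left, hk b hab.mem_right] at h1
  have : (c a b : ℝ) = k b - k a := by linarith
  exact_mod_cast this

end SimplicialSurface

theorem finrank_range_add_finrank_ker_of_isDomain {R M N : Type} [CommRing R] [IsDomain R]
    [AddCommGroup M] [AddCommGroup N] [Module R M] [Module R N] [Module.Finite R M] (f : M →ₗ[R] N) :
    Module.finrank R (LinearMap.range f) + Module.finrank R (LinearMap.ker f) =
      Module.finrank R M := by
  rw [← f.quotKerEquivRange.finrank_eq, Submodule.finrank_quotient_add_finrank]

namespace SimplicialSurface

variable {P : SimplicialSurface}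

/-- The value of a simplicial one-cochain on a directed edge. The edges are directed upwards. -/
def cochainValue (P : SimplicialSurface) (ξ a b : E3) : (P.simplices 2 → ℤ) →ₗ[ℤ] ℤ :=
  if h : ({a, b} : Finset E3) ∈ P.simplices 2 then
    if inner ℝ ξ a < inner ℝ ξ b then LinearMap.proj ⟨{a, b}, h⟩ else -LinearMap.proj ⟨{a, b}, h⟩
  else 0

theorem cochainValue_swap {ξ : E3} (hg : P.IsGeneral ξ) {a b : E3} (h : P.Adj a b) :
    P.cochainValue ξ b a = -P.cochainValue ξ a b := by
  have hba : ({b, a} : Finset E3) ∈ P.simplices 2 := h.symm.edge_mem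
  have hs : (⟨{b, a}, hba⟩ : P.simplices 2) = ⟨{a, b}, h.edge_mem⟩ :=
    Subtype.ext (Finset.pair_comm _ _)
  rw [cochainValue, cochainValue, dif_pos hba, dif_pos h.edge_mem, hs]
  rcases lt_or_gt_of_ne (hg.ne h) with h1 | h1
  · rw [if_pos h1, if_neg h1.not_gt]
  · rw [if_neg h1.not_gt, if_pos h1, neg_neg]

namespace Orientation

/-- The simplicial coboundary of one-cochains. -/
def coboundary (o : P.Orientation) (ξ : E3) : (P.simplices 2 → ℤ) →ₗ[ℤ] (P.simplices 3 → ℤ) :=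
  LinearMap.pi fun f => ∑ p ∈ P.verts ×ˢ P.verts,
    if ∃ c, o.pos p.1 p.2 c ∧ (f : Finset E3) = {p.1, p.2, c} then P.cochainValue ξ p.1 p.2 else 0

/-- Every edge is traversed once in each direction by positively oriented triangles, and its two
contributions cancel. -/
theorem sum_coboundary (o : P.Orientation) {ξ : E3} (hg : P.IsGeneral ξ) (x : P.simplices 2 → ℤ) :
    ∑ f, o.coboundary ξ x f = 0 := by
  have h₁ : ∀ p : E3 × E3, ∑ f : P.simplices 3,
      (if ∃ c, o.pos p.1 p.2 c ∧ (f : Finset E3) = {p.1, p.2, c} then P.cochainValue ξ p.1 p.2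
        else 0) x = if P.Adj p.1 p.2 then P.cochainValue ξ p.1 p.2 x else 0 := by
    rintro ⟨a, b⟩
    by_cases h : P.Adj a b
    · obtain ⟨c, hc⟩ := o.exists_pos h
      rw [if_pos h, Finset.sum_eq_single ⟨{a, b, c}, o.mem _ _ _ hc⟩]
      · rw [if_pos ⟨c, hc, rfl⟩]
      · rintro ⟨f, hf⟩ - hne
        rw [if_neg]
        · rfl
        · rintro ⟨d, hd, he⟩
          have hdc := o.coherent _ _ _ _ hc hd
          subst hdc
          exact hne (Subtype.ext he)
      · simp
    · rw [if_neg h]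
      refine Finset.sum_eq_zero fun f _ => ?_
      rw [if_neg]
      · rfl
      · rintro ⟨d, hd, -⟩
        exact h (o.adj hd)
  have h₂ : ∀ f : P.simplices 3, o.coboundary ξ x f = ∑ p ∈ P.verts ×ˢ P.verts,
      (if ∃ c, o.pos p.1 p.2 c ∧ (f : Finset E3) = {p.1, p.2, c} then P.cochainValue ξ p.1 p.2
        else 0) x := by
    intro f
    rw [coboundary, LinearMap.pi_apply, LinearMap.sum_apply]
  rw [Finset.sum_congr rfl fun f _ => h₂ f, Finset.sum_comm, Finset.sum_congr rfl fun p _ => h₁ p]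
  refine Finset.sum_involution (fun p _ => p.swap) ?_ ?_ ?_ ?_
  · rintro ⟨a, b⟩ -
    change (if P.Adj a b then _ else _) + (if P.Adj b a then _ else _) = _
    by_cases h : P.Adj a b
    · rw [if_pos h, if_pos h.symm]
      change P.cochainValue ξ a b x + P.cochainValue ξ b a x = 0
      rw [cochainValue_swap hg h, LinearMap.neg_apply, add_neg_cancel]
    · rw [if_neg h, if_neg fun h' => h h'.symm, add_zero]
  · rintro ⟨a, b⟩ - hne heq
    have hab : b = a := congrArg Prod.fst heq
    refine hne (if_neg fun h => h.1 hab.symm)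
  · rintro ⟨a, b⟩ hp
    rw [Finset.mem_product] at hp ⊢
    exact ⟨hp.2, hp.1⟩
  · rintro ⟨a, b⟩ -
    rfl

theorem coboundary_apply (o : P.Orientation) {a b c : E3} (ξ : E3) (h : o.pos a b c)
    (x : P.simplices 2 → ℤ) : o.coboundary ξ x ⟨{a, b, c}, o.mem _ _ _ h⟩ =
      P.cochainValue ξ a b x + P.cochainValue ξ b c x + P.cochainValue ξ c a x := by
  have hbc := o.rotate _ _ _ h
  have hca := o.rotate _ _ _ hbc
  obtain ⟨hab, hac, hbc'⟩ := ne_of_card_eq_three (mem_simplices.1 (o.mem _ _ _ h)).2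
  have hav := (o.adj h).mem_left
  have hbv := (o.adj h).mem_right
  have hcv := (o.adj hca).mem_left
  have s₁ : ({b, c, a} : Finset E3) = {a, b, c} := by
    ext x; simp only [Finset.mem_insert, Finset.mem_singleton]; tauto
  have s₂ : ({c, a, b} : Finset E3) = {a, b, c} := by
    ext x; simp only [Finset.mem_insert, Finset.mem_singleton]; tauto
  have hasymm : ∀ p q r, o.pos p q r → ({a, b, c} : Finset E3) = {p, q, r} →
      (p, q) ∈ ({(a, b), (b, c), (c, a)} : Finset (E3 × E3)) := by
    intro p q r hp he
    have e₁ : p ∈ ({a, b, c} : Finset E3) := he ▸ (by simp)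
    have e₂ : q ∈ ({a, b, c} : Finset E3) := he ▸ (by simp)
    have e₃ : r ∈ ({a, b, c} : Finset E3) := he ▸ (by simp)
    obtain ⟨n₁, n₂, n₃⟩ := ne_of_card_eq_three (mem_simplices.1 (o.mem _ _ _ hp)).2
    have na := o.asymm _ _ _ h
    have nb := o.asymm _ _ _ hbc
    have nc := o.asymm _ _ _ hca
    simp only [Finset.mem_insert, Finset.mem_singleton] at e₁ e₂ e₃
    rcases e₁ with rfl | rfl | rfl <;> rcases e₂ with rfl | rfl | rfl <;>
      rcases e₃ with rfl | rfl | rfl <;>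
      first
      | exact absurd rfl n₁
      | exact absurd rfl n₂
      | exact absurd rfl n₃
      | exact absurd hp na
      | exact absurd hp nb
      | exact absurd hp nc
      | simp
  rw [coboundary, LinearMap.pi_apply, LinearMap.sum_apply,
    ← Finset.sum_subset (s₁ := {(a, b), (b, c), (c, a)})]
  · rw [Finset.sum_insert (by simp [hab, hac, hbc']), Finset.sum_pair (by simp [hbc', hac.symm]),
      if_pos ⟨c, h, rfl⟩, if_pos ⟨a, hbc, s₁.symm⟩, if_pos ⟨b, hca, s₂.symm⟩, add_assoc]
  · intro p hp
    simp only [Finset.mem_insert, Finset.mem_singleton] at hp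
    rcases hp with rfl | rfl | rfl <;> simp [hav, hbv, hcv]
  · rintro ⟨p, q⟩ - hn
    rw [if_neg]
    · rfl
    · rintro ⟨r, hr, he⟩
      exact hn (hasymm p q r hr he)

/-- A surface all of whose integral cocycles are coboundaries has Euler characteristic at least
two. -/
theorem two_le_eulerChar (o : P.Orientation) {ξ : E3} (hg : P.IsGeneral ξ)
    (hne : P.faces.Nonempty)
    (hprim : ∀ c : E3 → E3 → ℤ, (∀ a b, P.Adj a b → c b a = -c a b) →
      (∀ a b d, ({a, b, d} : Finset E3) ∈ P.simplices 3 → c a b + c b d + c d a = 0) →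
      ∃ g : E3 → ℤ, ∀ a b, P.Adj a b → c a b = g b - g a) : 2 ≤ P.eulerChar := by
  obtain ⟨s, hs⟩ := hne
  obtain ⟨t, ht, ht3, -⟩ := P.pure s hs
  have htm : t ∈ P.simplices 3 := mem_simplices.2 ⟨ht, ht3⟩
  obtain ⟨v, hv⟩ : t.Nonempty := Finset.card_pos.1 (by omega)
  have hvm := mem_verts_of_mem ht hv
  have hedge : ∀ e : P.simplices 2, ∃ p : P.verts × P.verts,
      (e : Finset E3) = {(p.1 : E3), (p.2 : E3)} ∧ inner ℝ ξ (p.1 : E3) < inner ℝ ξ (p.2 : E3) := by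
    rintro ⟨e, he⟩
    obtain ⟨a, b, hab, rfl⟩ := Finset.card_eq_two.1 (mem_simplices.1 he).2
    have hadj : P.Adj a b := ⟨hab, (mem_simplices.1 he).1⟩
    rcases lt_or_gt_of_ne (hg.ne hadj) with h | h
    · exact ⟨(⟨a, hadj.mem_left⟩, ⟨b, hadj.mem_right⟩), rfl, h⟩
    · exact ⟨(⟨b, hadj.mem_right⟩, ⟨a, hadj.mem_left⟩), Finset.pair_comm _ _, h⟩
  choose p hp hpξ using hedge
  -- The coboundary of functions on the vertices, with edges directed upwards as in `cochainValue`.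
  let d : (P.verts → ℤ) →ₗ[ℤ] (P.simplices 2 → ℤ) :=
    LinearMap.funLeft ℤ ℤ (fun e => (p e).2) - LinearMap.funLeft ℤ ℤ (fun e => (p e).1)
  have hker : LinearMap.ker (o.coboundary ξ) ≤ LinearMap.range d := by
    intro x hx
    rw [LinearMap.mem_ker] at hx
    have hpos : ∀ a b c, o.pos a b c → P.cochainValue ξ a b x + P.cochainValue ξ b c x +
        P.cochainValue ξ c a x = 0 := fun a b c h => by
      rw [← o.coboundary_apply ξ h x, hx]; rfl
    obtain ⟨g, hgx⟩ := hprim (fun a b => P.cochainValue ξ a b x)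
      (fun a b h => by rw [cochainValue_swap hg h, LinearMap.neg_apply]) (fun a b c h => by
        rcases o.total _ _ _ h with h1 | h1
        · exact hpos _ _ _ h1
        · have h2 := hpos _ _ _ h1
          obtain ⟨hab, hac, hbc⟩ := ne_of_card_eq_three (mem_simplices.1 h).2
          have hf := (mem_simplices.1 h).1
          have e₁ := congrArg (fun l => l x)
            (cochainValue_swap hg (adj_of_mem hf (a := a) (b := b) (by simp) (by simp) hab))
          have e₂ := congrArg (fun l => l x)
            (cochainValue_swap hg (adj_of_mem hf (a := a) (b := c) (by simp) (by simp) hac))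
          have e₃ := congrArg (fun l => l x)
            (cochainValue_swap hg (adj_of_mem hf (a := b) (b := c) (by simp) (by simp) hbc))
          simp only [LinearMap.neg_apply] at e₁ e₂ e₃
          linarith)
    refine ⟨fun v => g v, funext fun e => ?_⟩
    have hem : ({((p e).1 : E3), ((p e).2 : E3)} : Finset E3) ∈ P.simplices 2 := hp e ▸ e.2
    have hadj : P.Adj (p e).1 (p e).2 :=
      ⟨fun h => (hpξ e).ne (by rw [h]), (mem_simplices.1 hem).1⟩
    have h1 := hgx _ _ hadj
    have h2 : (⟨_, hem⟩ : P.simplices 2) = e := Subtype.ext (hp e).symm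
    rw [cochainValue, dif_pos hem, if_pos (hpξ e), h2, LinearMap.proj_apply] at h1
    rw [h1]
    rfl
  let σ : (P.simplices 3 → ℤ) →ₗ[ℤ] ℤ := ∑ f, LinearMap.proj f
  have hσ : ∀ y, σ y = ∑ f, y f := fun y => by simp [σ]
  have hrange : LinearMap.range (o.coboundary ξ) ≤ LinearMap.ker σ := by
    rintro _ ⟨x, rfl⟩
    rw [LinearMap.mem_ker, hσ, o.sum_coboundary hg]
  -- Let V, E, F be the numbers of vertices, edges and triangles. Then E ≤ rank d + rank δ, as the
  -- cocycles are coboundaries; rank d ≤ V − 1 because `d` kills constants, and rank δ ≤ F − 1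
  -- because the values of a coboundary add up to zero.
  have r₁ := finrank_range_add_finrank_ker_of_isDomain (o.coboundary ξ)
  have r₂ := finrank_range_add_finrank_ker_of_isDomain d
  have r₃ := finrank_range_add_finrank_ker_of_isDomain σ
  rw [Module.finrank_fintype_fun_eq_card, Fintype.card_coe] at r₁ r₂ r₃
  have i₁ := Submodule.finrank_mono hker
  have i₂ := Submodule.finrank_mono hrange
  have i₃ : 0 < Module.finrank ℤ (LinearMap.ker d) := by
    have : Nontrivial (LinearMap.ker d) := by
      refine ⟨⟨⟨fun _ => 1, ?_⟩, 0, fun h => ?_⟩⟩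
      · rw [LinearMap.mem_ker]
        ext e
        simp [d, LinearMap.funLeft]
      · exact one_ne_zero (congrFun (congrArg Subtype.val h) ⟨v, hvm⟩)
    exact Module.finrank_pos
  have i₄ : 0 < Module.finrank ℤ (LinearMap.range σ) := by
    have : Nontrivial (LinearMap.range σ) := by
      refine ⟨⟨⟨1, Pi.single ⟨t, htm⟩ 1, ?_⟩, 0, fun h => ?_⟩⟩
      · rw [hσ, Finset.sum_pi_single']; simp
      · exact one_ne_zero (congrArg Subtype.val h)
    exact Module.finrank_pos
  rw [eulerChar, card_simplices_one]
  omega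

end Orientation

end SimplicialSurface

/-! ### The three critical points and the final assembly -/

namespace SimplicialSurface

variable {P : SimplicialSurface}

section

variable {ξ vmax vmin v₀ : E3}

theorem Orientation.index_eq_one_of_max (o : P.Orientation) (hg : P.IsGeneral ξ)
    (hle : ∀ x ∈ P.verts, inner ℝ ξ x ≤ inner ℝ ξ vmax) : P.index vmax ξ = 1 :=
  o.index_eq_one_of_below hg fun _ h => lt_of_le_of_ne (hle _ h.mem_right) (hg.ne h).symm

theorem Orientation.index_eq_one_of_min (o : P.Orientation) (hg : P.IsGeneral ξ)
    (hge : ∀ x ∈ P.verts, inner ℝ ξ vmin ≤ inner ℝ ξ x) : P.index vmin ξ = 1 :=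
  o.index_eq_one_of_above hg fun _ h => lt_of_le_of_ne (hge _ h.mem_right) (hg.ne h)

theorem exists_adj {v : E3} (hv : v ∈ P.verts) : ∃ a, P.Adj v a := by
  obtain ⟨t, ht, ht3, hvt⟩ := P.pure {v} ((P.mem_verts v).1 hv)
  have hvt' : v ∈ t := hvt (Finset.mem_singleton_self v)
  obtain ⟨a, ha, hav⟩ := Finset.exists_mem_ne (by omega : 1 < t.card) v
  exact ⟨a, adj_of_mem ht hvt' ha hav.symm⟩

theorem max_ne_min (hg : P.IsGeneral ξ) (hmax : vmax ∈ P.verts)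
    (hle : ∀ x ∈ P.verts, inner ℝ ξ x ≤ inner ℝ ξ vmax)
    (hge : ∀ x ∈ P.verts, inner ℝ ξ vmin ≤ inner ℝ ξ x) : vmax ≠ vmin := by
  rintro rfl
  obtain ⟨a, ha⟩ := exists_adj hmax
  exact hg.ne ha (le_antisymm (hge a ha.mem_right) (hle a ha.mem_right))

theorem criticalPoints_eq (o : P.Orientation) (hg : P.IsGeneral ξ)
    (hcrit : (P.criticalPoints ξ).ncard = 3) (hmax : vmax ∈ P.verts) (hmin : vmin ∈ P.verts)
    (h₀ : v₀ ∈ P.criticalPoints ξ) (hle : ∀ x ∈ P.verts, inner ℝ ξ x ≤ inner ℝ ξ vmax)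
    (hge : ∀ x ∈ P.verts, inner ℝ ξ vmin ≤ inner ℝ ξ x) (h0max : v₀ ≠ vmax) (h0min : v₀ ≠ vmin) :
    {vmax, vmin, v₀} = P.criticalPoints ξ := by
  refine Set.eq_of_subset_of_ncard_le ?_ ?_ (Set.finite_of_ncard_ne_zero (by omega))
  · rintro x (rfl | rfl | rfl)
    · exact ⟨(P.mem_verts _).1 hmax, by rw [o.index_eq_one_of_max hg hle]; exact one_ne_zero⟩
    · exact ⟨(P.mem_verts _).1 hmin, by rw [o.index_eq_one_of_min hg hge]; exact one_ne_zero⟩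
    · exact h₀
  · rw [hcrit, Set.ncard_eq_three.2 ⟨vmax, vmin, v₀, max_ne_min hg hmax hle hge, h0max.symm,
      h0min.symm, rfl⟩]

theorem index_eq_eulerChar_sub_two (o : P.Orientation) (hg : P.IsGeneral ξ)
    (hcrit : (P.criticalPoints ξ).ncard = 3) (hmax : vmax ∈ P.verts) (hmin : vmin ∈ P.verts)
    (h₀ : v₀ ∈ P.criticalPoints ξ) (hle : ∀ x ∈ P.verts, inner ℝ ξ x ≤ inner ℝ ξ vmax)
    (hge : ∀ x ∈ P.verts, inner ℝ ξ vmin ≤ inner ℝ ξ x) (h0max : v₀ ≠ vmax) (h0min : v₀ ≠ vmin) :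
    P.index v₀ ξ = P.eulerChar - 2 := by
  have heq := criticalPoints_eq o hg hcrit hmax hmin h₀ hle hge h0max h0min
  have hsum := index_add_index_add_index hg hmax hmin ((P.mem_verts _).2 h₀.1)
    (max_ne_min hg hmax hle hge) h0max.symm h0min.symm (fun x hx h1 h2 h3 => by
      by_contra hne
      have hmem : x ∈ P.criticalPoints ξ := ⟨(P.mem_verts _).1 hx, hne⟩
      rw [← heq] at hmem
      rcases hmem with h | h | h
      · exact h1 h
      · exact h2 h
      · exact h3 h)
  rw [o.index_eq_one_of_max hg hle, o.index_eq_one_of_min hg hge] at hsum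
  linarith

theorem exists_max_min_third (hcrit : (P.criticalPoints ξ).ncard = 3) :
    ∃ vmax ∈ P.verts, ∃ vmin ∈ P.verts, ∃ v₀ ∈ P.criticalPoints ξ,
      (∀ x ∈ P.verts, inner ℝ ξ x ≤ inner ℝ ξ vmax) ∧
      (∀ x ∈ P.verts, inner ℝ ξ vmin ≤ inner ℝ ξ x) ∧ v₀ ≠ vmax ∧ v₀ ≠ vmin := by
  obtain ⟨v, hv⟩ : (P.criticalPoints ξ).Nonempty := Set.nonempty_of_ncard_ne_zero (by omega)
  have hne : P.verts.Nonempty := ⟨v, (P.mem_verts v).2 hv.1⟩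
  obtain ⟨vmax, hmax, hle⟩ := P.verts.exists_max_image (fun x => inner ℝ ξ x) hne
  obtain ⟨vmin, hmin, hge⟩ := P.verts.exists_min_image (fun x => inner ℝ ξ x) hne
  obtain ⟨v₀, h₀, h0⟩ : ∃ v₀ ∈ P.criticalPoints ξ, v₀ ∉ ({vmax, vmin} : Set E3) := by
    refine Set.exists_mem_notMem_of_ncard_lt_ncard ?_ (Set.toFinite _)
    rw [hcrit]
    have := Set.ncard_insert_le vmax {vmin}
    rw [Set.ncard_singleton] at this
    omega
  simp only [Set.mem_insert_iff, Set.mem_singleton_iff, not_or] at h0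
  exact ⟨vmax, hmax, vmin, hmin, v₀, h₀, hle, hge, h0.1, h0.2⟩

theorem mem_space_of_mem_verts {v : E3} (hv : v ∈ P.verts) : v ∈ P.space :=
  P.vertices_subset_space ((P.mem_verts v).1 hv)

end

end SimplicialSurface

end

theorem theorem3 (P : SimplicialSurface) (ξ : E3) (hξ : ‖ξ‖ = 1) (hgen : P.IsGeneral ξ)
    (hcrit : (P.criticalPoints ξ).ncard = 3) :
    (∀ vmax ∈ P.vertices, ∀ vmin ∈ P.vertices, ∀ v₀ ∈ P.criticalPoints ξ,
      IsMaxOn (fun x : E3 => inner ℝ ξ x) P.space vmax →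
      IsMinOn (fun x : E3 => inner ℝ ξ x) P.space vmin →
      v₀ ≠ vmax → v₀ ≠ vmin →
        (∀ o : P.Orientation, o.HasNormalDegree v₀ ξ 0) ∧
        P.index v₀ ξ = P.eulerChar - 2) ∧
    (¬ Nonempty (P.space ≃ₜ Metric.sphere (0 : E3) 1)) ∧
    ¬ P.IsTransversal := by
  -- The index formula and the last two claims mention no orientation, but their proofs use one.
  obtain ⟨o⟩ := P.nonempty_orientation
  obtain ⟨top, htop, bot, hbot, w, hw, hwtop, hwbot, hne, hne'⟩ :=
    SimplicialSurface.exists_max_min_third hcrit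
  refine ⟨?_, ?_, ?_⟩
  · intro vmax hmax vmin hmin v₀ h₀ hle hge h0max h0min
    rw [← P.mem_verts] at hmax hmin
    have hle' : ∀ x ∈ P.verts, inner ℝ ξ x ≤ inner ℝ ξ vmax := fun x hx =>
      hle (SimplicialSurface.mem_space_of_mem_verts hx)
    have hge' : ∀ x ∈ P.verts, inner ℝ ξ vmin ≤ inner ℝ ξ x := fun x hx =>
      hge (SimplicialSurface.mem_space_of_mem_verts hx)
    exact ⟨fun o => SimplicialSurface.hasNormalDegree_zero o hξ hgen hcrit hmax hmin h₀ hle' hge'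
        h0max h0min,
      SimplicialSurface.index_eq_eulerChar_sub_two o hgen hcrit hmax hmin h₀ hle' hge' h0max h0min⟩
  · rintro ⟨e⟩
    have h₁ := SimplicialSurface.index_le_of_ncard o hgen hcrit htop hbot hw hwtop hwbot hne hne'
    have h₂ := SimplicialSurface.index_eq_eulerChar_sub_two o hgen hcrit htop hbot hw hwtop hwbot
      hne hne'
    -- The index is at most −1, so χ(P) ≤ 1, whereas a sphere would give χ(P) ≥ 2.
    have h₃ := o.two_le_eulerChar hgen ⟨_, (P.mem_verts _).1 htop⟩
      fun c => SimplicialSurface.exists_primitive e (c := c)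
    omega
  · intro h
    exact SimplicialSurface.not_hasTransversePlane_of_ncard o hgen hcrit htop hbot hw hwtop hwbot
      hne hne' (h w hw.1)
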